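/- Let $S$ be a closed connected oriented smooth surface (of negative Euler characteristic), $x_0\in S$, and let $\rho_l,\rho_r:\pi_1(S,x_0)\to \mathrm{PSL}_2\mathbb R$ be Fuchsian representations, whose quotients $\mathbb H^2/\rho_l(\pi_1(S))$ and $\mathbb H^2/\rho_r(\pi_1(S))$ are identified, compatibly with $\pi_1(S,x_0)$ and with orientations, with $S$ equipped with hyperbolic metrics $h_l,h_r$. Let $\Omega_\rho=p_l^*\Omega_l-p_r^*\Omega_r$ on $S\times S$, where $\Omega_l,\Omega_r$ are the area forms of $h_l,h_r$, and let $\Lambda:S\to(S\times S,\Omega_\rho)$ be a smooth Lagrangian embedding ($\Lambda^*\Omega_\rho=0$) which is smoothly isotopic to the diagonal through embeddings. Let $G=\widetilde{\mathrm{SL}_2\mathbb R}$ be the universal cover of $\mathrm{PSL}_2\mathbb R$, with centre $\mathcal Z$. Anti-de Sitter space is $\mathrm{PSL}_2\mathbb R$ with the bi-invariant Lorentzian metric equal to $\frac18$ of the Killing form, and its universal cover is $G$ with the pulled-back metric. Let $T$ be the bundle of future-directed unit timelike vectors of $G$, $\varphi_t$ the geodesic flow on $T$, $\chi$ its generator,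 $g_S$ the Sasaki metric, and $\omega=-g_S(\chi,\cdot)$. Let $\pi:T\to\mathbb H^2\times\mathbb H^2$ send a vector to the pair $(x,y)$ such that the geodesic it generates projects to $\{\gamma\in\mathrm{PSL}_2\mathbb R:\gamma(y)=x\}$; this is a principal $\mathbb R$-bundle for the action of $\varphi_t$. Let $\widetilde\rho:\pi_1(S,x_0)\to (G\times G)/\{(\xi,\xi):\xi\in\mathcal Z\}$ be the standard lift of $\rho=(\rho_l,\rho_r)$, i.e. the lift which preserves every component of the preimage, in the boundary at infinity of the universal cover of anti-de Sitter space, of the graph in $\mathbb{RP}^1\times\mathbb{RP}^1$ of the orientation-preserving homeomorphism conjugating $\rho_l$ to $\rho_r$. Let $P_\rho=T/\widetilde\rho(\pi_1(S,x_0))$, a principal $\mathbb R$-bundle over $(\mathbb H^2\times\mathbb H^2)/\rho(\pi_1(S,x_0))$, with the connection form $\omega_\rho$ induced by $\omega$. Then $\Lambda$ has a $\rho$-equivariant lift $\widetilde\Lambda:\widetilde S\to\mathbb H^2\times\mathbb H^2$ to the universal covers. It induces a map $S\to(\mathbb H^2\times\mathbb H^2)/\rho(\pi_1(S,x_0))$,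 and $\Lambda^*P_\rho\to S$ denotes the pull-back of $P_\rho$ by this map. Let $\Sigma$ be any smooth global section of $\Lambda^*P_\rho\to S$. Then the holonomy of $\Lambda^*P_\rho$ is well defined: there is a unique homomorphism $\mathrm{hol}:\pi_1(S,x_0)\to\mathbb R$ such that, along every $C^1$ loop $\ell:[0,1]\to S$ based at $x_0$, there are parallel sections, i.e. $C^1$ maps $p$ with $p(s)\in(\Lambda^*P_\rho)_{\ell(s)}$ and $\omega_\rho(p'(s))=0$, and for each of them $t=\mathrm{hol}([\ell])$ is the unique real number with $p(0)=\varphi_t(p(1))$. Moreover, for every $\tau\in\pi_1(S,x_0)$ and every $C^1$ loop $\ell$ representing $\tau$, $$\mathrm{hol}(\tau)=\int_\ell\Sigma^*\omega_\rho .$$ -/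

import Mathlib

open scoped Manifold ContDiff MatrixGroups Topology UpperHalfPlane
open MeasureTheory

noncomputable section

namespace AdS

/-! ### The universal cover of `SL(2,ℝ)` and of anti-de Sitter space -/

/-- The universal covering group of `SL(2,ℝ)` (hence of `PSL(2,ℝ)`): pairs `(A, f)` where `A` is in
`SL(2,ℝ)` and `f : ℝ ≃ₜ ℝ` is a lift, through `θ ↦ (cos θ, sin θ)`, of the action of `A` on the
circle of directions of `ℝ²`. -/
def univSL2 : Subgroup (SL(2, ℝ) × (ℝ ≃ₜ ℝ)) where
  carrier := {g | ∀ θ : ℝ, ∃ r : ℝ, 0 < r ∧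
    (g.1 : Matrix (Fin 2) (Fin 2) ℝ).mulVec ![Real.cos θ, Real.sin θ]
      = r • ![Real.cos (g.2 θ), Real.sin (g.2 θ)]}
  mul_mem' := by
    intro a b ha hb θ
    obtain ⟨r, hr, h⟩ := hb θ
    obtain ⟨s, hs, h'⟩ := ha (b.2 θ)
    refine ⟨r * s, mul_pos hr hs, ?_⟩
    have e : (((a * b).1 : SL(2, ℝ)) : Matrix (Fin 2) (Fin 2) ℝ) = a.1.1 * b.1.1 := rfl
    rw [e, ← Matrix.mulVec_mulVec, h, Matrix.mulVec_smul, h', smul_smul]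
    rfl
  one_mem' := by
    intro θ
    exact ⟨1, one_pos, by simp⟩
  inv_mem' := by
    intro a ha θ
    obtain ⟨r, hr, h⟩ := ha (a.2.symm θ)
    refine ⟨r⁻¹, inv_pos.2 hr, ?_⟩
    rw [a.2.apply_symm_apply] at h
    have e : ((a⁻¹).1 : Matrix (Fin 2) (Fin 2) ℝ).mulVec
        ((a.1 : Matrix (Fin 2) (Fin 2) ℝ).mulVec
          ![Real.cos (a.2.symm θ), Real.sin (a.2.symm θ)])
        = ![Real.cos (a.2.symm θ), Real.sin (a.2.symm θ)] := by
      rw [Matrix.mulVec_mulVec]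
      have : ((a⁻¹).1 : Matrix (Fin 2) (Fin 2) ℝ) * (a.1 : Matrix (Fin 2) (Fin 2) ℝ) = 1 := by
        have h2 : (a⁻¹).1 * a.1 = 1 := inv_mul_cancel a.1
        exact congrArg Subtype.val h2
      rw [this, Matrix.one_mulVec]
    rw [h, Matrix.mulVec_smul] at e
    have e2 : (a⁻¹).2 θ = a.2.symm θ := rfl
    rw [e2, ← e, smul_smul, inv_mul_cancel₀ hr.ne', one_smul]

/-- The universal covering group, as a type. -/
abbrev UnivSL2 : Type := univSL2

/-- The matrix in `SL(2,ℝ)` under a point of the universal cover. -/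
def UnivSL2.mat (g : UnivSL2) : SL(2, ℝ) := g.1.1

/-- The homeomorphism of `ℝ` by which a point of the universal cover acts on directions. -/
def UnivSL2.angle (g : UnivSL2) : ℝ ≃ₜ ℝ := g.1.2

/-- The covering homomorphism onto `PSL(2,ℝ)`. -/
def UnivSL2.proj (g : UnivSL2) : PSL(2, ℝ) := QuotientGroup.mk g.mat

/-- The Lorentzian metric of anti-de Sitter space on the Lie algebra `𝔰𝔩(2,ℝ)`, namely
`1/8` of the Killing form `4 tr(XY)`. -/
def adsForm (X Y : Matrix (Fin 2) (Fin 2) ℝ) : ℝ := (1 / 2) * (X * Y).trace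

/-- The unit future timelike tangent bundle of the universal cover of anti-de Sitter space.
A tangent vector `u` at `γ` is recorded by its left translate `vec = γ⁻¹ u ∈ 𝔰𝔩(2,ℝ)`; the
time orientation is the one for which the generator of counterclockwise rotations of the
hyperbolic plane around a point is future directed. -/
@[ext] structure T1 where
  pt : UnivSL2
  vec : Matrix (Fin 2) (Fin 2) ℝ
  trace_vec : vec.trace = 0
  unit : adsForm vec vec = -1
  future : vec 1 0 < 0

/-- Coordinates `(γ, γ⁻¹u)` on the unit tangent bundle of `SL(2,ℝ)`, by two matrices. -/
abbrev Coord : Type := (Fin 2 → Fin 2 → ℝ) × (Fin 2 → Fin 2 → ℝ)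

/-- The covering map from `T1` onto the unit future tangent bundle of `SL(2,ℝ)`, a submanifold of
the vector space `Coord`. It is a local diffeomorphism: a map into `T1` is smooth if and only if it
is continuous and its composition with `T1.coord` is smooth, and a tangent vector of `T1` is
identified with its image in `Coord`. -/
def T1.coord (q : T1) : Coord :=
  (fun i j => (q.pt.mat : Matrix (Fin 2) (Fin 2) ℝ) i j, fun i j => q.vec i j)

/-- The topology of `T1`: the universal cover of `SL(2,ℝ)` is embedded in `SL(2,ℝ) × ℝ`
by `(A, f) ↦ (A, f 0)`. -/
instance : TopologicalSpace T1 :=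
  TopologicalSpace.induced (fun q : T1 => (q.coord, q.pt.angle 0)) inferInstance

/-- The differential of the projection to anti-de Sitter space, left translated to `𝔰𝔩(2,ℝ)`. -/
def horPart (q : T1) (X : Coord) : Matrix (Fin 2) (Fin 2) ℝ :=
  ((q.pt.mat⁻¹ : SL(2, ℝ)) : Matrix (Fin 2) (Fin 2) ℝ) * Matrix.of X.1

/-- The vertical component of a tangent vector `X = (γ̇, U̇)` at `(γ, γU)`, left translated. The
Levi-Civita connection of a bi-invariant metric is `∇_{γW}(γU) = γ(U̇ + [W,U]/2)`. -/
def vertPart (q : T1) (X : Coord) : Matrix (Fin 2) (Fin 2) ℝ :=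
  Matrix.of X.2 + (1 / 2 : ℝ) • (horPart q X * q.vec - q.vec * horPart q X)

/-- The horizontal lift at `q = (γ, u)` of the tangent vector `γW`. -/
def horLift (q : T1) (W : Matrix (Fin 2) (Fin 2) ℝ) : Coord :=
  (fun i j => ((q.pt.mat : Matrix (Fin 2) (Fin 2) ℝ) * W) i j,
    fun i j => (-(1 / 2 : ℝ) • (W * q.vec - q.vec * W)) i j)

/-- The Sasaki metric. -/
def sasaki (q : T1) (X Y : Coord) : ℝ :=
  adsForm (horPart q X) (horPart q Y) + adsForm (vertPart q X) (vertPart q Y)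

/-- The generator `χ(γ,u) = u^h` of the geodesic flow. -/
def geodGen (q : T1) : Coord := horLift q q.vec

/-- The connection form `ω = -g_S(χ, ·)`. -/
def connForm (q : T1) (X : Coord) : ℝ := -sasaki q (geodGen q) X

/-- The geodesic flow as a relation: `FlowTo t q q'` says `q' = φ_t(q)`, i.e. `q'` is the time `t`
point of the integral curve of `χ` issuing from `q` (the velocity curve of a geodesic). -/
def FlowTo (t : ℝ) (q q' : T1) : Prop :=
  ∃ c : ℝ → T1, Continuous c ∧ c 0 = q ∧ c t = q' ∧
    ∀ s : ℝ, HasDerivAt (fun s => (c s).coord) (geodGen (c s)) s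

/-- `π(q) = (x, y)`: the geodesic with initial datum `q` projects into the timelike geodesic
`L_{x,y} = {γ | γ(y) = x}`. -/
def ProjectsTo (q : T1) (xy : ℍ × ℍ) : Prop :=
  ∀ (t : ℝ) (q' : T1), FlowTo t q q' → q'.pt.mat • xy.2 = xy.1

/-! ### Isometries -/

/-- The diagonal of the centre of the universal cover. -/
def diagCenter : Subgroup (UnivSL2 × UnivSL2) where
  carrier := {g | g.1 ∈ Subgroup.center UnivSL2 ∧ g.1 = g.2}
  mul_mem' := by
    rintro a b ⟨ha, ha'⟩ ⟨hb, hb'⟩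
    exact ⟨mul_mem ha hb, by simp [ha', hb']⟩
  one_mem' := ⟨one_mem _, rfl⟩
  inv_mem' := by
    rintro a ⟨ha, ha'⟩
    exact ⟨inv_mem ha, by simp [ha']⟩

instance : diagCenter.Normal where
  conj_mem := by
    rintro ⟨a, b⟩ ⟨ha, hab⟩ ⟨g, h⟩
    change a = b at hab
    subst hab
    change a ∈ _ at ha
    rw [Subgroup.mem_center_iff] at ha
    have e : ∀ g : UnivSL2, g * a * g⁻¹ = a := fun g => by rw [ha g, mul_inv_cancel_right]
    refine ⟨?_, ?_⟩
    · change g * a * g⁻¹ ∈ _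
      rw [e g, Subgroup.mem_center_iff]
      exact ha
    · change g * a * g⁻¹ = h * a * h⁻¹
      rw [e g, e h]

/-- The identity component of the isometry group of the universal cover of anti-de Sitter space. -/
abbrev Isom0 : Type := (UnivSL2 × UnivSL2) ⧸ diagCenter

/-- Conjugation of a `2 × 2` matrix by an element of `SL(2,ℝ)`. -/
def Ad (B : SL(2, ℝ)) (U : Matrix (Fin 2) (Fin 2) ℝ) : Matrix (Fin 2) (Fin 2) ℝ :=
  (B : Matrix (Fin 2) (Fin 2) ℝ) * U * ((B⁻¹ : SL(2, ℝ)) : Matrix (Fin 2) (Fin 2) ℝ)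

lemma inv_mul_coe (B : SL(2, ℝ)) : ((B⁻¹ : SL(2, ℝ)) : Matrix (Fin 2) (Fin 2) ℝ) *
    (B : Matrix (Fin 2) (Fin 2) ℝ) = 1 :=
  congrArg Subtype.val (inv_mul_cancel B)

lemma trace_Ad (B : SL(2, ℝ)) (U : Matrix (Fin 2) (Fin 2) ℝ) : (Ad B U).trace = U.trace := by
  rw [Ad, Matrix.trace_mul_comm, ← Matrix.mul_assoc, inv_mul_coe, Matrix.one_mul]

lemma Ad_mul (B : SL(2, ℝ)) (U V : Matrix (Fin 2) (Fin 2) ℝ) : Ad B U * Ad B V = Ad B (U * V) := by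
  have h := inv_mul_coe B
  unfold Ad
  calc _ = (B : Matrix (Fin 2) (Fin 2) ℝ) * U * ((((B⁻¹ : SL(2, ℝ)) : Matrix (Fin 2) (Fin 2) ℝ) *
        (B : Matrix (Fin 2) (Fin 2) ℝ))) * V *
        ((B⁻¹ : SL(2, ℝ)) : Matrix (Fin 2) (Fin 2) ℝ) := by simp only [Matrix.mul_assoc]
    _ = _ := by rw [h, Matrix.mul_one]; simp only [Matrix.mul_assoc]

lemma Ad_future (B : SL(2, ℝ)) (U : Matrix (Fin 2) (Fin 2) ℝ) (h0 : U.trace = 0)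
    (h1 : adsForm U U = -1) (h2 : U 1 0 < 0) : (Ad B U) 1 0 < 0 := by
  have hB : B 0 0 * B 1 1 - B 0 1 * B 1 0 = 1 := by
    have := B.det_coe
    rwa [Matrix.det_fin_two] at this
  have h3 : U 1 1 = -U 0 0 := by
    rw [Matrix.trace_fin_two] at h0; linarith
  have h4 : U 0 0 ^ 2 + U 0 1 * U 1 0 = -1 := by
    simp only [adsForm, Matrix.trace_fin_two, Matrix.mul_apply, Fin.sum_univ_two, h3] at h1
    nlinarith
  have h5 : (Ad B U) 1 0 = 2 * U 0 0 * B 1 0 * B 1 1 + U 1 0 * B 1 1 ^ 2 - U 0 1 * B 1 0 ^ 2 := by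
    have hi : ((B⁻¹ : SL(2, ℝ)) : Matrix (Fin 2) (Fin 2) ℝ) = !![B 1 1, -B 0 1; -B 1 0, B 0 0] := by
      rw [Matrix.SpecialLinearGroup.coe_inv, Matrix.adjugate_fin_two]
    rw [Ad, hi]
    simp only [Matrix.mul_apply, Fin.sum_univ_two, Matrix.of_apply, Matrix.cons_val', h3,
      Matrix.cons_val_zero, Matrix.cons_val_one, Matrix.cons_val_fin_one]
    ring
  rw [h5]
  by_contra hc
  push Not at hc
  have h6 : U 1 0 * (2 * U 0 0 * B 1 0 * B 1 1 + U 1 0 * B 1 1 ^ 2 - U 0 1 * B 1 0 ^ 2)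
      = (U 1 0 * B 1 1 + U 0 0 * B 1 0) ^ 2 + B 1 0 ^ 2 := by
    linear_combination (-B 1 0 ^ 2) * h4
  have h7 : (U 1 0 * B 1 1 + U 0 0 * B 1 0) ^ 2 + B 1 0 ^ 2 ≤ 0 := by
    rw [← h6]; exact mul_nonpos_of_nonpos_of_nonneg h2.le hc
  have h8 : B 1 0 = 0 := by nlinarith [sq_nonneg (U 1 0 * B 1 1 + U 0 0 * B 1 0), sq_nonneg (B 1 0)]
  rw [h8] at h7 hB
  have h9 : U 1 0 * B 1 1 = 0 := by nlinarith [sq_nonneg (U 1 0 * B 1 1)]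
  rcases mul_eq_zero.1 h9 with h | h
  · exact h2.ne h
  · rw [h] at hB; simp at hB

/-- The isometry `γ ↦ α γ β⁻¹` acts on `T1` by its differential; in the left trivialisation
`(γ, γU) ↦ (αγβ⁻¹, αγUβ⁻¹)` is `(γ, U) ↦ (αγβ⁻¹, βUβ⁻¹)`. -/
instance : MulAction (UnivSL2 × UnivSL2) T1 where
  smul g q :=
    { pt := g.1 * q.pt * g.2⁻¹
      vec := Ad g.2.mat q.vec
      trace_vec := by rw [trace_Ad, q.trace_vec]
      unit := by rw [adsForm, Ad_mul, trace_Ad]; exact q.unit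
      future := Ad_future _ _ q.trace_vec q.unit q.future }
  one_smul q := by
    refine T1.ext ?_ ?_
    · change 1 * q.pt * 1⁻¹ = q.pt
      simp
    · change Ad (1 : SL(2, ℝ)) q.vec = q.vec
      simp [Ad]
  mul_smul g h q := by
    refine T1.ext ?_ ?_
    · change g.1 * h.1 * q.pt * (g.2 * h.2)⁻¹ = g.1 * (h.1 * q.pt * h.2⁻¹) * g.2⁻¹
      group
    · change Ad (g.2.mat * h.2.mat) q.vec = Ad g.2.mat (Ad h.2.mat q.vec)
      simp only [Ad, mul_inv_rev, Matrix.SpecialLinearGroup.coe_mul, Matrix.mul_assoc]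

/-- The action of `PSL(2,ℝ)` on the hyperbolic plane. -/
def pslAct : PSL(2, ℝ) →* Equiv.Perm ℍ :=
  QuotientGroup.lift (Subgroup.center SL(2, ℝ)) (MulAction.toPermHom SL(2, ℝ) ℍ) (by
    intro A hA
    obtain ⟨r, hr, h⟩ := Matrix.SpecialLinearGroup.mem_center_iff.1 hA
    have hr0 : (r : ℂ) ≠ 0 := by
      rintro h0
      have : r = 0 := by exact_mod_cast h0
      simp [this] at hr
    ext z
    have h00 : A 0 0 = r := by simp [← h]
    have h01 : A 0 1 = 0 := by simp [← h]
    have h10 : A 1 0 = 0 := by simp [← h]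
    have h11 : A 1 1 = r := by simp [← h]
    simp [MulAction.toPermHom, UpperHalfPlane.specialLinearGroup_apply, h00, h01, h10, h11, hr0])

/-! ### The principal bundle of a representation -/

section Bundle

variable {G : Type*} [Group G]

/-- The pairs in `UnivSL2 × UnivSL2` which represent an isometry in the image of `ρt`. -/
def liftGroup (ρt : G →* Isom0) : Subgroup (UnivSL2 × UnivSL2) :=
  ρt.range.comap (QuotientGroup.mk' diagCenter)

/-- The total space `P_ρ`: the quotient of `T1` by the image of `ρt`. -/
def Bundle (ρt : G →* Isom0) : Type :=
  MulAction.orbitRel.Quotient (liftGroup ρt) T1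

/-- The quotient map `T1 → P_ρ`. -/
def Bundle.mk (ρt : G →* Isom0) (q : T1) : Bundle ρt :=
  (Quotient.mk (MulAction.orbitRel (liftGroup ρt) T1) q :)

/-- The `ℝ`-action on `P_ρ` as a relation: `p' = φ_t(p)`. -/
def Bundle.FlowTo {ρt : G →* Isom0} (t : ℝ) (p p' : Bundle ρt) : Prop :=
  ∃ q q' : T1, Bundle.mk ρt q = p ∧ Bundle.mk ρt q' = p' ∧ AdS.FlowTo t q q'

/-- `ρt` lifts `(ρl, ρr)`. -/
def IsLift (ρl ρr : G →* PSL(2, ℝ)) (ρt : G →* Isom0) : Prop :=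
  ∀ (τ : G) (g : UnivSL2 × UnivSL2), (QuotientGroup.mk g : Isom0) = ρt τ →
    g.1.proj = ρl τ ∧ g.2.proj = ρr τ

/-- `ρt` is the standard lift of `(ρl, ρr)`. The boundary at infinity of the universal cover of
anti-de Sitter space is the quotient of `ℝ × ℝ`, the universal cover of `ℝP¹ × ℝP¹`, by
`(θ, θ') ↦ (θ + π, θ' + π)`, and `(α, β)` acts on it by the lifted actions of `α` and `β`. The
components of the preimage of the graph of an orientation-preserving homeomorphism of `ℝP¹` are the
graphs of its lifts `φ`; invariance of one of them under `ρt` (hence of all) means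
`β ∘ φ = φ ∘ α`, and this includes that the homeomorphism conjugates `ρl` to `ρr`. -/
def IsStandardLift (ρl ρr : G →* PSL(2, ℝ)) (ρt : G →* Isom0) : Prop :=
  IsLift ρl ρr ρt ∧
  ∃ φ : ℝ ≃ₜ ℝ, StrictMono φ ∧ (∀ θ, φ (θ + Real.pi) = φ θ + Real.pi) ∧
    ∀ (τ : G) (g : UnivSL2 × UnivSL2), (QuotientGroup.mk g : Isom0) = ρt τ →
      ∀ θ, g.2.angle (φ θ) = φ (g.1.angle θ)

variable {E H M : Type*} [NormedAddCommGroup E] [NormedSpace ℝ E] [TopologicalSpace H]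
  (I : ModelWithCorners ℝ E H) [TopologicalSpace M] [ChartedSpace H M]

/-- `F` is, near `x` within `A`, a `C^n` lift to `T1` of the map `f` into `P_ρ`. -/
def IsLocalLift {ρt : G →* Isom0} (n : ℕ∞ω) (f : M → Bundle ρt) (A : Set M) (x : M)
    (F : M → T1) : Prop :=
  ∃ O : Set M, IsOpen O ∧ x ∈ O ∧ (∀ y ∈ A ∩ O, Bundle.mk ρt (F y) = f y) ∧
    ContinuousOn F (A ∩ O) ∧ ContMDiffOn I 𝓘(ℝ, Coord) n (fun y => (F y).coord) (A ∩ O)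

/-- `f` is a `C^n` map on `A` into the quotient manifold `P_ρ`. -/
def Bundle.ContMDiffOn {ρt : G →* Isom0} (n : ℕ∞ω) (f : M → Bundle ρt) (A : Set M) : Prop :=
  ∀ x ∈ A, ∃ F : M → T1, IsLocalLift I n f A x F

open Classical in
/-- The pull-back `f^*ω_ρ` at `x` on the vector `v`, for a `C¹` map `f` on `A` into `P_ρ`: as `ω_ρ`
is induced by `ω`, it is `ω(dF(v))` for any local lift `F` of `f`. -/
def Bundle.pullbackForm {ρt : G →* Isom0} (f : M → Bundle ρt) (A : Set M) (x : M)
    (v : TangentSpace I x) : ℝ :=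
  if h : ∃ F : M → T1, IsLocalLift I 1 f A x F then
    connForm (h.choose x) (mfderivWithin I 𝓘(ℝ, Coord) (fun y => (h.choose y).coord) A x v)
  else 0

end Bundle

/-! ### Fuchsian representations and Lagrangian embeddings -/

section Surface

variable {S : Type*} [TopologicalSpace S] [ChartedSpace (EuclideanSpace ℝ (Fin 2)) S]

/-- `ρ : π₁(S, x₀) → PSL(2,ℝ)` is Fuchsian, with quotient of the hyperbolic plane identified with
the surface `S`, oriented by `o`, through the covering `q : ℍ → S`: `q` is a smooth
orientation-preserving covering on which `π₁(S, x₀)` acts by deck transformations through `ρ`.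
Products in Mathlib's fundamental group are `[γ][γ'] = [first γ', then γ]`; for this convention
the deck transformation of `[γ]` maps the end of the lift of `γ` issuing from the base point `z₀`
back to `z₀`. -/
structure IsFuchsian (o : ∀ x : S, Orientation ℝ (TangentSpace (𝓡 2) x) (Fin 2)) {x₀ : S}
    (ρ : FundamentalGroup S x₀ →* PSL(2, ℝ)) (q : ℍ → S) (z₀ : ℍ) : Prop where
  base : q z₀ = x₀
  covering : IsCoveringMap q
  localDiffeo : IsLocalDiffeomorph 𝓘(ℝ, ℂ) (𝓡 2) ∞ q
  oriented : ∀ (z : ℍ) (e : ℂ ≃L[ℝ] TangentSpace (𝓡 2) (q z)),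
    (∀ a : ℂ, e a = mfderiv 𝓘(ℝ, ℂ) (𝓡 2) q z a) →
      Orientation.map (Fin 2) e.toLinearEquiv Complex.orientation = o (q z)
  deck : ∀ τ z, q (pslAct (ρ τ) z) = q z
  monodromy : ∀ (γ : Path x₀ x₀) (Γ : C(unitInterval, ℍ)), Γ 0 = z₀ → (∀ s, q (Γ s) = γ s) →
    pslAct (ρ (FundamentalGroup.fromPath (Path.Homotopic.Quotient.mk γ))) (Γ 1) = z₀

/-- The area form `dx ∧ dy / y²` of the hyperbolic plane. -/
def hypArea (z : ℍ) (a b : ℂ) : ℝ := (a.re * b.im - a.im * b.re) / z.im ^ 2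

open Classical in
/-- The area form induced on `S` by a covering `q : ℍ → S` whose deck group acts by
orientation-preserving isometries: the hyperbolic area form at any point over `x`. -/
def areaForm (q : ℍ → S) (x : S) (v w : TangentSpace (𝓡 2) x) : ℝ :=
  if h : ∃ z, q z = x then
    hypArea h.choose
      ((mfderiv 𝓘(ℝ, ℂ) (𝓡 2) q h.choose).inverse v)
      ((mfderiv 𝓘(ℝ, ℂ) (𝓡 2) q h.choose).inverse w)
  else 0

/-- The symplectic form `Ω_ρ = p_l^* Ω_l - p_r^* Ω_r` on `S × S`. -/
def sympForm (ql qr : ℍ → S) (x : S × S)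
    (v w : TangentSpace (𝓡 2) x.1 × TangentSpace (𝓡 2) x.2) : ℝ :=
  areaForm ql x.1 v.1 w.1 - areaForm qr x.2 v.2 w.2

/-- The space `𝓜_ρ` of Lagrangian embeddings `S → (S × S, Ω_ρ)` isotopic to the diagonal. -/
structure IsLagrangianIsotopicToDiag (ql qr : ℍ → S) (Λ : S → S × S) : Prop where
  lagrangian : ∀ (x : S) (v w : TangentSpace (𝓡 2) x),
    sympForm ql qr (Λ x) (mfderiv (𝓡 2) ((𝓡 2).prod (𝓡 2)) Λ x v)
      (mfderiv (𝓡 2) ((𝓡 2).prod (𝓡 2)) Λ x w) = 0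
  isotopic : ∃ F : ℝ → S → S × S,
    ContMDiff (𝓘(ℝ, ℝ).prod (𝓡 2)) ((𝓡 2).prod (𝓡 2)) ∞ (Function.uncurry F) ∧
    (∀ t, Manifold.IsSmoothEmbedding (𝓡 2) ((𝓡 2).prod (𝓡 2)) ∞ (F t)) ∧
    (∀ x, F 0 x = (x, x)) ∧ F 1 = Λ

/-- `Λt` is the `ρ`-equivariant lift of `Λ : S → S × S` to the universal covers; the universal
cover of the source is `ql : ℍ → S`, that of the target is `ql × qr : ℍ × ℍ → S × S`. -/
structure IsEquivariantLift {x₀ : S} (ρl ρr : FundamentalGroup S x₀ →* PSL(2, ℝ))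
    (ql qr : ℍ → S) (Λ : S → S × S) (Λt : ℍ → ℍ × ℍ) : Prop where
  continuous : Continuous Λt
  covers : ∀ z, (ql (Λt z).1, qr (Λt z).2) = Λ (ql z)
  equivariant : ∀ τ z,
    Λt (pslAct (ρl τ) z) = (pslAct (ρl τ) (Λt z).1, pslAct (ρr τ) (Λt z).2)

/-- The fibre over `x : S` of the pull-back bundle `Λ^*P_ρ`: the points of `P_ρ` which lie over the
class of `Λt z` in the quotient of `ℍ × ℍ` by `ρ`, where `z` is a point over `x`. -/
def fiber {G : Type*} [Group G] (ρt : G →* Isom0) (ql : ℍ → S) (Λt : ℍ → ℍ × ℍ) (x : S) :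
    Set (Bundle ρt) :=
  {p | ∃ (z : ℍ) (q : T1), ql z = x ∧ Bundle.mk ρt q = p ∧ ProjectsTo q (Λt z)}

/-- `f` is a global smooth section of the bundle over `S` with fibres `B x ⊆ P_ρ`. -/
structure IsSmoothSection {G : Type*} [Group G] {ρt : G →* Isom0} (B : S → Set (Bundle ρt))
    (f : S → Bundle ρt) : Prop where
  mem : ∀ x, f x ∈ B x
  smooth : Bundle.ContMDiffOn (𝓡 2) ∞ f Set.univ

/-- A `C¹` loop, parametrised by `[0,1]`. -/
def IsC1Loop {x₀ : S} (l : Path x₀ x₀) : Prop :=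
  ContMDiffOn 𝓘(ℝ, ℝ) (𝓡 2) 1 l.extend (Set.Icc 0 1)

/-- `p : [0,1] → P_ρ` is a parallel section, along the loop `l`, of the bundle with fibres `B x`:
`p(s)` is in the fibre over `l(s)` and `ω_ρ(p'(s)) = 0`. -/
structure IsParallelAlong {G : Type*} [Group G] {ρt : G →* Isom0} (B : S → Set (Bundle ρt))
    {x₀ : S} (l : Path x₀ x₀) (p : ℝ → Bundle ρt) : Prop where
  mem : ∀ s ∈ Set.Icc (0 : ℝ) 1, p s ∈ B (l.extend s)
  smooth : Bundle.ContMDiffOn 𝓘(ℝ, ℝ) 1 p (Set.Icc 0 1)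
  parallel : ∀ s ∈ Set.Icc (0 : ℝ) 1,
    Bundle.pullbackForm 𝓘(ℝ, ℝ) p (Set.Icc 0 1) s (1 : ℝ) = 0

/-- `hol` is the holonomy representation of the bundle with fibres `B x`: along every loop `l`
there are parallel sections, and for each of them `p(0) = φ_t(p(1))` for exactly one `t`,
namely `t = hol([l])`. -/
def IsHolonomy {G : Type*} [Group G] {ρt : G →* Isom0} (B : S → Set (Bundle ρt)) {x₀ : S}
    (hol : FundamentalGroup S x₀ →* Multiplicative ℝ) : Prop :=
  ∀ l : Path x₀ x₀, IsC1Loop l →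
    (∃ p, IsParallelAlong B l p) ∧
    ∀ p, IsParallelAlong B l p → ∀ t : ℝ, Bundle.FlowTo t (p 1) (p 0) ↔
      t = (hol (FundamentalGroup.fromPath (Path.Homotopic.Quotient.mk l))).toAdd

/-- The integral of `f^*ω_ρ` along the loop `l`. -/
def integralAlong {G : Type*} [Group G] {ρt : G →* Isom0} (f : S → Bundle ρt) {x₀ : S}
    (l : Path x₀ x₀) : ℝ :=
  ∫ s in (0 : ℝ)..1, Bundle.pullbackForm (𝓡 2) f Set.univ (l.extend s)
    (mfderivWithin 𝓘(ℝ, ℝ) (𝓡 2) l.extend (Set.Icc 0 1) s (1 : ℝ))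

end Surface

end AdS

end

/-! The bundle of future unit timelike vectors is trivialised by `ℝ × ℍ × ℍ`. Let `bor z` be the
upper triangular element moving `i` to `z`, and `rot t` the clockwise rotation lifted to the
universal cover. The Iwasawa decomposition shows that every vector has a unique expression `triple t
x y`, with base point `bor x * rot t * (bor y)⁻¹` and with the generator of rotations around `y` as
left-translated vector (`triple_coords`, `triple_inj`). In these coordinates: - the geodesic flow is
translation in `t`, and `(x, y)` is the projection to `ℍ × ℍ` (`flowTo_triple_iff`,
`projectsTo_iff`); - a pair of isometries acts on `(x, y)` by its two components and shifts `t` by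
an amount depending on `(x, y)` only (`smul_triple`); - the connection form is `dt + (Re dx / Im x -
Re dy / Im y) / 2` (`exists_hasDerivWithinAt_triple`).

Since `d(Re dx / Im x)` is the hyperbolic area form (`exists_hasFDerivAt_potForm`), the curvature is
half the difference of the two area forms, which the Lagrangian condition kills along the
equivariant lift `Λt`. The half-plane is convex, so the Poincaré lemma gives a function `h₁` with
connection form `dt + dh₁` along `Λt` (`IsEquivariantLift.exists_isPrimitive`). A curve over `Λt` is
therefore parallel exactly when `t + h₁` is constant.

A section `f` is written upstairs as `f (ql z) = [triple (k z) (Λt z)]`. Deck transformations act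
freely, so `k` is determined by `f`; it is `C¹` along curves because a local lift of `f` differs
from its coordinate expression by one fixed isometry (`IsLift.exists_smul_eq`). Put `K = k + h₁`.
The derivatives of `K` and of its translate by a deck transformation both compute the pull-back of
the connection form by `f`, so `K z - K (τ z)` does not depend on `z`
(`IsSmoothSection.sub_deck_eq`), and these constants form a homomorphism
(`IsSmoothSection.exists_period`).

Along a lift `Γ` of a loop in the class `τ`, one has `τ (Γ 1) = Γ 0`, so the constant of `τ` is `K
(Γ 1) - K (Γ 0)`. Comparing a parallel section with `f` identifies it with the holonomy
(`IsSmoothSection.isHolonomy`), and the fundamental theorem of calculus identifies it with the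
integral (`IsSmoothSection.integralAlong_eq`). Uniqueness holds because each class contains a `C¹`
loop. -/

namespace AdS

/-! ### Continuous angle functions -/

/-- Two continuous real functions on a preconnected set with the same cosine and sine agree as
soon as they agree at one point. -/
lemma eqOn_of_cos_sin_eq {X : Type*} [TopologicalSpace X] {s : Set X} (hs : IsPreconnected s)
    {f g : X → ℝ} (hf : ContinuousOn f s) (hg : ContinuousOn g s)
    (hc : ∀ x ∈ s, Real.cos (f x) = Real.cos (g x)) (hsn : ∀ x ∈ s, Real.sin (f x) = Real.sin (g x))
    {x₀ : X} (hx₀ : x₀ ∈ s) (h₀ : f x₀ = g x₀) : Set.EqOn f g s :=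
  (AddCircle.isCoveringMap_coe (2 * Real.pi)).eqOn_of_comp_eqOn hs hf hg
    (fun x hx => Real.Angle.cos_sin_inj (hc x hx) (hsn x hx)) hx₀ h₀

lemma eq_of_cos_sin_eq {f g : ℝ → ℝ} (hf : Continuous f) (hg : Continuous g)
    (hc : ∀ x, Real.cos (f x) = Real.cos (g x)) (hsn : ∀ x, Real.sin (f x) = Real.sin (g x))
    (x₀ : ℝ) (h₀ : f x₀ = g x₀) : f = g :=
  funext fun x => eqOn_of_cos_sin_eq isPreconnected_univ hf.continuousOn hg.continuousOn
    (fun x _ => hc x) (fun x _ => hsn x) (Set.mem_univ x₀) h₀ (Set.mem_univ x)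

/-- Both direction vectors have norm one, so comparing squared norms forces the two positive factors
to coincide. -/
lemma cos_sin_eq_of_smul_eq {r s θ η : ℝ} (hr : 0 < r) (hs : 0 < s)
    (h : r • ![Real.cos θ, Real.sin θ] = s • ![Real.cos η, Real.sin η]) :
    Real.cos θ = Real.cos η ∧ Real.sin θ = Real.sin η := by
  have h0 : r * Real.cos θ = s * Real.cos η := by simpa using congrFun h 0
  have h1 : r * Real.sin θ = s * Real.sin η := by simpa using congrFun h 1
  have h2 : r ^ 2 = s ^ 2 := by
    have e1 := Real.sin_sq_add_cos_sq θ
    have e2 := Real.sin_sq_add_cos_sq η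
    calc r ^ 2 = (r * Real.cos θ) ^ 2 + (r * Real.sin θ) ^ 2 := by linear_combination (-r ^ 2) * e1
      _ = (s * Real.cos η) ^ 2 + (s * Real.sin η) ^ 2 := by rw [h0, h1]
      _ = s ^ 2 := by linear_combination (s ^ 2) * e2
  have h3 : r = s := (pow_left_inj₀ hr.le hs.le two_ne_zero).1 h2
  subst h3
  exact ⟨mul_left_cancel₀ hr.ne' h0, mul_left_cancel₀ hr.ne' h1⟩

namespace UnivSL2

lemma angle_spec (g : UnivSL2) (θ : ℝ) : ∃ r : ℝ, 0 < r ∧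
    (g.mat : Matrix (Fin 2) (Fin 2) ℝ).mulVec ![Real.cos θ, Real.sin θ]
      = r • ![Real.cos (g.angle θ), Real.sin (g.angle θ)] := g.2 θ

@[simp] lemma mat_mul (g h : UnivSL2) : (g * h).mat = g.mat * h.mat := rfl
@[simp] lemma mat_inv (g : UnivSL2) : (g⁻¹).mat = (g.mat)⁻¹ := rfl
@[simp] lemma angle_mul (g h : UnivSL2) (θ : ℝ) : (g * h).angle θ = g.angle (h.angle θ) := rfl
@[simp] lemma mat_one : (1 : UnivSL2).mat = 1 := rfl
@[simp] lemma angle_inv (g : UnivSL2) (θ : ℝ) : (g⁻¹).angle θ = g.angle.symm θ := rfl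
@[simp] lemma angle_one (θ : ℝ) : (1 : UnivSL2).angle θ = θ := rfl

/-- A point of the universal cover is determined by its matrix and one value of its angle
function. -/
lemma ext_angle {g h : UnivSL2} (hm : g.mat = h.mat) {θ₀ : ℝ} (h₀ : g.angle θ₀ = h.angle θ₀) :
    g = h := by
  have key : ∀ θ, Real.cos (g.angle θ) = Real.cos (h.angle θ) ∧
      Real.sin (g.angle θ) = Real.sin (h.angle θ) := by
    intro θ
    obtain ⟨r, hr, e⟩ := g.angle_spec θ
    obtain ⟨s, hs, e'⟩ := h.angle_spec θ
    rw [hm, e'] at e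
    exact cos_sin_eq_of_smul_eq hr hs e.symm
  have := eq_of_cos_sin_eq g.angle.continuous h.angle.continuous (fun θ => (key θ).1)
    (fun θ => (key θ).2) θ₀ h₀
  exact Subtype.ext (Prod.ext hm (Homeomorph.ext fun θ => congrFun this θ))

end UnivSL2

/-! ### Rotations and upper triangular matrices -/

/-- The matrix of the clockwise rotation of angle `t`. -/
noncomputable def rotMat (t : ℝ) : SL(2, ℝ) :=
  ⟨!![Real.cos t, Real.sin t; -Real.sin t, Real.cos t], by
    rw [Matrix.det_fin_two_of]; linear_combination Real.sin_sq_add_cos_sq t⟩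

/-- The clockwise rotation of angle `t`, as a point of the universal cover. -/
noncomputable def rot (t : ℝ) : UnivSL2 :=
  ⟨(rotMat t, Homeomorph.addRight (-t)), fun θ => ⟨1, one_pos, by
    ext i
    fin_cases i
    · simp [rotMat, Matrix.mulVec, dotProduct, Fin.sum_univ_two, ← sub_eq_add_neg, Real.cos_sub]
      ring
    · simp [rotMat, Matrix.mulVec, dotProduct, Fin.sum_univ_two, ← sub_eq_add_neg, Real.sin_sub]
      ring⟩⟩

@[simp] lemma rot_mat (t : ℝ) : (rot t).mat = rotMat t := rfl
@[simp] lemma rot_angle (t θ : ℝ) : (rot t).angle θ = θ - t := (sub_eq_add_neg θ t).symm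

lemma sl_mul_apply (A B : SL(2, ℝ)) (i j : Fin 2) :
    (A * B) i j = A i 0 * B 0 j + A i 1 * B 1 j := by
  rw [Matrix.SpecialLinearGroup.coe_mul, Matrix.mul_apply, Fin.sum_univ_two]

lemma rot_add (s t : ℝ) : rot (s + t) = rot s * rot t := by
  refine UnivSL2.ext_angle (θ₀ := 0) ?_ (by simp; ring)
  ext i j
  rw [UnivSL2.mat_mul, sl_mul_apply]
  fin_cases i <;> fin_cases j <;>
    simp [rotMat, Real.cos_add, Real.sin_add] <;> ring

lemma rot_zero : rot 0 = 1 := by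
  refine UnivSL2.ext_angle (θ₀ := 0) ?_ (by simp)
  ext i j
  fin_cases i <;> fin_cases j <;> simp [rotMat]

/-- The complex number `e^{-iθ} B e^{iθ}`, for `B` upper triangular with diagonal `a, 1/a` and
off-diagonal entry `b`. -/
noncomputable def triVec (a b θ : ℝ) : ℂ :=
  ⟨a * Real.cos θ ^ 2 + b * Real.sin θ * Real.cos θ + a⁻¹ * Real.sin θ ^ 2,
    (a⁻¹ - a) * Real.sin θ * Real.cos θ - b * Real.sin θ ^ 2⟩

/-- If `e^{-iθ} B e^{iθ}` were real and nonpositive, `e^{iθ}` would be an eigenvector of `B` with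
that eigenvalue, whereas the eigenvalues are `a` and `a⁻¹`. Hence the principal argument is
continuous here and gives a global lift of the action on directions. -/
lemma triVec_mem_slitPlane {a : ℝ} (ha : 0 < a) (b θ : ℝ) : triVec a b θ ∈ Complex.slitPlane := by
  rw [Complex.mem_slitPlane_iff]
  by_contra! h
  obtain ⟨h1, h2⟩ := h
  have cs := Real.sin_sq_add_cos_sq θ
  have ha' := inv_pos.2 ha
  set c := Real.cos θ
  set s := Real.sin θ
  simp only [triVec] at h1 h2
  set x := a * c ^ 2 + b * s * c + a⁻¹ * s ^ 2 with hx
  -- The second row of the eigenvector equation `B v = x v` at `v = (c, s)`.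
  have e1 : s * (a⁻¹ - x) = 0 := by
    have : s * (a⁻¹ - x) = c * ((a⁻¹ - a) * s * c - b * s ^ 2) := by
      rw [hx]; linear_combination (-a⁻¹ * s) * cs
    rw [this]; exact mul_eq_zero_of_right _ h2
  have hs0 : s = 0 := by
    rcases mul_eq_zero.1 e1 with h | h
    · exact h
    · linarith
  rw [hs0] at cs
  have hx1 : x = a := by rw [hx, hs0]; linear_combination a * cs
  linarith

/-- The lift, fixing `0`, of the action on directions of the upper triangular matrix with first
row `a, b`. -/
noncomputable def triAngle (a b θ : ℝ) : ℝ := θ + (triVec a b θ).arg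

lemma triAngle_zero {a : ℝ} (ha : 0 < a) (b : ℝ) : triAngle a b 0 = 0 := by
  have : triVec a b 0 = (a : ℂ) := by
    apply Complex.ext <;> simp [triVec]
  rw [triAngle, this, Complex.arg_ofReal_of_nonneg ha.le, add_zero]

lemma triVec_continuousOn : ContinuousOn (fun p : ℝ × ℝ × ℝ => triVec p.1 p.2.1 p.2.2)
    {p | 0 < p.1} := by
  have hinv : ContinuousOn (fun p : ℝ × ℝ × ℝ => (p.1)⁻¹) {p | 0 < p.1} :=
    continuousOn_fst.inv₀ fun p hp => ne_of_gt hp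
  have : (fun p : ℝ × ℝ × ℝ => triVec p.1 p.2.1 p.2.2) = fun p =>
      (((p.1 * Real.cos p.2.2 ^ 2 + p.2.1 * Real.sin p.2.2 * Real.cos p.2.2
        + p.1⁻¹ * Real.sin p.2.2 ^ 2 : ℝ) : ℂ) +
      (((p.1⁻¹ - p.1) * Real.sin p.2.2 * Real.cos p.2.2 - p.2.1 * Real.sin p.2.2 ^ 2 : ℝ) : ℂ)
        * Complex.I) := by
    funext p
    rw [← Complex.mk_eq_add_mul_I, triVec]
  rw [this]
  fun_prop

lemma triAngle_continuousOn : ContinuousOn (fun p : ℝ × ℝ × ℝ => triAngle p.1 p.2.1 p.2.2)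
    {p | 0 < p.1} := by
  refine (continuous_snd.comp continuous_snd).continuousOn.add fun p hp => ?_
  exact ContinuousAt.comp_continuousWithinAt (f := fun p : ℝ × ℝ × ℝ => triVec p.1 p.2.1 p.2.2)
    (Complex.continuousAt_arg (triVec_mem_slitPlane hp _ _)) (triVec_continuousOn p hp)

lemma triAngle_continuous {a : ℝ} (ha : 0 < a) (b : ℝ) : Continuous (triAngle a b) :=
  triAngle_continuousOn.comp_continuous (f := fun θ => (a, b, θ)) (by fun_prop) fun _ => ha

/-- As complex numbers, `B e^{iθ} = e^{iθ} * triVec a b θ`; the modulus and argument of the second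
factor give `r` and the angle increment. -/
lemma triAngle_spec {a : ℝ} (ha : 0 < a) (b θ : ℝ) : ∃ r : ℝ, 0 < r ∧
    a * Real.cos θ + b * Real.sin θ = r * Real.cos (triAngle a b θ) ∧
    a⁻¹ * Real.sin θ = r * Real.sin (triAngle a b θ) := by
  refine ⟨‖triVec a b θ‖, norm_pos_iff.2 (Complex.slitPlane_ne_zero (triVec_mem_slitPlane ha b θ)),
    ?_, ?_⟩
  · rw [triAngle, Real.cos_add]
    have h1 := Complex.norm_mul_cos_arg (triVec a b θ)
    have h2 := Complex.norm_mul_sin_arg (triVec a b θ)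
    have cs := Real.sin_sq_add_cos_sq θ
    simp only [triVec] at h1 h2 ⊢
    linear_combination (-Real.cos θ) * h1 + Real.sin θ * h2
      - (a * Real.cos θ + b * Real.sin θ) * cs
  · rw [triAngle, Real.sin_add]
    have h1 := Complex.norm_mul_cos_arg (triVec a b θ)
    have h2 := Complex.norm_mul_sin_arg (triVec a b θ)
    have cs := Real.sin_sq_add_cos_sq θ
    simp only [triVec] at h1 h2 ⊢
    linear_combination (-Real.sin θ) * h1 - Real.cos θ * h2 - a⁻¹ * Real.sin θ * cs

/-- The composite is a continuous lift of the identity on directions and fixes `0`, so uniqueness of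
lifts makes it the identity. -/
lemma triAngle_leftInverse {a : ℝ} (ha : 0 < a) (b θ : ℝ) :
    triAngle a⁻¹ (-b) (triAngle a b θ) = θ := by
  have ha' := inv_pos.2 ha
  have key : ∀ θ, Real.cos (triAngle a⁻¹ (-b) (triAngle a b θ)) = Real.cos θ ∧
      Real.sin (triAngle a⁻¹ (-b) (triAngle a b θ)) = Real.sin θ := by
    intro θ
    obtain ⟨r, hr, h1, h2⟩ := triAngle_spec ha b θ
    obtain ⟨s, hs, h3, h4⟩ := triAngle_spec ha' (-b) (triAngle a b θ)
    rw [inv_inv] at h4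
    have haa : a * a⁻¹ = 1 := mul_inv_cancel₀ ha.ne'
    refine (cos_sin_eq_of_smul_eq (mul_pos hr hs) one_pos ?_)
    ext i
    fin_cases i
    · simp
      linear_combination (-r) * h3 - a⁻¹ * h1 + b * h2 + Real.cos θ * haa
    · simp
      linear_combination (-r) * h4 - a * h2 + Real.sin θ * haa
  have := eq_of_cos_sin_eq ((triAngle_continuous ha' (-b)).comp (triAngle_continuous ha b))
    continuous_id (fun θ => (key θ).1) (fun θ => (key θ).2) 0
    (by simp [triAngle_zero ha, triAngle_zero ha'])
  exact congrFun this θ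

/-- The homeomorphism `triAngle a b`. -/
noncomputable def triHomeo {a : ℝ} (ha : 0 < a) (b : ℝ) : ℝ ≃ₜ ℝ where
  toFun := triAngle a b
  invFun := triAngle a⁻¹ (-b)
  left_inv := triAngle_leftInverse ha b
  right_inv θ := by simpa using triAngle_leftInverse (inv_pos.2 ha) (-b) θ
  continuous_toFun := triAngle_continuous ha b
  continuous_invFun := triAngle_continuous (inv_pos.2 ha) _

/-- The upper triangular matrix with positive diagonal which maps `i` to `z`. -/
noncomputable def borMat (z : ℍ) : SL(2, ℝ) :=
  ⟨!![√z.im, z.re / √z.im; 0, (√z.im)⁻¹], by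
    rw [Matrix.det_fin_two_of, mul_inv_cancel₀ (Real.sqrt_pos.2 z.im_pos).ne']; ring⟩

/-- The lift of `borMat z` which fixes the direction `0`. -/
noncomputable def bor (z : ℍ) : UnivSL2 :=
  ⟨(borMat z, triHomeo (Real.sqrt_pos.2 z.im_pos) (z.re / √z.im)), fun θ => by
    obtain ⟨r, hr, h1, h2⟩ := triAngle_spec (Real.sqrt_pos.2 z.im_pos) (z.re / √z.im) θ
    refine ⟨r, hr, ?_⟩
    change _ = r • ![Real.cos (triAngle (√z.im) (z.re / √z.im) θ),
      Real.sin (triAngle (√z.im) (z.re / √z.im) θ)]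
    ext i
    fin_cases i
    · simpa [borMat, Matrix.mulVec, dotProduct, Fin.sum_univ_two] using h1
    · simpa [borMat, Matrix.mulVec, dotProduct, Fin.sum_univ_two] using h2⟩

@[simp] lemma bor_mat (z : ℍ) : (bor z).mat = borMat z := rfl
lemma bor_angle (z : ℍ) (θ : ℝ) : (bor z).angle θ = triAngle (√z.im) (z.re / √z.im) θ := rfl
lemma bor_angle_symm (z : ℍ) (θ : ℝ) :
    (bor z).angle.symm θ = triAngle (√z.im)⁻¹ (-(z.re / √z.im)) θ := rfl

lemma bor_angle_symm_zero (z : ℍ) : (bor z).angle.symm 0 = 0 :=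
  triAngle_zero (inv_pos.2 (Real.sqrt_pos.2 z.im_pos)) _

lemma bor_angle_zero (z : ℍ) : (bor z).angle 0 = 0 :=
  triAngle_zero (Real.sqrt_pos.2 z.im_pos) _

/-! ### The action on the upper half-plane and the Iwasawa decomposition -/

lemma sl_smul_im_re (A : SL(2, ℝ)) (z : ℍ) : ((A • z : ℍ) : ℂ) =
    ((A 0 0 : ℂ) * z + A 0 1) / ((A 1 0 : ℂ) * z + A 1 1) := by
  rw [UpperHalfPlane.specialLinearGroup_apply]; rfl

lemma borMat_smul_I (z : ℍ) : borMat z • UpperHalfPlane.I = z := by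
  have h := Real.sqrt_pos.2 z.im_pos
  have h2 : (√z.im) * √z.im = z.im := Real.mul_self_sqrt z.im_pos.le
  apply UpperHalfPlane.ext
  rw [sl_smul_im_re]
  have : ((√z.im : ℝ) : ℂ) ≠ 0 := by exact_mod_cast h.ne'
  simp only [borMat, Matrix.SpecialLinearGroup.coe_mk, Matrix.of_apply, Matrix.cons_val',
    Matrix.cons_val_zero, Matrix.cons_val_one, Matrix.cons_val_fin_one, UpperHalfPlane.coe_I]
  have h3 : ((√z.im : ℝ) : ℂ) * (√z.im : ℝ) = (z.im : ℝ) := by exact_mod_cast h2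
  push_cast
  rw [div_eq_iff (by simpa using this)]
  have h4 : (z : ℂ) = z.re + z.im * Complex.I := (Complex.re_add_im (z : ℂ)).symm
  field_simp
  rw [h4]
  linear_combination Complex.I * h3

lemma rotMat_smul_I (t : ℝ) : rotMat t • UpperHalfPlane.I = UpperHalfPlane.I := by
  apply UpperHalfPlane.ext
  rw [sl_smul_im_re]
  simp only [rotMat, Matrix.SpecialLinearGroup.coe_mk, Matrix.of_apply, Matrix.cons_val',
    Matrix.cons_val_zero, Matrix.cons_val_one, Matrix.cons_val_fin_one, UpperHalfPlane.coe_I]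
  have hne : ((-Real.sin t : ℝ) : ℂ) * Complex.I + (Real.cos t : ℝ) ≠ 0 := by
    intro h
    have h1 := congrArg Complex.re h
    have h2 := congrArg Complex.im h
    simp only [Complex.add_re, Complex.mul_re, Complex.ofReal_re, Complex.I_re, mul_zero,
      Complex.ofReal_im, sub_zero, zero_add, Complex.zero_re, Complex.add_im,
      Complex.mul_im, Complex.I_im, mul_one, add_zero, Complex.zero_im, neg_eq_zero] at h1 h2
    have := Real.sin_sq_add_cos_sq t
    rw [h1, h2] at this
    norm_num at this
  rw [div_eq_iff hne]
  push_cast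
  linear_combination Complex.sin t * Complex.I_mul_I

/-- A matrix fixing `i` is a rotation. -/
lemma entries_of_smul_I {A : SL(2, ℝ)} (h : A • UpperHalfPlane.I = UpperHalfPlane.I) :
    A 1 1 = A 0 0 ∧ A 0 1 = -A 1 0 := by
  have h1 := congrArg (fun z : ℍ => (z : ℂ)) h
  simp only [sl_smul_im_re, UpperHalfPlane.coe_I] at h1
  have hne : (A 1 0 : ℂ) * Complex.I + A 1 1 ≠ 0 := by
    intro h0
    rw [h0, div_zero] at h1
    exact Complex.I_ne_zero h1.symm
  rw [div_eq_iff hne] at h1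
  have h2 := congrArg Complex.re h1
  have h3 := congrArg Complex.im h1
  simp at h2 h3
  exact ⟨h3.symm, h2⟩

/-- The angle `t` of the Iwasawa decomposition `g = (bor z)(rot t)`. -/
noncomputable def UnivSL2.phase (g : UnivSL2) : ℝ :=
  -((bor (g.mat • UpperHalfPlane.I)).angle.symm (g.angle 0))

/-- The quotient `(bor z)⁻¹ * g` fixes `i`, so its matrix is a rotation, the determinant removing
any scaling. Its angle function at `0` selects the right lift among those of this matrix. -/
lemma UnivSL2.iwasawa (g : UnivSL2) : g = bor (g.mat • UpperHalfPlane.I) * rot g.phase := by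
  set z := g.mat • UpperHalfPlane.I with hz
  rw [← inv_mul_eq_iff_eq_mul]
  set h := (bor z)⁻¹ * g with hh
  have hI : h.mat • UpperHalfPlane.I = UpperHalfPlane.I := by
    rw [hh, UnivSL2.mat_mul, mul_smul, ← hz, UnivSL2.mat_inv, inv_smul_eq_iff, bor_mat,
      borMat_smul_I]
  obtain ⟨e1, e2⟩ := entries_of_smul_I hI
  have ha : h.angle 0 = -g.phase := by
    rw [UnivSL2.phase, ← hz, neg_neg]; rfl
  obtain ⟨r, hr, e⟩ := h.angle_spec 0
  rw [ha] at e
  have e3 : h.mat 0 0 = r * Real.cos g.phase := by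
    simpa [Matrix.mulVec, dotProduct, Fin.sum_univ_two] using congrFun e 0
  have e4 : h.mat 1 0 = -(r * Real.sin g.phase) := by
    simpa [Matrix.mulVec, dotProduct, Fin.sum_univ_two] using congrFun e 1
  have hd : h.mat 0 0 * h.mat 1 1 - h.mat 0 1 * h.mat 1 0 = 1 := by
    have := h.mat.det_coe
    rwa [Matrix.det_fin_two] at this
  have hr1 : r = 1 := by
    have : r ^ 2 = 1 := by
      rw [e1, e2, e3, e4] at hd
      linear_combination hd - r ^ 2 * Real.sin_sq_add_cos_sq g.phase
    exact (pow_eq_one_iff_of_nonneg hr.le two_ne_zero).1 this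
  refine UnivSL2.ext_angle (θ₀ := 0) ?_ (by rw [ha]; simp)
  rw [hr1, one_mul] at e3 e4
  ext i j
  fin_cases i <;> fin_cases j
  · simpa [rotMat] using e3
  · simpa [rotMat, e4] using e2
  · simpa [rotMat] using e4
  · simpa [rotMat, e3] using e1

lemma UnivSL2.phase_bor_mul_rot (z : ℍ) (t : ℝ) : (bor z * rot t).phase = t := by
  have : (bor z * rot t).mat • UpperHalfPlane.I = z := by
    simp [mul_smul, rotMat_smul_I, borMat_smul_I]
  rw [UnivSL2.phase, this]
  simp

/-! ### The trivialisation of the unit timelike bundle by `ℝ × ℍ × ℍ` -/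

/-- The future unit vector at the identity which generates the rotations around `i`. -/
def rotGen : Matrix (Fin 2) (Fin 2) ℝ := !![0, 1; -1, 0]

lemma sl_inv_entries (B : SL(2, ℝ)) : ((B⁻¹ : SL(2, ℝ)) : Matrix (Fin 2) (Fin 2) ℝ) =
    !![B 1 1, -B 0 1; -B 1 0, B 0 0] := by
  rw [Matrix.SpecialLinearGroup.coe_inv, Matrix.adjugate_fin_two]

lemma Ad_mul_left (B C : SL(2, ℝ)) (U : Matrix (Fin 2) (Fin 2) ℝ) : Ad (B * C) U = Ad B (Ad C U) := by
  simp only [Ad, mul_inv_rev, Matrix.SpecialLinearGroup.coe_mul, Matrix.mul_assoc]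

lemma Ad_rotMat (t : ℝ) : Ad (rotMat t) rotGen = rotGen := by
  have := Real.sin_sq_add_cos_sq t
  rw [Ad, sl_inv_entries]
  ext i j
  fin_cases i <;> fin_cases j <;>
    simp [rotMat, rotGen, Matrix.mul_apply, Fin.sum_univ_two] <;> nlinarith

lemma Ad_borMat (y : ℍ) : Ad (borMat y) rotGen =
    !![-y.re / y.im, (y.re ^ 2 + y.im ^ 2) / y.im; -1 / y.im, y.re / y.im] := by
  have h := Real.sqrt_pos.2 y.im_pos
  have h2 : √y.im ^ 2 = y.im := Real.sq_sqrt y.im_pos.le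
  have h3 := y.im_pos.ne'
  rw [Ad, sl_inv_entries]
  ext i j
  fin_cases i <;> fin_cases j <;>
    simp [borMat, rotGen, Matrix.mul_apply, Fin.sum_univ_two] <;> field_simp <;> simp [h2]
  · linear_combination y.im * (√y.im ^ 2 + y.im) * h2
  · ring

/-- The point of the unit timelike bundle with coordinates `(t, x, y)`: the time `t` point of the
timelike geodesic which projects into `{γ | γ(y) = x}`. -/
noncomputable def triple (t : ℝ) (x y : ℍ) : T1 where
  pt := bor x * rot t * (bor y)⁻¹
  vec := Ad (borMat y) rotGen
  trace_vec := by rw [trace_Ad]; simp [rotGen]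
  unit := by
    rw [adsForm, Ad_mul, trace_Ad]
    simp [rotGen, Matrix.trace_fin_two]
    norm_num
  future := by
    rw [Ad_borMat]
    simpa using! div_neg_of_neg_of_pos neg_one_lt_zero y.im_pos

/-- The point `y` of the hyperbolic plane fixed by the vector `q`. -/
noncomputable def T1.ctr (q : T1) : ℍ :=
  ⟨⟨q.vec 0 0 / q.vec 1 0, -1 / q.vec 1 0⟩, div_pos_of_neg_of_neg neg_one_lt_zero q.future⟩

/-- The image of `q.ctr` by the base point of `q`. -/
noncomputable def T1.img (q : T1) : ℍ := q.pt.mat • q.ctr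

/-- The time coordinate of a unit timelike vector. -/
noncomputable def T1.time (q : T1) : ℝ := (q.pt * bor q.ctr).phase

lemma T1.ctr_re (q : T1) : q.ctr.re = q.vec 0 0 / q.vec 1 0 := rfl
lemma T1.ctr_im (q : T1) : q.ctr.im = -1 / q.vec 1 0 := rfl

lemma T1.vec_entries (q : T1) : q.vec 1 1 = -q.vec 0 0 ∧
    q.vec 0 0 ^ 2 + q.vec 0 1 * q.vec 1 0 = -1 := by
  have h3 : q.vec 1 1 = -q.vec 0 0 := by
    have := q.trace_vec
    rw [Matrix.trace_fin_two] at this; linarith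
  refine ⟨h3, ?_⟩
  have h1 := q.unit
  simp only [adsForm, Matrix.trace_fin_two, Matrix.mul_apply, Fin.sum_univ_two, h3] at h1
  nlinarith

@[simp] lemma triple_ctr (t : ℝ) (x y : ℍ) : (triple t x y).ctr = y := by
  have h3 := y.im_pos.ne'
  refine UpperHalfPlane.ext_re_im ?_ ?_
  · rw [T1.ctr_re]
    simp only [triple, Ad_borMat]
    simp
    field_simp
  · rw [T1.ctr_im]
    simp only [triple, Ad_borMat]
    simp

lemma triple_mat (t : ℝ) (x y : ℍ) :
    (triple t x y).pt.mat = borMat x * rotMat t * (borMat y)⁻¹ := rfl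

@[simp] lemma triple_img (t : ℝ) (x y : ℍ) : (triple t x y).img = x := by
  rw [T1.img, triple_ctr, triple_mat, mul_smul, mul_smul]
  have : (borMat y)⁻¹ • y = UpperHalfPlane.I := by rw [inv_smul_eq_iff, borMat_smul_I]
  rw [this, rotMat_smul_I, borMat_smul_I]

@[simp] lemma triple_time (t : ℝ) (x y : ℍ) : (triple t x y).time = t := by
  rw [T1.time, triple_ctr]
  simp [triple, UnivSL2.phase_bor_mul_rot]

/-- Future unit vectors form a single adjoint orbit, parametrised by the fixed point in `ℍ`. The
lower left and diagonal entries determine that point, and the unit condition forces the remaining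
entry. -/
lemma T1.Ad_ctr (q : T1) : Ad (borMat q.ctr) rotGen = q.vec := by
  obtain ⟨h1, h2⟩ := q.vec_entries
  have h3 := q.future.ne
  rw [Ad_borMat, q.ctr_re, q.ctr_im]
  ext i j
  fin_cases i <;> fin_cases j <;> simp [h1] <;> field_simp
  linear_combination -h2

/-- This is the Iwasawa decomposition of `q.pt * bor q.ctr`, which moves `i` to `q.img`. -/
lemma triple_coords (q : T1) : triple q.time q.img q.ctr = q := by
  refine T1.ext ?_ q.Ad_ctr
  have h : (q.pt * bor q.ctr).mat • UpperHalfPlane.I = q.img := by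
    rw [UnivSL2.mat_mul, mul_smul, bor_mat, borMat_smul_I, T1.img]
  have := (q.pt * bor q.ctr).iwasawa
  rw [h] at this
  change bor q.img * rot q.time * (bor q.ctr)⁻¹ = q.pt
  rw [T1.time, ← this, mul_inv_cancel_right]

lemma triple_inj {t t' : ℝ} {x x' y y' : ℍ} (h : triple t x y = triple t' x' y') :
    t = t' ∧ x = x' ∧ y = y' :=
  ⟨by simpa using congrArg T1.time h, by simpa using congrArg T1.img h,
    by simpa using congrArg T1.ctr h⟩

/-- Gives the cosine and sine of the time coordinate as smooth expressions in the matrix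
coordinates; the regularity of `time` is deduced from these. -/
lemma T1.rotMat_time (q : T1) : rotMat q.time = (borMat q.img)⁻¹ * q.pt.mat * borMat q.ctr := by
  conv_rhs => rw [← triple_coords q]
  simp only [triple_ctr, triple_img, triple_mat]
  group

/-! ### Continuity -/

lemma T1.continuous_coord : Continuous T1.coord :=
  continuous_fst.comp (continuous_induced_dom (f := fun q : T1 => (q.coord, q.pt.angle 0)))

lemma T1.continuous_angle : Continuous fun q : T1 => q.pt.angle 0 :=
  continuous_snd.comp (continuous_induced_dom (f := fun q : T1 => (q.coord, q.pt.angle 0)))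

lemma T1.continuous_mat (i j : Fin 2) : Continuous fun q : T1 => q.pt.mat i j :=
  (continuous_apply j).comp ((continuous_apply i).comp (continuous_fst.comp T1.continuous_coord))

lemma T1.continuous_vec (i j : Fin 2) : Continuous fun q : T1 => q.vec i j :=
  (continuous_apply j).comp ((continuous_apply i).comp (continuous_snd.comp T1.continuous_coord))

lemma continuous_to_uhp {X : Type*} [TopologicalSpace X] {f : X → ℍ}
    (h : Continuous fun x => (f x : ℂ)) : Continuous f :=
  UpperHalfPlane.isOpenEmbedding_coe.isEmbedding.continuous_iff.2 h

lemma T1.continuous_ctr : Continuous T1.ctr := by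
  refine continuous_to_uhp ?_
  have : (fun q : T1 => (q.ctr : ℂ)) = fun q : T1 =>
      ((q.vec 0 0 / q.vec 1 0 : ℝ) : ℂ) + ((-1 / q.vec 1 0 : ℝ) : ℂ) * Complex.I := by
    funext q
    exact (Complex.re_add_im (q.ctr : ℂ)).symm
  rw [this]
  have h1 := T1.continuous_vec 0 0
  have h2 := T1.continuous_vec 1 0
  have h3 : Continuous fun q : T1 => q.vec 0 0 / q.vec 1 0 := h1.div h2 fun q => q.future.ne
  have h4 : Continuous fun q : T1 => -1 / q.vec 1 0 := continuous_const.div h2 fun q => q.future.ne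
  fun_prop

lemma sl_denom_ne_zero (A : SL(2, ℝ)) (z : ℍ) : (A 1 0 : ℂ) * z + A 1 1 ≠ 0 :=
  UpperHalfPlane.denom_ne_zero (A : GL (Fin 2) ℝ) z

lemma T1.continuous_img : Continuous T1.img := by
  refine continuous_to_uhp ?_
  simp only [T1.img, sl_smul_im_re]
  have hc : Continuous fun q : T1 => (q.ctr : ℂ) := UpperHalfPlane.continuous_coe.comp T1.continuous_ctr
  have h : ∀ i j, Continuous fun q : T1 => ((q.pt.mat i j : ℝ) : ℂ) := fun i j =>
    Complex.continuous_ofReal.comp (T1.continuous_mat i j)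
  exact (((h 0 0).mul hc).add (h 0 1)).div (((h 1 0).mul hc).add (h 1 1))
    fun q => sl_denom_ne_zero _ _

lemma continuous_bor_angle {X : Type*} [TopologicalSpace X] {f : X → ℍ} {g : X → ℝ}
    (hf : Continuous f) (hg : Continuous g) : Continuous fun x => (bor (f x)).angle (g x) := by
  simp only [bor_angle]
  have him : Continuous fun x => √(f x).im := (UpperHalfPlane.continuous_im.comp hf).sqrt
  refine triAngle_continuousOn.comp_continuous (f := fun x => (√(f x).im, (f x).re / √(f x).im, g x))
    (him.prodMk (((UpperHalfPlane.continuous_re.comp hf).div him fun x => ?_).prodMk hg)) fun x => ?_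
  · exact (Real.sqrt_pos.2 (f x).im_pos).ne'
  · exact Real.sqrt_pos.2 (f x).im_pos

lemma continuous_bor_angle_symm {X : Type*} [TopologicalSpace X] {f : X → ℍ} {g : X → ℝ}
    (hf : Continuous f) (hg : Continuous g) : Continuous fun x => (bor (f x)).angle.symm (g x) := by
  simp only [bor_angle_symm]
  have him : Continuous fun x => √(f x).im := (UpperHalfPlane.continuous_im.comp hf).sqrt
  have h0 : ∀ x, √(f x).im ≠ 0 := fun x => (Real.sqrt_pos.2 (f x).im_pos).ne'
  refine triAngle_continuousOn.comp_continuous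
    (f := fun x => ((√(f x).im)⁻¹, -((f x).re / √(f x).im), g x))
    ((him.inv₀ h0).prodMk (((UpperHalfPlane.continuous_re.comp hf).div him h0).neg.prodMk hg))
    fun x => ?_
  exact inv_pos.2 (Real.sqrt_pos.2 (f x).im_pos)

lemma phase_mul_bor (g : UnivSL2) (x : ℍ) :
    (g * bor x).phase = -((bor (g.mat • x)).angle.symm (g.angle 0)) := by
  rw [UnivSL2.phase, UnivSL2.mat_mul, mul_smul, bor_mat, borMat_smul_I, UnivSL2.angle_mul,
    bor_angle_zero]

lemma T1.continuous_time : Continuous T1.time := by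
  have : T1.time = fun q : T1 => -((bor q.img).angle.symm (q.pt.angle 0)) :=
    funext fun q => phase_mul_bor _ _
  rw [this]
  exact (continuous_bor_angle_symm T1.continuous_img T1.continuous_angle).neg

lemma borMat_inv_coe (y : ℍ) : (((borMat y)⁻¹ : SL(2, ℝ)) : Matrix (Fin 2) (Fin 2) ℝ) =
    !![(√y.im)⁻¹, -(y.re / √y.im); 0, √y.im] := by
  rw [sl_inv_entries]
  simp [borMat]

lemma triple_mat_apply (t : ℝ) (x y : ℍ) (i j : Fin 2) : (triple t x y).pt.mat i j =
    (borMat x i 0 * rotMat t 0 0 + borMat x i 1 * rotMat t 1 0) * (borMat y)⁻¹ 0 j +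
      (borMat x i 0 * rotMat t 0 1 + borMat x i 1 * rotMat t 1 1) * (borMat y)⁻¹ 1 j := by
  rw [triple_mat, sl_mul_apply, sl_mul_apply, sl_mul_apply]

lemma continuous_triple : Continuous fun p : ℝ × ℍ × ℍ => triple p.1 p.2.1 p.2.2 := by
  have hr : ∀ i j, Continuous fun t : ℝ => rotMat t i j := by
    intro i j
    fin_cases i <;> fin_cases j <;> simp [rotMat] <;> fun_prop
  have him : Continuous fun x : ℍ => √x.im := UpperHalfPlane.continuous_im.sqrt
  have h0 : ∀ x : ℍ, √x.im ≠ 0 := fun x => (Real.sqrt_pos.2 x.im_pos).ne'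
  have hre : Continuous fun x : ℍ => x.re / √x.im := UpperHalfPlane.continuous_re.div him h0
  have hinv : Continuous fun x : ℍ => (√x.im)⁻¹ := him.inv₀ h0
  have hb : ∀ i j, Continuous fun x : ℍ => borMat x i j := by
    intro i j
    fin_cases i <;> fin_cases j <;> simp [borMat] <;> fun_prop
  have hb' : ∀ i j, Continuous fun x : ℍ => (borMat x)⁻¹ i j := by
    intro i j
    simp only [borMat_inv_coe]
    fin_cases i <;> fin_cases j <;> simp <;> fun_prop
  have hv : ∀ i j, Continuous fun x : ℍ => Ad (borMat x) rotGen i j := by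
    intro i j
    simp only [Ad, Matrix.mul_apply, Fin.sum_univ_two]
    have := hb
    fun_prop
  refine continuous_induced_rng.2 (Continuous.prodMk (Continuous.prodMk ?_ ?_) ?_)
  · refine continuous_pi fun i => continuous_pi fun j => ?_
    simp only [triple_mat_apply]
    have r := fun i j => (hr i j).comp (continuous_fst (X := ℝ) (Y := ℍ × ℍ))
    have b := fun i j => (hb i j).comp (continuous_fst.comp (continuous_snd (X := ℝ) (Y := ℍ × ℍ)))
    have b' := fun i j => (hb' i j).comp (continuous_snd.comp (continuous_snd (X := ℝ) (Y := ℍ × ℍ)))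
    exact ((((b i 0).mul (r 0 0)).add ((b i 1).mul (r 1 0))).mul (b' 0 j)).add
      ((((b i 0).mul (r 0 1)).add ((b i 1).mul (r 1 1))).mul (b' 1 j))
  · refine continuous_pi fun i => continuous_pi fun j => ?_
    exact (hv i j).comp (continuous_snd.comp continuous_snd)
  -- The factor `(bor y)⁻¹` fixes the direction `0` at which the topology of `T1` evaluates the
  -- angle function.
  · have : ∀ p : ℝ × ℍ × ℍ, (triple p.1 p.2.1 p.2.2).pt.angle 0 = (bor p.2.1).angle (-p.1) := by
      intro p
      simp [triple, bor_angle_symm_zero]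
    simp only [this]
    exact continuous_bor_angle (by fun_prop) (by fun_prop)

/-! ### The geodesic flow -/

/-- Cayley–Hamilton for trace `0` and determinant `1`: `U² = -1`, hence `exp(sU) = cos s + (sin s)
U`. -/
lemma T1.vec_mul_vec (q : T1) (i j : Fin 2) :
    q.vec i 0 * q.vec 0 j + q.vec i 1 * q.vec 1 j = if i = j then -1 else 0 := by
  obtain ⟨h1, h2⟩ := q.vec_entries
  fin_cases i <;> fin_cases j <;> simp [h1] <;> linarith

lemma geodGen_fst (q : T1) (i j : Fin 2) : (geodGen q).1 i j =
    q.pt.mat i 0 * q.vec 0 j + q.pt.mat i 1 * q.vec 1 j := by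
  simp [geodGen, horLift, Matrix.mul_apply, Fin.sum_univ_two]

/-- The correction term is `[U, U] = 0`: the left-translated velocity of a geodesic is constant. -/
lemma geodGen_snd (q : T1) : (geodGen q).2 = 0 := by
  ext i j
  simp [geodGen, horLift]

lemma hasDerivAt_rotMat (t s : ℝ) (i j : Fin 2) : HasDerivAt (fun s => rotMat (t + s) i j)
    (rotMat (t + s) i 0 * rotGen 0 j + rotMat (t + s) i 1 * rotGen 1 j) s := by
  have hc : HasDerivAt (fun s => Real.cos (t + s)) (-Real.sin (t + s)) s := by
    simpa using ((hasDerivAt_id s).const_add t).cos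
  have hs : HasDerivAt (fun s => Real.sin (t + s)) (Real.cos (t + s)) s := by
    simpa using ((hasDerivAt_id s).const_add t).sin
  fin_cases i <;> fin_cases j <;> simp [rotMat, rotGen]
  · exact hc
  · exact hs
  · exact hs.fun_neg
  · exact hc

lemma triple_mat_mul_vec (t : ℝ) (x y : ℍ) :
    ((triple t x y).pt.mat : Matrix (Fin 2) (Fin 2) ℝ) * (triple t x y).vec =
      (borMat x : Matrix (Fin 2) (Fin 2) ℝ) * (rotMat t : Matrix (Fin 2) (Fin 2) ℝ) * rotGen *
        (((borMat y)⁻¹ : SL(2, ℝ)) : Matrix (Fin 2) (Fin 2) ℝ) := by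
  change _ * Ad (borMat y) rotGen = _
  rw [triple_mat, Ad, Matrix.SpecialLinearGroup.coe_mul, Matrix.SpecialLinearGroup.coe_mul]
  calc _ = (borMat x : Matrix (Fin 2) (Fin 2) ℝ) * (rotMat t : Matrix (Fin 2) (Fin 2) ℝ) *
        ((((borMat y)⁻¹ : SL(2, ℝ)) : Matrix (Fin 2) (Fin 2) ℝ) *
          (borMat y : Matrix (Fin 2) (Fin 2) ℝ)) * rotGen *
        (((borMat y)⁻¹ : SL(2, ℝ)) : Matrix (Fin 2) (Fin 2) ℝ) := by simp only [Matrix.mul_assoc]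
    _ = _ := by rw [inv_mul_coe, Matrix.mul_one]

/-- `rotMat` solves `R' = R * rotGen`; conjugating by `bor y` turns this into the geodesic equation
`γ' = γU`. -/
lemma flowTo_triple (t s : ℝ) (x y : ℍ) : FlowTo s (triple t x y) (triple (t + s) x y) := by
  refine ⟨fun s => triple (t + s) x y, ?_, by simp, rfl, fun s => ?_⟩
  · exact continuous_triple.comp (f := fun s => (t + s, x, y)) (by fun_prop)
  · refine HasDerivAt.prodMk ?_ ?_
    · refine hasDerivAt_pi.2 fun i => hasDerivAt_pi.2 fun j => ?_
      change HasDerivAt (fun s => (triple (t + s) x y).pt.mat i j)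
        ((((triple (t + s) x y).pt.mat : Matrix (Fin 2) (Fin 2) ℝ) * (triple (t + s) x y).vec) i j) s
      rw [triple_mat_mul_vec]
      simp only [triple_mat_apply]
      have h := hasDerivAt_rotMat t s
      convert! ((((h 0 0).const_mul (borMat x i 0)).add ((h 1 0).const_mul (borMat x i 1))).mul_const
        ((borMat y)⁻¹ 0 j)).add ((((h 0 1).const_mul (borMat x i 0)).add
          ((h 1 1).const_mul (borMat x i 1))).mul_const ((borMat y)⁻¹ 1 j)) using 1
      simp only [Matrix.mul_apply, Fin.sum_univ_two]
      ring
    · change HasDerivAt (fun _ => (triple 0 x y).coord.2) (geodGen (triple (t + s) x y)).2 s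
      rw [geodGen_snd]
      exact hasDerivAt_const s _

lemma eq_of_hasDerivAt_zero {f : ℝ → ℝ} (h : ∀ s, HasDerivAt f 0 s) (s t : ℝ) : f s = f t :=
  is_const_of_deriv_eq_zero (fun s => (h s).differentiableAt) (fun s => (h s).deriv) s t

/-- Uniqueness of the integral curve: `U` is constant, so `γ' = γU` is linear and determines the
matrices. Continuity then determines the point of the universal cover. -/
lemma FlowTo.eq_triple {s t : ℝ} {x y : ℍ} {q' : T1} (h : FlowTo s (triple t x y) q') :
    q' = triple (t + s) x y := by
  obtain ⟨c, hc, h0, h1, hd⟩ := h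
  have hfst : ∀ s i j, HasDerivAt (fun s => (c s).pt.mat i j)
      ((c s).pt.mat i 0 * (c s).vec 0 j + (c s).pt.mat i 1 * (c s).vec 1 j) s := by
    intro s i j
    rw [← geodGen_fst]
    exact hasDerivAt_pi.1 (hasDerivAt_pi.1 ((hasFDerivAt_fst.comp_hasDerivAt s (hd s))) i) j
  have hsnd : ∀ s i j, HasDerivAt (fun s => (c s).vec i j) 0 s := by
    intro s i j
    have := hasDerivAt_pi.1 (hasDerivAt_pi.1 ((hasFDerivAt_snd.comp_hasDerivAt s (hd s))) i) j
    have e : (ContinuousLinearMap.snd ℝ (Fin 2 → Fin 2 → ℝ) (Fin 2 → Fin 2 → ℝ))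
      (geodGen (c s)) = 0 := geodGen_snd _
    rw [e] at this
    exact this
  have hvec : ∀ s, (c s).vec = (triple t x y).vec := by
    intro s
    ext i j
    rw [← h0]
    exact eq_of_hasDerivAt_zero (fun s => hsnd s i j) s 0
  set U := (triple t x y).vec with hU
  have hUU := (triple t x y).vec_mul_vec
  rw [← hU] at hUU
  -- The constant of motion `γ(s) exp(-sU)`, where `U² = -1` gives `exp(-sU) = cos s - (sin s) U`.
  have hconst : ∀ s i j, (c s).pt.mat i j * Real.cos s -
      ((c s).pt.mat i 0 * U 0 j + (c s).pt.mat i 1 * U 1 j) * Real.sin s =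
      (triple t x y).pt.mat i j := by
    intro s i j
    have := eq_of_hasDerivAt_zero (f := fun s => (c s).pt.mat i j * Real.cos s -
      ((c s).pt.mat i 0 * U 0 j + (c s).pt.mat i 1 * U 1 j) * Real.sin s) ?_ s 0
    · simp only [Real.cos_zero, Real.sin_zero, mul_one, mul_zero, sub_zero, h0] at this
      exact this
    · intro s
      have h := fun j => hfst s i j
      rw [hvec s] at h
      convert! (((h j).mul (Real.hasDerivAt_cos s)).sub
        ((((h 0).mul_const (U 0 j)).add ((h 1).mul_const (U 1 j))).mul
          (Real.hasDerivAt_sin s))) using 1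
      have e1 := hUU 0 j
      have e2 := hUU 1 j
      have e3 : ((c s).pt.mat i 0 * U 0 0 + (c s).pt.mat i 1 * U 1 0) * U 0 j +
          ((c s).pt.mat i 0 * U 0 1 + (c s).pt.mat i 1 * U 1 1) * U 1 j = -(c s).pt.mat i j := by
        calc _ = (c s).pt.mat i 0 * (U 0 0 * U 0 j + U 0 1 * U 1 j) +
            (c s).pt.mat i 1 * (U 1 0 * U 0 j + U 1 1 * U 1 j) := by ring
          _ = _ := by rw [e1, e2]; fin_cases j <;> simp
      simp only [Pi.add_apply]
      linear_combination Real.sin s * e3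
  have hctr : ∀ s, (c s).ctr = y := fun s => by
    have : (c s).ctr = (triple t x y).ctr := by
      refine UpperHalfPlane.ext_re_im ?_ ?_
      · rw [T1.ctr_re, T1.ctr_re, hvec s]
      · rw [T1.ctr_im, T1.ctr_im, hvec s]
    rw [this, triple_ctr]
  have hmat : ∀ s, (c s).pt.mat = (triple (t + s) x y).pt.mat := by
    intro s
    have e : (c s).pt.mat = borMat x * rotMat t * rotMat s * (borMat y)⁻¹ := by
      have hV : ∀ i j, (triple t x y).pt.mat i 0 * U 0 j + (triple t x y).pt.mat i 1 * U 1 j =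
          (borMat x * rotMat t * (rotMat (Real.pi / 2)) * (borMat y)⁻¹ : SL(2, ℝ)) i j := by
        intro i j
        have h := congrFun (congrFun (triple_mat_mul_vec t x y) i) j
        rw [Matrix.mul_apply, Fin.sum_univ_two] at h
        rw [← hU] at h
        rw [h]
        -- The infinitesimal rotation is also the quarter turn, so right multiplication by `U` can
        -- be written inside the group.
        have : rotGen = (rotMat (Real.pi / 2) : Matrix (Fin 2) (Fin 2) ℝ) := by
          simp [rotGen, rotMat]
        rw [this]
        rfl
      ext i j
      have a0 := hconst s i 0
      have a1 := hconst s i 1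
      have a := hconst s i j
      have e3 : ((c s).pt.mat i 0 * U 0 0 + (c s).pt.mat i 1 * U 1 0) * U 0 j +
          ((c s).pt.mat i 0 * U 0 1 + (c s).pt.mat i 1 * U 1 1) * U 1 j = -(c s).pt.mat i j := by
        calc _ = (c s).pt.mat i 0 * (U 0 0 * U 0 j + U 0 1 * U 1 j) +
            (c s).pt.mat i 1 * (U 1 0 * U 0 j + U 1 1 * U 1 j) := by ring
          _ = _ := by rw [hUU, hUU]; fin_cases j <;> simp
      have b : (c s).pt.mat i j = (triple t x y).pt.mat i j * Real.cos s +
          ((triple t x y).pt.mat i 0 * U 0 j + (triple t x y).pt.mat i 1 * U 1 j) * Real.sin s := by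
        rw [← a, ← a0, ← a1]
        linear_combination (-(c s).pt.mat i j) * Real.sin_sq_add_cos_sq s + Real.sin s ^ 2 * e3
      rw [b, hV, triple_mat]
      rw [sl_mul_apply, sl_mul_apply (borMat x * rotMat t * rotMat (Real.pi / 2)),
        sl_mul_apply (borMat x * rotMat t) (rotMat (Real.pi / 2)),
        sl_mul_apply (borMat x * rotMat t) (rotMat (Real.pi / 2)),
        sl_mul_apply (borMat x * rotMat t * rotMat s),
        sl_mul_apply (borMat x * rotMat t) (rotMat s),
        sl_mul_apply (borMat x * rotMat t) (rotMat s)]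
      simp [rotMat]
      ring
    rw [e, triple_mat]
    have : rotMat (t + s) = rotMat t * rotMat s := congrArg UnivSL2.mat (rot_add t s)
    rw [this]
    group
  have himg : ∀ s, (c s).img = x := fun s => by
    rw [T1.img, hctr, hmat]
    have := triple_img (t + s) x y
    rwa [T1.img, triple_ctr] at this
  have hrot : ∀ s, rotMat (c s).time = rotMat (t + s) := fun s => by
    rw [T1.rotMat_time, hctr, himg, hmat, triple_mat]
    group
  -- The matrices give the time only modulo `2π`; continuity of the curve in `T1` and the value at
  -- `0` remove the ambiguity.
  have htime := eq_of_cos_sin_eq (f := fun s => (c s).time) (g := fun s => t + s)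
    (T1.continuous_time.comp hc) (by fun_prop)
    (fun s => by simpa [rotMat] using congrArg (fun A : SL(2, ℝ) => A 0 0) (hrot s))
    (fun s => by simpa [rotMat] using congrArg (fun A : SL(2, ℝ) => A 0 1) (hrot s)) 0
    (by simp [h0])
  rw [← h1, ← triple_coords (c s), himg, hctr]
  exact congrArg (fun r => triple r x y) (congrFun htime s)

lemma flowTo_triple_iff {s t : ℝ} {x y : ℍ} {q' : T1} :
    FlowTo s (triple t x y) q' ↔ q' = triple (t + s) x y :=
  ⟨FlowTo.eq_triple, fun h => h ▸ flowTo_triple t s x y⟩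

/-- The quarter turn acts as `w ↦ -1/w`, so a fixed point satisfies `w² = -1`. -/
lemma eq_I_of_rotMat_smul {w : ℍ} (h : rotMat (Real.pi / 2) • w = w) : w = UpperHalfPlane.I := by
  have h1 := congrArg (fun z : ℍ => (z : ℂ)) h
  simp only [sl_smul_im_re] at h1
  simp only [rotMat, Real.cos_pi_div_two, Real.sin_pi_div_two, Matrix.SpecialLinearGroup.coe_mk,
    Matrix.of_apply, Matrix.cons_val', Matrix.cons_val_zero, Matrix.cons_val_one,
    Matrix.cons_val_fin_one, Complex.ofReal_zero, zero_mul, Complex.ofReal_one, zero_add,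
    Complex.ofReal_neg, neg_mul, one_mul, add_zero] at h1
  have h2 : (w : ℂ) * w = -1 := by
    rw [div_eq_iff (neg_ne_zero.2 w.ne_zero)] at h1
    linear_combination h1
  have h3 := congrArg Complex.re h2
  have h4 := congrArg Complex.im h2
  simp only [Complex.mul_re, Complex.mul_im, Complex.neg_re, Complex.neg_im, Complex.one_re,
    Complex.one_im, UpperHalfPlane.coe_re, UpperHalfPlane.coe_im] at h3 h4
  have hp := w.im_pos
  have hre : w.re = 0 := by
    have : w.re * w.im = 0 := by linarith
    exact (mul_eq_zero.1 this).resolve_right hp.ne'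
  rw [hre] at h3
  have him : w.im = 1 := by nlinarith
  refine UpperHalfPlane.ext_re_im ?_ ?_
  · rw [hre, UpperHalfPlane.I_re]
  · rw [him, UpperHalfPlane.I_im]

lemma projectsTo_iff {q : T1} {xy : ℍ × ℍ} : ProjectsTo q xy ↔ q.img = xy.1 ∧ q.ctr = xy.2 := by
  obtain ⟨x', y'⟩ := xy
  obtain ⟨t, x, y, rfl⟩ : ∃ t x y, q = triple t x y := ⟨_, _, _, (triple_coords q).symm⟩
  rw [triple_img, triple_ctr]
  constructor
  · intro h
    -- Moved back to `i`, the hypothesis says that a point has constant image under all rotations;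
    -- the angles `0` and `π/2` already force it to be `i`.
    have key : ∀ s, rotMat s • ((borMat y)⁻¹ • y') = (borMat x)⁻¹ • x' := by
      intro s
      have := h (s - t) _ (flowTo_triple t (s - t) x y)
      rw [add_sub_cancel, triple_mat, mul_smul, mul_smul] at this
      change borMat x • rotMat s • (borMat y)⁻¹ • y' = x' at this
      rw [← this, inv_smul_smul]
    have e0 := key 0
    have r0 : rotMat 0 = 1 := congrArg UnivSL2.mat rot_zero
    rw [r0, one_smul] at e0
    have e1 := key (Real.pi / 2)
    rw [← e0] at e1
    have e2 := eq_I_of_rotMat_smul e1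
    rw [e2] at e0
    rw [inv_smul_eq_iff, borMat_smul_I] at e2
    rw [eq_comm, inv_smul_eq_iff, borMat_smul_I] at e0
    exact ⟨e0.symm, e2.symm⟩
  · rintro ⟨rfl, rfl⟩ s q' hq
    rw [hq.eq_triple]
    have := triple_img (t + s) x y
    rwa [T1.img, triple_ctr] at this

/-! ### Isometries in the trivialisation -/

lemma mul_bor (g : UnivSL2) (x : ℍ) : g * bor x = bor (g.mat • x) * rot (g * bor x).phase := by
  have := (g * bor x).iwasawa
  rwa [UnivSL2.mat_mul, mul_smul, bor_mat, borMat_smul_I] at this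

lemma smul_pt (g : UnivSL2 × UnivSL2) (q : T1) : (g • q).pt = g.1 * q.pt * g.2⁻¹ := rfl
lemma smul_vec (g : UnivSL2 × UnivSL2) (q : T1) : (g • q).vec = Ad g.2.mat q.vec := rfl

/-- Iwasawa applied to `g.1 * bor x` and to `g.2 * bor y` leaves one rotation on each side of `rot
t`. Rotations commute, so only their difference of phases is added to the time. -/
lemma smul_triple (g : UnivSL2 × UnivSL2) (t : ℝ) (x y : ℍ) : g • triple t x y =
    triple (t + ((g.1 * bor x).phase - (g.2 * bor y).phase)) (g.1.mat • x) (g.2.mat • y) := by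
  refine T1.ext ?_ ?_
  · rw [smul_pt]
    change g.1 * (bor x * rot t * (bor y)⁻¹) * g.2⁻¹ = bor _ * rot _ * (bor _)⁻¹
    have h1 := mul_bor g.1 x
    have h2 : (bor y)⁻¹ * g.2⁻¹ = rot (-(g.2 * bor y).phase) * (bor (g.2.mat • y))⁻¹ := by
      have h3 : rot (-(g.2 * bor y).phase) = (rot (g.2 * bor y).phase)⁻¹ := by
        rw [eq_inv_iff_mul_eq_one, ← rot_add, neg_add_cancel, rot_zero]
      rw [← mul_inv_rev, h3, ← mul_inv_rev, ← mul_bor]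
    calc _ = (g.1 * bor x) * rot t * ((bor y)⁻¹ * g.2⁻¹) := by group
      _ = bor (g.1.mat • x) * (rot (g.1 * bor x).phase * rot t * rot (-(g.2 * bor y).phase))
          * (bor (g.2.mat • y))⁻¹ := by rw [h2]; nth_rewrite 1 [h1]; group
      _ = _ := by rw [← rot_add, ← rot_add]; congr 3; ring
  · rw [smul_vec]
    change Ad g.2.mat (Ad (borMat y) rotGen) = Ad (borMat (g.2.mat • y)) rotGen
    have := congrArg UnivSL2.mat (mul_bor g.2 y)
    simp only [UnivSL2.mat_mul, bor_mat, rot_mat] at this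
    rw [← Ad_mul_left, this, Ad_mul_left, Ad_rotMat]

lemma smul_img (g : UnivSL2 × UnivSL2) (q : T1) : (g • q).img = g.1.mat • q.img := by
  rw [← triple_coords q, smul_triple, triple_img, triple_img]

lemma smul_ctr (g : UnivSL2 × UnivSL2) (q : T1) : (g • q).ctr = g.2.mat • q.ctr := by
  rw [← triple_coords q, smul_triple, triple_ctr, triple_ctr]

/-- Isometries commute with the geodesic flow. -/
lemma smul_triple_add {g : UnivSL2 × UnivSL2} {t t' : ℝ} {x y x' y' : ℍ}
    (h : g • triple t x y = triple t' x' y') (s : ℝ) :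
    g • triple (t + s) x y = triple (t' + s) x' y' := by
  rw [smul_triple] at h ⊢
  obtain ⟨h1, h2, h3⟩ := triple_inj h
  rw [h2, h3, ← h1]
  congr 1
  ring

lemma continuous_smul_T1 (g : UnivSL2 × UnivSL2) : Continuous fun q : T1 => g • q := by
  have : (fun q : T1 => g • q) = fun q : T1 =>
      triple (q.time + (-((bor (g.1.mat • q.img)).angle.symm (g.1.angle 0)) -
        -((bor (g.2.mat • q.ctr)).angle.symm (g.2.angle 0)))) (g.1.mat • q.img) (g.2.mat • q.ctr) := by
    funext q
    conv_lhs => rw [← triple_coords q]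
    rw [smul_triple, phase_mul_bor, phase_mul_bor]
  rw [this]
  have h1 : Continuous fun q : T1 => g.1.mat • q.img := T1.continuous_img.const_smul _
  have h2 : Continuous fun q : T1 => g.2.mat • q.ctr := T1.continuous_ctr.const_smul _
  have h3 := continuous_bor_angle_symm h1 (continuous_const (y := g.1.angle 0))
  have h4 := continuous_bor_angle_symm h2 (continuous_const (y := g.2.angle 0))
  exact continuous_triple.comp (f := fun q : T1 => (_, _, _))
    ((T1.continuous_time.add (h3.neg.sub h4.neg)).prodMk (h1.prodMk h2))

/-! ### The connection form in the trivialisation -/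

lemma trace_two (M : Matrix (Fin 2) (Fin 2) ℝ) : M.trace = M 0 0 + M 1 1 := Matrix.trace_fin_two M

/-- The generator of the flow is horizontal, so the vertical term of the Sasaki metric drops out. -/
lemma connForm_eq (q : T1) (X : Coord) : connForm q X = -(1 / 2) * (q.vec *
    (((q.pt.mat⁻¹ : SL(2, ℝ)) : Matrix (Fin 2) (Fin 2) ℝ) * Matrix.of X.1)).trace := by
  have h1 : horPart q (geodGen q) = q.vec := by
    change ((q.pt.mat⁻¹ : SL(2, ℝ)) : Matrix (Fin 2) (Fin 2) ℝ) *
      ((q.pt.mat : Matrix (Fin 2) (Fin 2) ℝ) * q.vec) = q.vec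
    rw [← Matrix.mul_assoc, inv_mul_coe, Matrix.one_mul]
  have h2 : vertPart q (geodGen q) = 0 := by
    rw [vertPart, h1, geodGen_snd]
    simp
  rw [connForm, sasaki, h1, h2]
  simp [adsForm, horPart]

/-- The differential of the isometry `g`, in the coordinates `Coord`. -/
noncomputable def isomDiff (g : UnivSL2 × UnivSL2) (X : Coord) : Coord :=
  (fun i j => ((g.1.mat : Matrix (Fin 2) (Fin 2) ℝ) * Matrix.of X.1 *
      ((g.2.mat⁻¹ : SL(2, ℝ)) : Matrix (Fin 2) (Fin 2) ℝ)) i j,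
    fun i j => ((g.2.mat : Matrix (Fin 2) (Fin 2) ℝ) * Matrix.of X.2 *
      ((g.2.mat⁻¹ : SL(2, ℝ)) : Matrix (Fin 2) (Fin 2) ℝ)) i j)

/-- `isomDiff` as a continuous linear map. -/
noncomputable def isomDiffL (g : UnivSL2 × UnivSL2) : Coord →L[ℝ] Coord :=
  LinearMap.toContinuousLinearMap
    { toFun := isomDiff g
      map_add' := fun X Y => by
        refine Prod.ext ?_ ?_
        · funext i j
          simp [isomDiff, Matrix.mul_apply, Fin.sum_univ_two]
          ring
        · funext i j
          simp [isomDiff, Matrix.mul_apply, Fin.sum_univ_two]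
          ring
      map_smul' := fun c X => by
        refine Prod.ext ?_ ?_
        · funext i j
          simp [isomDiff, Matrix.mul_apply, Fin.sum_univ_two]
          ring
        · funext i j
          simp [isomDiff, Matrix.mul_apply, Fin.sum_univ_two]
          ring }

/-- Left translations cancel in `γ⁻¹γ̇`, and right translations only conjugate, which the trace
ignores. This invariance lets `ω` descend to the quotient bundle. -/
lemma connForm_smul (g : UnivSL2 × UnivSL2) (q : T1) (X : Coord) :
    connForm (g • q) (isomDiffL g X) = connForm q X := by
  rw [connForm_eq, connForm_eq]
  congr 1
  change (Ad g.2.mat q.vec * (((g.1.mat * q.pt.mat * g.2.mat⁻¹)⁻¹ : SL(2, ℝ)) *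
    ((g.1.mat : Matrix (Fin 2) (Fin 2) ℝ) * Matrix.of X.1 *
      ((g.2.mat⁻¹ : SL(2, ℝ)) : Matrix (Fin 2) (Fin 2) ℝ)))).trace = _
  rw [mul_inv_rev, mul_inv_rev, inv_inv]
  have e : Ad g.2.mat q.vec * (((g.2.mat * (q.pt.mat⁻¹ * g.1.mat⁻¹) : SL(2, ℝ)) :
      Matrix (Fin 2) (Fin 2) ℝ) *
    ((g.1.mat : Matrix (Fin 2) (Fin 2) ℝ) * Matrix.of X.1 *
      ((g.2.mat⁻¹ : SL(2, ℝ)) : Matrix (Fin 2) (Fin 2) ℝ))) = Ad g.2.mat (q.vec *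
    (((q.pt.mat⁻¹ : SL(2, ℝ)) : Matrix (Fin 2) (Fin 2) ℝ) * Matrix.of X.1)) := by
    rw [Ad, Ad, Matrix.SpecialLinearGroup.coe_mul, Matrix.SpecialLinearGroup.coe_mul]
    calc _ = (g.2.mat : Matrix (Fin 2) (Fin 2) ℝ) * q.vec *
          (((g.2.mat⁻¹ : SL(2, ℝ)) : Matrix (Fin 2) (Fin 2) ℝ) *
            (g.2.mat : Matrix (Fin 2) (Fin 2) ℝ)) *
          ((q.pt.mat⁻¹ : SL(2, ℝ)) : Matrix (Fin 2) (Fin 2) ℝ) *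
          (((g.1.mat⁻¹ : SL(2, ℝ)) : Matrix (Fin 2) (Fin 2) ℝ) *
            (g.1.mat : Matrix (Fin 2) (Fin 2) ℝ)) * Matrix.of X.1 *
          ((g.2.mat⁻¹ : SL(2, ℝ)) : Matrix (Fin 2) (Fin 2) ℝ) := by simp only [Matrix.mul_assoc]
      _ = _ := by rw [inv_mul_coe, inv_mul_coe, Matrix.mul_one, Matrix.mul_one]
                  simp only [Matrix.mul_assoc]
  rw [e, trace_Ad]

section Curves

lemma HasDerivWithinAt.uhp_im {x : ℝ → ℍ} {x' : ℂ} {A : Set ℝ} {s : ℝ}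
    (hx : HasDerivWithinAt (fun s => (x s : ℂ)) x' A s) :
    HasDerivWithinAt (fun s => (x s).im) x'.im A s :=
  Complex.imCLM.hasFDerivAt.comp_hasDerivWithinAt s hx

lemma HasDerivWithinAt.uhp_re {x : ℝ → ℍ} {x' : ℂ} {A : Set ℝ} {s : ℝ}
    (hx : HasDerivWithinAt (fun s => (x s : ℂ)) x' A s) :
    HasDerivWithinAt (fun s => (x s).re) x'.re A s :=
  Complex.reCLM.hasFDerivAt.comp_hasDerivWithinAt s hx

lemma exists_hasDerivWithinAt_borMat {x : ℝ → ℍ} {x' : ℂ} {A : Set ℝ} {s : ℝ}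
    (hx : HasDerivWithinAt (fun s => (x s : ℂ)) x' A s) :
    ∃ a b : ℝ, (∀ i j, HasDerivWithinAt (fun s => borMat (x s) i j)
        (!![a, b; 0, -a / (x s).im] i j) A s) ∧
      (∀ i j, HasDerivWithinAt (fun s => (borMat (x s))⁻¹ i j)
        (!![-a / (x s).im, -b; 0, a] i j) A s) ∧
      a * ((x s).re / √(x s).im) + √(x s).im * b = x'.re := by
  have hp := Real.sqrt_pos.2 (x s).im_pos
  have h2 : √(x s).im ^ 2 = (x s).im := Real.sq_sqrt (x s).im_pos.le
  have h1 := (HasDerivWithinAt.uhp_im hx).sqrt (x s).im_pos.ne'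
  have h3 := (HasDerivWithinAt.uhp_re hx).div h1 hp.ne'
  have h4 := h1.inv hp.ne'
  rw [h2] at h4
  -- `a` and `b` are the derivatives of `√(Im x)` and `Re x / √(Im x)`; the last identity is the
  -- product rule for `Re x`.
  refine ⟨x'.im / (2 * √(x s).im),
    (x'.re * √(x s).im - (x s).re * (x'.im / (2 * √(x s).im))) / √(x s).im ^ 2, ?_, ?_, ?_⟩
  · intro i j
    fin_cases i <;> fin_cases j <;> simp [borMat]
    · exact h1
    · exact h3
    · exact hasDerivWithinAt_const _ _ _
    · exact h4
  · intro i j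
    simp only [borMat_inv_coe]
    fin_cases i <;> fin_cases j <;> simp
    · exact h4
    · exact h3.fun_neg
    · exact hasDerivWithinAt_const _ _ _
    · exact h1
  · field_simp
    ring

lemma hasDerivWithinAt_rotMat {k : ℝ → ℝ} {k' : ℝ} {A : Set ℝ} {s : ℝ}
    (hk : HasDerivWithinAt k k' A s) (i j : Fin 2) :
    HasDerivWithinAt (fun s => rotMat (k s) i j)
      (k' * (!![-Real.sin (k s), Real.cos (k s); -Real.cos (k s), -Real.sin (k s)] i j)) A s := by
  have hc := hk.cos
  have hs := hk.sin
  fin_cases i <;> fin_cases j <;> simp [rotMat]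
  · simpa [mul_comm] using hc
  · simpa [mul_comm] using hs
  · simpa [mul_comm] using hs.fun_neg
  · simpa [mul_comm] using hc

/-- Along a curve, the connection form is `dt + (Re dx / Im x - Re dy / Im y) / 2` in the
trivialisation. -/
lemma exists_hasDerivWithinAt_triple {k : ℝ → ℝ} {x y : ℝ → ℍ} {k' : ℝ} {x' y' : ℂ}
    {A : Set ℝ} {s : ℝ} (hk : HasDerivWithinAt k k' A s)
    (hx : HasDerivWithinAt (fun s => (x s : ℂ)) x' A s)
    (hy : HasDerivWithinAt (fun s => (y s : ℂ)) y' A s) :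
    ∃ D : Coord, HasDerivWithinAt (fun s => (triple (k s) (x s) (y s)).coord) D A s ∧
      connForm (triple (k s) (x s) (y s)) D =
        k' + 1 / 2 * (x'.re / (x s).im - y'.re / (y s).im) := by
  obtain ⟨a, b, hB, -, hab⟩ := exists_hasDerivWithinAt_borMat hx
  obtain ⟨c, d, hC, hC', hcd⟩ := exists_hasDerivWithinAt_borMat hy
  have hR := hasDerivWithinAt_rotMat hk
  have hfst : ∀ i j, ∃ D, HasDerivWithinAt (fun s => (triple (k s) (x s) (y s)).pt.mat i j) D A s ∧
      D = _ := fun i j => by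
    simp only [triple_mat_apply]
    exact ⟨_, ((((hB i 0).mul (hR 0 0)).add ((hB i 1).mul (hR 1 0))).mul (hC' 0 j)).add
      ((((hB i 0).mul (hR 0 1)).add ((hB i 1).mul (hR 1 1))).mul (hC' 1 j)), rfl⟩
  have hsnd : ∀ i j, ∃ D, HasDerivWithinAt (fun s => (triple (k s) (x s) (y s)).vec i j) D A s := by
    intro i j
    change ∃ D, HasDerivWithinAt (fun s => Ad (borMat (y s)) rotGen i j) D A s
    simp only [Ad, Matrix.mul_apply, Fin.sum_univ_two]
    exact ⟨_, ((((hC i 0).mul_const _).add ((hC i 1).mul_const _)).mul (hC' 0 j)).add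
      ((((hC i 0).mul_const _).add ((hC i 1).mul_const _)).mul (hC' 1 j))⟩
  choose D₁ hD₁ hD₁' using hfst
  choose D₂ hD₂ using hsnd
  refine ⟨(D₁, D₂), HasDerivWithinAt.prodMk
    (hasDerivWithinAt_pi.2 fun i => hasDerivWithinAt_pi.2 fun j => hD₁ i j)
    (hasDerivWithinAt_pi.2 fun i => hasDerivWithinAt_pi.2 fun j => hD₂ i j), ?_⟩
  have hpx := Real.sqrt_pos.2 (x s).im_pos
  have hpy := Real.sqrt_pos.2 (y s).im_pos
  have h2x : √(x s).im ^ 2 = (x s).im := Real.sq_sqrt (x s).im_pos.le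
  have h2y : √(y s).im ^ 2 = (y s).im := Real.sq_sqrt (y s).im_pos.le
  have hU : (triple (k s) (x s) (y s)).vec = !![-(y s).re / (y s).im,
    ((y s).re ^ 2 + (y s).im ^ 2) / (y s).im; -1 / (y s).im, (y s).re / (y s).im] :=
    Ad_borMat (y s)
  have hyre : (y s).re = √(y s).im * ((y s).re / √(y s).im) := by field_simp
  rw [connForm_eq, trace_two]
  simp only [sl_inv_entries (triple (k s) (x s) (y s)).pt.mat, hU, triple_mat_apply, hD₁',
    Matrix.mul_apply, Fin.sum_univ_two, Matrix.of_apply, borMat_inv_coe, Pi.add_apply, Pi.mul_apply]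
  rw [← hab, ← hcd]
  simp only [borMat, rotMat, Matrix.SpecialLinearGroup.coe_mk, Matrix.of_apply, Matrix.cons_val',
    Matrix.cons_val_zero, Matrix.cons_val_one, Matrix.cons_val_fin_one]
  generalize (x s).re / √(x s).im = β at *
  generalize hδ : (y s).re / √(y s).im = δ at *
  rw [hyre, ← h2x, ← h2y]
  simp only [Real.sqrt_sq hpx.le, Real.sqrt_sq hpy.le]
  generalize √(x s).im = α at *
  generalize √(y s).im = γ at *
  have cs := Real.sin_sq_add_cos_sq (k s)
  generalize Real.sin (k s) = σ at *
  generalize Real.cos (k s) = τ at *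
  -- With sine and cosine treated as free variables, the trace is a quadratic form in them, and the
  -- factor `σ² + τ²` makes the identity purely algebraic.
  trans (σ ^ 2 + τ ^ 2) *
    (k' + 1 / 2 * ((a * β + α * b) / α ^ 2 - (c * δ + γ * d) / γ ^ 2))
  · field_simp
    ring
  · rw [cs, one_mul]

/-! ### Smoothness in the trivialisation -/

variable {n : ℕ∞ω} {A : Set ℝ}

lemma contDiffOn_uhp_im {x : ℝ → ℍ} (hx : ContDiffOn ℝ n (fun s => (x s : ℂ)) A) :
    ContDiffOn ℝ n (fun s => (x s).im) A := Complex.imCLM.contDiff.comp_contDiffOn hx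

lemma contDiffOn_uhp_re {x : ℝ → ℍ} (hx : ContDiffOn ℝ n (fun s => (x s : ℂ)) A) :
    ContDiffOn ℝ n (fun s => (x s).re) A := Complex.reCLM.contDiff.comp_contDiffOn hx

lemma contDiffOn_borMat {x : ℝ → ℍ} (hx : ContDiffOn ℝ n (fun s => (x s : ℂ)) A) (i j : Fin 2) :
    ContDiffOn ℝ n (fun s => borMat (x s) i j) A := by
  have h1 : ContDiffOn ℝ n (fun s => √(x s).im) A :=
    (contDiffOn_uhp_im hx).sqrt fun s _ => (x s).im_pos.ne'
  have h0 : ∀ s ∈ A, √(x s).im ≠ 0 := fun s _ => (Real.sqrt_pos.2 (x s).im_pos).ne'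
  fin_cases i <;> fin_cases j <;> simp [borMat]
  · exact h1
  · exact (contDiffOn_uhp_re hx).div h1 h0
  · exact contDiffOn_const
  · exact h1.inv h0

lemma contDiffOn_borMat_inv {x : ℝ → ℍ} (hx : ContDiffOn ℝ n (fun s => (x s : ℂ)) A) (i j : Fin 2) :
    ContDiffOn ℝ n (fun s => (borMat (x s))⁻¹ i j) A := by
  have h := contDiffOn_borMat hx
  simp only [sl_inv_entries]
  fin_cases i <;> fin_cases j <;> simp
  · exact h 1 1
  · exact (h 0 1).neg
  · exact (h 1 0).neg
  · exact h 0 0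

lemma contDiffOn_triple {k : ℝ → ℝ} {x y : ℝ → ℍ} (hk : ContDiffOn ℝ n k A)
    (hx : ContDiffOn ℝ n (fun s => (x s : ℂ)) A) (hy : ContDiffOn ℝ n (fun s => (y s : ℂ)) A) :
    ContDiffOn ℝ n (fun s => (triple (k s) (x s) (y s)).coord) A := by
  have hB := contDiffOn_borMat hx
  have hC := contDiffOn_borMat hy
  have hC' := contDiffOn_borMat_inv hy
  have hR : ∀ i j, ContDiffOn ℝ n (fun s => rotMat (k s) i j) A := by
    intro i j
    fin_cases i <;> fin_cases j <;> simp [rotMat]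
    · exact hk.cos
    · exact hk.sin
    · exact hk.sin.neg
    · exact hk.cos
  refine ContDiffOn.prodMk (contDiffOn_pi.2 fun i => contDiffOn_pi.2 fun j => ?_)
    (contDiffOn_pi.2 fun i => contDiffOn_pi.2 fun j => ?_)
  · simp only [triple_mat_apply]
    exact ((((hB i 0).mul (hR 0 0)).add ((hB i 1).mul (hR 1 0))).mul (hC' 0 j)).add
      ((((hB i 0).mul (hR 0 1)).add ((hB i 1).mul (hR 1 1))).mul (hC' 1 j))
  · change ContDiffOn ℝ n (fun s => Ad (borMat (y s)) rotGen i j) A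
    simp only [Ad, Matrix.mul_apply, Fin.sum_univ_two]
    exact ((((hC i 0).mul contDiffOn_const).add ((hC i 1).mul contDiffOn_const)).mul (hC' 0 j)).add
      ((((hC i 0).mul contDiffOn_const).add ((hC i 1).mul contDiffOn_const)).mul (hC' 1 j))

/-- Near `s₀`, continuity keeps `f s - f s₀` within `π/2` of zero, where `f s = f s₀ + arcsin (sin
(f s - f s₀))`. The addition formula makes the inner sine smooth. -/
lemma contDiffOn_of_cos_sin {f : ℝ → ℝ} (hf : ContinuousOn f A)
    (hc : ContDiffOn ℝ n (fun s => Real.cos (f s)) A)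
    (hs : ContDiffOn ℝ n (fun s => Real.sin (f s)) A) : ContDiffOn ℝ n f A := by
  intro s₀ hs₀
  have h1 : ContDiffWithinAt ℝ n (fun s => Real.sin (f s - f s₀)) A s₀ := by
    simp only [Real.sin_sub]
    exact ((hs s₀ hs₀).mul contDiffWithinAt_const).sub ((hc s₀ hs₀).mul contDiffWithinAt_const)
  have h2 : ContDiffAt ℝ n Real.arcsin (Real.sin (f s₀ - f s₀)) := by
    apply Real.contDiffAt_arcsin <;> simp
  have h3 : ContDiffWithinAt ℝ n (fun s => f s₀ + Real.arcsin (Real.sin (f s - f s₀))) A s₀ :=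
    contDiffWithinAt_const.add
      (ContDiffAt.comp_contDiffWithinAt (g := Real.arcsin) (f := fun s => Real.sin (f s - f s₀))
        s₀ h2 h1)
  refine h3.congr_of_eventuallyEq ?_ (by simp)
  have h4 : ∀ᶠ s in 𝓝[A] s₀, f s ∈ Metric.ball (f s₀) (Real.pi / 2) :=
    (hf s₀ hs₀).eventually (Metric.ball_mem_nhds _ (by positivity))
  filter_upwards [h4] with s hs
  rw [Metric.mem_ball, Real.dist_eq, abs_lt] at hs
  rw [Real.arcsin_sin hs.1.le hs.2.le]
  ring

variable {F : ℝ → T1}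

lemma contDiffOn_mat (hF : ContDiffOn ℝ n (fun s => (F s).coord) A) (i j : Fin 2) :
    ContDiffOn ℝ n (fun s => (F s).pt.mat i j) A :=
  contDiffOn_pi.1 (contDiffOn_pi.1 (contDiff_fst.comp_contDiffOn hF) i) j

lemma contDiffOn_vec (hF : ContDiffOn ℝ n (fun s => (F s).coord) A) (i j : Fin 2) :
    ContDiffOn ℝ n (fun s => (F s).vec i j) A :=
  contDiffOn_pi.1 (contDiffOn_pi.1 (contDiff_snd.comp_contDiffOn hF) i) j

lemma ContDiffOn.ofReal_complex {f : ℝ → ℝ} (hf : ContDiffOn ℝ n f A) :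
    ContDiffOn ℝ n (fun s => (f s : ℂ)) A := Complex.ofRealCLM.contDiff.comp_contDiffOn hf

lemma contDiffOn_ctr (hF : ContDiffOn ℝ n (fun s => (F s).coord) A) :
    ContDiffOn ℝ n (fun s => ((F s).ctr : ℂ)) A := by
  have : (fun s => ((F s).ctr : ℂ)) = fun s =>
      (((F s).vec 0 0 / (F s).vec 1 0 : ℝ) : ℂ) + ((-1 / (F s).vec 1 0 : ℝ) : ℂ) * Complex.I := by
    funext q
    exact (Complex.re_add_im ((F q).ctr : ℂ)).symm
  rw [this]
  have h := contDiffOn_vec hF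
  have h0 : ∀ s ∈ A, (F s).vec 1 0 ≠ 0 := fun s _ => (F s).future.ne
  exact (ContDiffOn.ofReal_complex ((h 0 0).div (h 1 0) h0)).add
    ((ContDiffOn.ofReal_complex (contDiffOn_const.div (h 1 0) h0)).mul contDiffOn_const)

lemma contDiffOn_img (hF : ContDiffOn ℝ n (fun s => (F s).coord) A) :
    ContDiffOn ℝ n (fun s => ((F s).img : ℂ)) A := by
  simp only [T1.img, sl_smul_im_re, div_eq_mul_inv]
  have h := fun i j => ContDiffOn.ofReal_complex (contDiffOn_mat hF i j)
  have hc := contDiffOn_ctr hF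
  exact (((h 0 0).mul hc).add (h 0 1)).mul ((((h 1 0).mul hc).add (h 1 1)).inv
    fun s _ => sl_denom_ne_zero _ _)

lemma contDiffOn_time (hc : ContinuousOn F A) (hF : ContDiffOn ℝ n (fun s => (F s).coord) A) :
    ContDiffOn ℝ n (fun s => (F s).time) A := by
  have h1 := contDiffOn_borMat_inv (contDiffOn_img hF)
  have h2 := contDiffOn_mat hF
  have h3 := contDiffOn_borMat (contDiffOn_ctr hF)
  have h : ∀ i j, ContDiffOn ℝ n (fun s => rotMat (F s).time i j) A := by
    intro i j
    simp only [T1.rotMat_time, sl_mul_apply]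
    exact ((((h1 i 0).mul (h2 0 0)).add ((h1 i 1).mul (h2 1 0))).mul (h3 0 j)).add
      ((((h1 i 0).mul (h2 0 1)).add ((h1 i 1).mul (h2 1 1))).mul (h3 1 j))
  exact contDiffOn_of_cos_sin (T1.continuous_time.comp_continuousOn hc)
    (by simpa [rotMat] using h 0 0) (by simpa [rotMat] using h 0 1)

end Curves

/-! ### The hyperbolic plane as a real manifold -/

section UHP

variable {n : ℕ∞ω}

lemma contMDiff_coe_real : ContMDiff 𝓘(ℝ, ℂ) 𝓘(ℝ, ℂ) n ((↑) : ℍ → ℂ) :=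
  fun _ => contMDiffAt_extChartAt

lemma contMDiffAt_ofComplex_real {z : ℂ} (hz : 0 < z.im) :
    ContMDiffAt 𝓘(ℝ, ℂ) 𝓘(ℝ, ℂ) n UpperHalfPlane.ofComplex z := by
  rw [contMDiffAt_iff]
  refine ⟨(UpperHalfPlane.contMDiffAt_ofComplex (n := 0) hz).continuousAt, ?_⟩
  simpa using! contDiffAt_id.congr_of_eventuallyEq
    (UpperHalfPlane.eventuallyEq_coe_comp_ofComplex hz)

variable {E H M : Type*} [NormedAddCommGroup E] [NormedSpace ℝ E] [TopologicalSpace H]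
  {I : ModelWithCorners ℝ E H} [TopologicalSpace M] [ChartedSpace H M]

lemma contMDiffOn_uhp_iff {f : M → ℍ} {A : Set M} : ContMDiffOn I 𝓘(ℝ, ℂ) n f A ↔
    ContMDiffOn I 𝓘(ℝ, ℂ) n (fun x => (f x : ℂ)) A := by
  constructor
  · intro h
    exact contMDiff_coe_real.comp_contMDiffOn h
  · intro h x hx
    have := (contMDiffAt_ofComplex_real (n := n) (f x).im_pos).comp_contMDiffWithinAt x (h x hx)
    refine this.congr (fun y _ => ?_) ?_ <;> simp

lemma contMDiffOn_curve_iff {f : ℝ → ℍ} {A : Set ℝ} : ContMDiffOn 𝓘(ℝ, ℝ) 𝓘(ℝ, ℂ) n f A ↔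
    ContDiffOn ℝ n (fun x => (f x : ℂ)) A := by
  rw [contMDiffOn_uhp_iff, contMDiffOn_iff_contDiffOn]

lemma uhp_hasMFDerivAt_iff {f : ℍ → ℍ} {z : ℍ} {f' : ℂ →L[ℝ] ℂ} :
    HasMFDerivAt 𝓘(ℝ, ℂ) 𝓘(ℝ, ℂ) f z f' ↔
      ContinuousAt f z ∧ HasFDerivAt (fun w : ℂ => (f (UpperHalfPlane.ofComplex w) : ℂ)) f' z := by
  refine and_congr_right fun _ => ?_
  simp only [ModelWithCorners.range_eq_univ]
  refine (hasFDerivWithinAt_univ (𝕜 := ℝ) (E := ℂ) (F := ℂ)).trans ?_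
  refine Filter.EventuallyEq.hasFDerivAt_iff ?_
  filter_upwards [(UpperHalfPlane.isOpen_upperHalfPlaneSet).mem_nhds z.im_pos] with w hw
  change ((f _ : ℍ) : ℂ) = _
  congr 2

lemma hasMFDerivAt_smul (A : SL(2, ℝ)) (z : ℍ) :
    HasMFDerivAt 𝓘(ℝ, ℂ) 𝓘(ℝ, ℂ) (fun z : ℍ => A • z) z
      ((ContinuousLinearMap.toSpanSingleton ℂ
        (1 / ((A 1 0 : ℂ) * z + A 1 1) ^ 2 : ℂ)).restrictScalars ℝ) := by
  rw [uhp_hasMFDerivAt_iff]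
  refine ⟨(continuous_const_smul A).continuousAt, ?_⟩
  have h := (UpperHalfPlane.hasStrictDerivAt_smul (g := (A : GL (Fin 2) ℝ)) (by simp) z).hasDerivAt
  have h2 := h.hasFDerivAt.restrictScalars ℝ
  convert! h2 using 3
  simp [UpperHalfPlane.denom]

/-- With `d = cz + d'` the denominator of the action, the Jacobian `|d|⁻⁴` cancels against the
square of `Im (A • z) = Im z / |d|²`. -/
lemma hypArea_smul (A : SL(2, ℝ)) (z : ℍ) (a b : ℂ) :
    hypArea (A • z) (a * (1 / ((A 1 0 : ℂ) * z + A 1 1) ^ 2)) (b * (1 / ((A 1 0 : ℂ) * z + A 1 1) ^ 2))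
      = hypArea z a b := by
  have him : (A • z).im = z.im / Complex.normSq ((A 1 0 : ℂ) * z + A 1 1) := by
    have := UpperHalfPlane.im_smul_eq_div_normSq (A : GL (Fin 2) ℝ) z
    change ((A : GL (Fin 2) ℝ) • z).im = _
    simpa [UpperHalfPlane.denom] using this
  have h0 := sl_denom_ne_zero A z
  set d := (A 1 0 : ℂ) * z + A 1 1
  have hn : Complex.normSq d ≠ 0 := by simpa using h0
  have key : ∀ a b l : ℂ, (a * l).re * (b * l).im - (a * l).im * (b * l).re =
      (a.re * b.im - a.im * b.re) * Complex.normSq l := by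
    intro a b l
    simp only [Complex.mul_re, Complex.mul_im, Complex.normSq_apply]
    ring
  rw [hypArea, hypArea, him, key, map_div₀, map_pow, map_one]
  have := z.im_pos.ne'
  field_simp

end UHP

/-! ### Deck transformations -/

lemma proj_act (g : UnivSL2) (z : ℍ) : pslAct g.proj z = g.mat • z := rfl

lemma exists_pslAct (g : PSL(2, ℝ)) : ∃ A : SL(2, ℝ), ∀ z, pslAct g z = A • z := by
  obtain ⟨A, rfl⟩ := QuotientGroup.mk_surjective g
  exact ⟨A, fun z => rfl⟩

lemma continuous_pslAct (g : PSL(2, ℝ)) : Continuous (pslAct g) := by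
  obtain ⟨A, hA⟩ := exists_pslAct g
  rw [show ⇑(pslAct g) = fun z => A • z from funext hA]
  exact continuous_const_smul A

/-- The class of a loop in the fundamental group. -/
def loopClass {S : Type*} [TopologicalSpace S] {x₀ : S} (l : Path x₀ x₀) : FundamentalGroup S x₀ :=
  FundamentalGroup.fromPath (Path.Homotopic.Quotient.mk l)

lemma exists_loopClass {S : Type*} [TopologicalSpace S] {x₀ : S}
    (τ : FundamentalGroup S x₀) : ∃ l : Path x₀ x₀, loopClass l = τ :=
  Path.Homotopic.Quotient.mk_surjective τ

section Surface

variable {S : Type*} [TopologicalSpace S] [ChartedSpace (EuclideanSpace ℝ (Fin 2)) S]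
  {o : ∀ x : S, Orientation ℝ (TangentSpace (𝓡 2) x) (Fin 2)} {x₀ : S}
  {ρ : FundamentalGroup S x₀ →* PSL(2, ℝ)} {q : ℍ → S} {z₀ : ℍ}

lemma IsFuchsian.exists_lift (h : IsFuchsian o ρ q z₀) (l : Path x₀ x₀) :
    ∃ Γ : C(unitInterval, ℍ), Γ 0 = z₀ ∧ (∀ s, q (Γ s) = l s) ∧
      pslAct (ρ (loopClass l)) (Γ 1) = z₀ := by
  obtain ⟨Γ, h1, h2⟩ := h.covering.exists_path_lifts l z₀ (by simp [h.base])
  exact ⟨Γ, h2, fun s => congrFun h1 s, h.monodromy l Γ h2 fun s => congrFun h1 s⟩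

/-- The deck group is transitive on the fibres of the covering. -/
lemma IsFuchsian.exists_deck (h : IsFuchsian o ρ q z₀) {z z' : ℍ} (hz : q z = q z') :
    ∃ τ, pslAct (ρ τ) z = z' := by
  obtain ⟨δ⟩ := PathConnectedSpace.joined z₀ z'
  obtain ⟨ε⟩ := PathConnectedSpace.joined z₀ z
  have hq := h.covering.continuous
  -- The image of the path from `z₀` to `z'`, run backwards and lifted from `z` instead of `z'`.
  -- Preceded by the image of `ε` it closes up to a loop, whose deck transformation sends `σ 1` to
  -- `z₀`.
  let back : Path (q z) (q z₀) := ((δ.map hq).symm).cast hz rfl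
  obtain ⟨σ, hσ, hσ0⟩ := h.covering.exists_path_lifts back z (by simp)
  let σ' : Path z (σ 1) := ⟨σ, hσ0, rfl⟩
  let γ : Path x₀ x₀ := ((ε.map hq).trans back).cast h.base.symm h.base.symm
  have hmon := h.monodromy γ (ε.trans σ').toContinuousMap (by simp) (by
    intro s
    change q ((ε.trans σ') s) = ((ε.map hq).trans back) s
    rw [Path.trans_apply, Path.trans_apply]
    split_ifs
    · rfl
    · exact congrFun hσ _)
  refine ⟨loopClass γ, ?_⟩
  have h1 : pslAct (ρ (loopClass γ)) (σ 1) = z₀ := by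
    have : (ε.trans σ').toContinuousMap 1 = σ 1 := (ε.trans σ').target
    rwa [this] at hmon
  -- The translated reverse of `σ` and the path `δ` lift the same path from `z₀`; comparing their
  -- endpoints gives `z ↦ z'`.
  have h2 := h.covering.eq_of_comp_eq
    (g₁ := fun s => pslAct (ρ (loopClass γ)) (σ (unitInterval.symm s))) (g₂ := δ)
    ((continuous_pslAct _).comp (σ.continuous.comp unitInterval.continuous_symm)) δ.continuous
    (funext fun s => by
      have := congrFun hσ (unitInterval.symm s)
      simp only [Function.comp_apply, h.deck] at this ⊢
      rw [this]
      simp [back]) 0 (by simpa using h1)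
  have := congrFun h2 1
  simpa [hσ0] using this

/-- The deck group acts freely. -/
lemma IsFuchsian.eq_one_of_fixed (h : IsFuchsian o ρ q z₀) {τ : FundamentalGroup S x₀} {z : ℍ}
    (hz : pslAct (ρ τ) z = z) : τ = 1 := by
  -- A deck transformation and the identity are two lifts of `q`, so one common value makes them
  -- equal.
  have h1 : ∀ w, pslAct (ρ τ) w = w := fun w => congrFun
    (h.covering.eq_of_comp_eq (continuous_pslAct (ρ τ)) continuous_id
      (funext fun w => h.deck τ w) z hz) w
  obtain ⟨l, rfl⟩ := exists_loopClass τ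
  obtain ⟨Γ, h0, hl, hm⟩ := h.exists_lift l
  rw [h1] at hm
  let Γ' : Path z₀ z₀ := ⟨Γ, h0, hm⟩
  -- The lifted loop now closes up; it is null-homotopic in the simply connected `ℍ`, and the
  -- homotopy projects to `S`.
  have h2 : Γ'.Homotopic (Path.refl z₀) := SimplyConnectedSpace.paths_homotopic _ _
  have h3 := (h2.map ⟨q, h.covering.continuous⟩).pathCast h.base.symm h.base.symm
  rw [FundamentalGroup.one_def, ← Path.Homotopic.Quotient.mk_refl]
  refine Path.Homotopic.Quotient.eq.2 ?_
  convert! h3 using 1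
  · ext s
    exact (hl s).symm
  · ext s
    exact h.base.symm

lemma IsFuchsian.deck_unique (h : IsFuchsian o ρ q z₀) {τ τ' : FundamentalGroup S x₀} {z : ℍ}
    (hz : pslAct (ρ τ) z = pslAct (ρ τ') z) : τ = τ' := by
  have : pslAct (ρ (τ'⁻¹ * τ)) z = z := by
    rw [map_mul, map_mul, Equiv.Perm.mul_apply, hz, map_inv, map_inv]
    exact (pslAct (ρ τ')).symm_apply_apply z
  exact (inv_mul_eq_one.1 (h.eq_one_of_fixed this)).symm

variable {E H M : Type*} [NormedAddCommGroup E] [NormedSpace ℝ E] [TopologicalSpace H]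
  {I : ModelWithCorners ℝ E H} [TopologicalSpace M] [ChartedSpace H M]

/-- A continuous lift through the covering of a smooth map is smooth. -/
lemma IsFuchsian.contMDiffOn_lift (h : IsFuchsian o ρ q z₀) {n : ℕ∞ω} (hn : n ≤ ∞) {A : Set M}
    {g : M → ℍ} (hg : ContinuousOn g A) (hq : ContMDiffOn I (𝓡 2) n (fun x => q (g x)) A) :
    ContMDiffOn I 𝓘(ℝ, ℂ) n g A := by
  intro x hx
  have hd := h.localDiffeo (g x)
  have h1 := (hd.localInverse_contMDiffAt.of_le hn).comp_contMDiffWithinAt x (hq x hx)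
  refine h1.congr_of_eventuallyEq ?_ (hd.localInverse_left_inv hd.localInverse_mem_target).symm
  have := (hg x hx).eventually (hd.localInverse.open_target.mem_nhds hd.localInverse_mem_target)
  filter_upwards [this] with y hy
  exact (hd.localInverse_left_inv hy).symm

/-- Two continuous lifts which agree at a point agree nearby. -/
lemma IsFuchsian.eventually_eq (h : IsFuchsian o ρ q z₀) {X : Type*} [TopologicalSpace X]
    {g g' : X → ℍ} {A : Set X} {x : X} (hg : ContinuousWithinAt g A x)
    (hg' : ContinuousWithinAt g' A x) (hx : g x = g' x)
    (hq : ∀ᶠ y in 𝓝[A] x, q (g y) = q (g' y)) : ∀ᶠ y in 𝓝[A] x, g y = g' y := by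
  have hd := h.localDiffeo (g x)
  have hm := hd.localInverse.open_target.mem_nhds hd.localInverse_mem_target
  filter_upwards [hg.eventually hm, hg'.eventually (by rwa [← hx]), hq] with y h1 h2 h3
  rw [← hd.localInverse_left_inv h1, h3, hd.localInverse_left_inv h2]

lemma IsFuchsian.exists_C1_lift (h : IsFuchsian o ρ q z₀) {l : Path x₀ x₀} (hl : IsC1Loop l) :
    ∃ Γ : ℝ → ℍ, ContDiffOn ℝ 1 (fun s => (Γ s : ℂ)) (Set.Icc 0 1) ∧ Γ 0 = z₀ ∧
      (∀ s ∈ Set.Icc (0 : ℝ) 1, q (Γ s) = l.extend s) ∧ pslAct (ρ (loopClass l)) (Γ 1) = z₀ := by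
  obtain ⟨Γ, h0, h1, h2⟩ := h.exists_lift l
  have hΓ : ∀ s ∈ Set.Icc (0 : ℝ) 1, q (Set.IccExtend zero_le_one Γ s) = l.extend s := by
    intro s hs
    rw [Set.IccExtend_of_mem _ _ hs, h1, Path.extend_apply _ hs]
  refine ⟨Set.IccExtend zero_le_one Γ, ?_, ?_, hΓ, ?_⟩
  · rw [← contMDiffOn_curve_iff]
    refine h.contMDiffOn_lift (by exact_mod_cast le_top)
      (Γ.continuous.Icc_extend').continuousOn (hl.congr hΓ)
  · rw [Set.IccExtend_left]
    exact h0
  · rw [Set.IccExtend_right]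
    exact h2

/-- The straight segment between two points of the hyperbolic plane. -/
noncomputable def seg (z w : ℍ) (s : ℝ) : ℍ :=
  UpperHalfPlane.ofComplex (AffineMap.lineMap (z : ℂ) (w : ℂ) s)

lemma seg_coe (z w : ℍ) {s : ℝ} (hs : s ∈ Set.Icc (0 : ℝ) 1) :
    (seg z w s : ℂ) = AffineMap.lineMap (z : ℂ) (w : ℂ) s := by
  have : 0 < (AffineMap.lineMap (z : ℂ) (w : ℂ) s : ℂ).im :=
    (convex_halfSpace_im_gt 0).lineMap_mem z.im_pos w.im_pos hs
  rw [seg, UpperHalfPlane.ofComplex_apply_of_im_pos this]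

lemma seg_zero (z w : ℍ) : seg z w 0 = z := by simp [seg]
lemma seg_one (z w : ℍ) : seg z w 1 = w := by simp [seg]

lemma contDiffOn_seg (z w : ℍ) {n : ℕ∞ω} :
    ContDiffOn ℝ n (fun s => (seg z w s : ℂ)) (Set.Icc 0 1) := by
  refine ContDiffOn.congr (f := fun s => AffineMap.lineMap (z : ℂ) (w : ℂ) s) ?_
    fun s hs => seg_coe z w hs
  simp only [AffineMap.lineMap_apply, vsub_eq_sub, vadd_eq_add]
  fun_prop

lemma continuousOn_uhp {X : Type*} [TopologicalSpace X] {f : X → ℍ} {A : Set X}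
    (h : ContinuousOn (fun x => (f x : ℂ)) A) : ContinuousOn f A :=
  UpperHalfPlane.isOpenEmbedding_coe.isEmbedding.continuousOn_iff.2 h

/-- Every class of the fundamental group contains a `C¹` loop. -/
lemma IsFuchsian.exists_C1_loop (h : IsFuchsian o ρ q z₀) (τ : FundamentalGroup S x₀) :
    ∃ l : Path x₀ x₀, IsC1Loop l ∧ loopClass l = τ := by
  obtain ⟨l, rfl⟩ := exists_loopClass τ
  obtain ⟨Γ, h0, h1, -⟩ := h.exists_lift l
  have hc : ContinuousOn (seg z₀ (Γ 1)) (Set.Icc 0 1) :=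
    continuousOn_uhp (contDiffOn_seg z₀ (Γ 1) (n := 0)).continuousOn
  -- The segment has the endpoints of the lift `Γ`, hence is homotopic to it in `ℍ`, and it is
  -- smooth.
  let σ : Path z₀ (Γ 1) :=
    { toFun := fun s => seg z₀ (Γ 1) s
      continuous_toFun := hc.comp_continuous continuous_subtype_val fun s => s.2
      source' := by simp [seg_zero]
      target' := by simp [seg_one] }
  let Γ' : Path z₀ (Γ 1) := ⟨Γ, h0, rfl⟩
  have h2 : σ.Homotopic Γ' := SimplyConnectedSpace.paths_homotopic _ _
  have e1 : x₀ = q (Γ 1) := by rw [h1]; simp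
  have h3 := (h2.map ⟨q, h.covering.continuous⟩).pathCast h.base.symm e1
  refine ⟨(σ.map h.covering.continuous).cast h.base.symm e1, ?_, ?_⟩
  · have : ContMDiffOn 𝓘(ℝ, ℝ) (𝓡 2) 1 (fun s => q (seg z₀ (Γ 1) s)) (Set.Icc 0 1) :=
      (h.localDiffeo.contMDiff.of_le (by exact_mod_cast le_top)).comp_contMDiffOn
        (contMDiffOn_curve_iff.2 (contDiffOn_seg _ _))
    refine this.congr fun s hs => ?_
    rw [Path.extend_apply _ hs]
    rfl
  · refine Path.Homotopic.Quotient.eq.2 ?_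
    convert! h3 using 1
    ext s
    exact (h1 s).symm

/-! ### The area form -/

/-- The preimage chosen in `areaForm` does not matter: it differs from `z` by a deck transformation,
and `PSL(2,ℝ)` preserves `hypArea`. -/
lemma IsFuchsian.areaForm_eq [IsManifold (𝓡 2) ∞ S] (h : IsFuchsian o ρ q z₀) (z : ℍ) (a b : ℂ) :
    areaForm q (q z) (mfderiv 𝓘(ℝ, ℂ) (𝓡 2) q z a) (mfderiv 𝓘(ℝ, ℂ) (𝓡 2) q z b)
      = hypArea z a b := by
  have hex : ∃ w, q w = q z := ⟨z, rfl⟩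
  rw [areaForm, dif_pos hex]
  obtain ⟨τ, hτ⟩ := h.exists_deck hex.choose_spec
  generalize hex.choose = w at *
  obtain ⟨A, hA⟩ := exists_pslAct (ρ τ)
  rw [hA] at hτ
  subst hτ
  have hd : ∀ w, MDifferentiableAt 𝓘(ℝ, ℂ) (𝓡 2) q w := fun w =>
    (h.localDiffeo w).mdifferentiableAt (by simp)
  have hcomp : ∀ c : ℂ, mfderiv 𝓘(ℝ, ℂ) (𝓡 2) q w c =
      mfderiv 𝓘(ℝ, ℂ) (𝓡 2) q (A • w) (c * (1 / ((A 1 0 : ℂ) * (w : ℂ) + (A 1 1 : ℂ)) ^ 2)) := by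
    intro c
    have h1 := (hd (A • w)).hasMFDerivAt.comp w (hasMFDerivAt_smul A w)
    have h2 : (q ∘ fun z : ℍ => A • z) = q := funext fun z => by
      have := h.deck τ z
      rwa [hA] at this
    rw [h2] at h1
    rw [h1.mfderiv]
    rfl
  have h0 : (1 / ((A 1 0 : ℂ) * (w : ℂ) + (A 1 1 : ℂ)) ^ 2) ≠ 0 := by
    have := sl_denom_ne_zero A w
    exact one_div_ne_zero (pow_ne_zero 2 this)
  have hinv : ∀ c : ℂ, (mfderiv 𝓘(ℝ, ℂ) (𝓡 2) q w).inverse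
      (mfderiv 𝓘(ℝ, ℂ) (𝓡 2) q (A • w) c) = c / (1 / ((A 1 0 : ℂ) * (w : ℂ) + (A 1 1 : ℂ)) ^ 2) := by
    intro c
    have h1 : mfderiv 𝓘(ℝ, ℂ) (𝓡 2) q w
        (c / (1 / ((A 1 0 : ℂ) * (w : ℂ) + (A 1 1 : ℂ)) ^ 2) : ℂ) =
        mfderiv 𝓘(ℝ, ℂ) (𝓡 2) q (A • w) c :=
      (hcomp _).trans (congrArg (fun u : ℂ => mfderiv 𝓘(ℝ, ℂ) (𝓡 2) q (A • w) u)
        (div_mul_cancel₀ c h0))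
    have e := (h.localDiffeo w).mfderivToContinuousLinearEquiv_coe (by simp)
    rw [← h1, ← e, ContinuousLinearMap.inverse_equiv]
    exact ContinuousLinearEquiv.symm_apply_apply _ _
  refine (congrArg₂ (hypArea w) (hinv a) (hinv b)).trans ((hypArea_smul A w _ _).symm.trans ?_)
  exact congrArg₂ (hypArea (A • w)) (div_mul_cancel₀ a h0) (div_mul_cancel₀ b h0)

end Surface

section Lift

variable {S : Type*} [TopologicalSpace S] [ChartedSpace (EuclideanSpace ℝ (Fin 2)) S]
  {o : ∀ x : S, Orientation ℝ (TangentSpace (𝓡 2) x) (Fin 2)} {x₀ : S}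
  {ρl ρr : FundamentalGroup S x₀ →* PSL(2, ℝ)} {ql qr : ℍ → S} {zl zr : ℍ}

/-! ### The equivariant lift of a Lagrangian embedding -/

/-- The equivariant lift of the identity between the two hyperbolic structures. -/
lemma exists_equivariant_id (hl : IsFuchsian o ρl ql zl) (hr : IsFuchsian o ρr qr zr) :
    ∃ φ : C(ℍ, ℍ), (∀ z, qr (φ z) = ql z) ∧
      ∀ τ z, φ (pslAct (ρl τ) z) = pslAct (ρr τ) (φ z) := by
  obtain ⟨φ, ⟨hφ0, hφ⟩, -⟩ := hr.covering.existsUnique_continuousMap_lifts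
    ⟨ql, hl.covering.continuous⟩ zl zr (by rw [hr.base]; exact hl.base.symm)
  have hφ' : ∀ z, qr (φ z) = ql z := fun z => congrFun hφ z
  refine ⟨φ, hφ', fun τ => ?_⟩
  obtain ⟨l, rfl⟩ := exists_loopClass τ
  obtain ⟨Γ, h0, h1, h2⟩ := hl.exists_lift l
  have h3 := hr.monodromy l (φ.comp Γ) (by simp [h0, hφ0]) (fun s => by simp [hφ', h1])
  -- Both maps lift `ql` through `qr`, and monodromy for the two structures sends both values at `Γ
  -- 1` to `zr`.
  refine fun z => congrFun (hr.covering.eq_of_comp_eq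
    (g₁ := fun z => φ (pslAct (ρl (loopClass l)) z))
    (g₂ := fun z => pslAct (ρr (loopClass l)) (φ z))
    (φ.continuous.comp (continuous_pslAct _)) ((continuous_pslAct _).comp φ.continuous)
    (funext fun z => ?_) (Γ 1) ?_) z
  · simp [hφ', hr.deck, hl.deck]
  · rw [h2, hφ0]
    exact h3.symm

/-- A lift of a homotopy is equivariant if it is so at time `0`. -/
lemma IsFuchsian.liftHomotopy_equivariant (h : IsFuchsian o ρr qr zr) {H : C(unitInterval × ℍ, S)}
    {f : C(ℍ, ℍ)} (H0 : ∀ z, H (0, z) = qr (f z)) {τ : FundamentalGroup S x₀} {z : ℍ}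
    (hf : f (pslAct (ρl τ) z) = pslAct (ρr τ) (f z))
    (hH : ∀ t, H (t, pslAct (ρl τ) z) = H (t, z)) (t : unitInterval) :
    h.covering.liftHomotopy H f H0 (t, pslAct (ρl τ) z) =
      pslAct (ρr τ) (h.covering.liftHomotopy H f H0 (t, z)) := by
  have hlift := fun p => congrFun (h.covering.liftHomotopy_lifts H f H0) p
  simp only [Function.comp_apply] at hlift
  refine congrFun (h.covering.eq_of_comp_eq
    (g₁ := fun t => h.covering.liftHomotopy H f H0 (t, pslAct (ρl τ) z))
    (g₂ := fun t => pslAct (ρr τ) (h.covering.liftHomotopy H f H0 (t, z)))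
    ?_ ?_ (funext fun t => ?_) 0 ?_) t
  · exact (h.covering.liftHomotopy H f H0).continuous.comp (by fun_prop)
  · exact (continuous_pslAct _).comp
      ((h.covering.liftHomotopy H f H0).continuous.comp (by fun_prop))
  · simp only [Function.comp_apply, h.deck, hlift, hH]
  · rw [h.covering.liftHomotopy_zero, h.covering.liftHomotopy_zero, hf]

/-- The isotopy from the diagonal is lifted componentwise, starting from `(id, φ)` with `φ` the
equivariant lift of the identity of `S`. Equivariance at time `0` propagates to time `1`. -/
lemma exists_isEquivariantLift (hl : IsFuchsian o ρl ql zl) (hr : IsFuchsian o ρr qr zr)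
    {Λ : S → S × S} (hΛ : IsLagrangianIsotopicToDiag ql qr Λ) :
    ∃ Λt : ℍ → ℍ × ℍ, IsEquivariantLift ρl ρr ql qr Λ Λt := by
  obtain ⟨φ, hφ, hφe⟩ := exists_equivariant_id hl hr
  obtain ⟨F, hF, -, hF0, hF1⟩ := hΛ.isotopic
  have hc : Continuous fun p : unitInterval × ℍ => F p.1 (ql p.2) :=
    hF.continuous.comp (f := fun p : unitInterval × ℍ => ((p.1 : ℝ), ql p.2))
      ((continuous_subtype_val.comp continuous_fst).prodMk
        (hl.covering.continuous.comp continuous_snd))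
  let H₁ : C(unitInterval × ℍ, S) := ⟨fun p => (F p.1 (ql p.2)).1, continuous_fst.comp hc⟩
  let H₂ : C(unitInterval × ℍ, S) := ⟨fun p => (F p.1 (ql p.2)).2, continuous_snd.comp hc⟩
  have e₁ : ∀ z, H₁ (0, z) = ql (ContinuousMap.id ℍ z) := fun z => by simp [H₁, hF0]
  have e₂ : ∀ z, H₂ (0, z) = qr (φ z) := fun z => by simp [H₂, hF0, hφ]
  have l₁ := fun p => congrFun (hl.covering.liftHomotopy_lifts H₁ _ e₁) p
  have l₂ := fun p => congrFun (hr.covering.liftHomotopy_lifts H₂ _ e₂) p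
  refine ⟨fun z => (hl.covering.liftHomotopy H₁ _ e₁ (1, z), hr.covering.liftHomotopy H₂ _ e₂ (1, z)),
    ?_, fun z => ?_, fun τ z => ?_⟩
  · exact ((hl.covering.liftHomotopy H₁ _ e₁).continuous.comp (by fun_prop)).prodMk
      ((hr.covering.liftHomotopy H₂ _ e₂).continuous.comp (by fun_prop))
  · refine (Prod.ext (l₁ (1, z)) (l₂ (1, z))).trans ?_
    simp [hF1]
  · refine Prod.ext ?_ ?_
    · exact hl.liftHomotopy_equivariant e₁ rfl (fun t => by simp [H₁, hl.deck]) 1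
    · exact hr.liftHomotopy_equivariant e₂ (hφe τ z) (fun t => by simp [H₂, hl.deck]) 1

/-! ### Smoothness and the Lagrangian condition on the universal cover -/

lemma IsLagrangianIsotopicToDiag.contMDiff {Λ : S → S × S}
    (hΛ : IsLagrangianIsotopicToDiag ql qr Λ) : ContMDiff (𝓡 2) ((𝓡 2).prod (𝓡 2)) ∞ Λ := by
  obtain ⟨F, hF, -, -, rfl⟩ := hΛ.isotopic
  exact hF.comp (contMDiff_const.prodMk contMDiff_id)

variable {Λ : S → S × S} {Λt : ℍ → ℍ × ℍ}

lemma IsEquivariantLift.contMDiff_fst (h : IsEquivariantLift ρl ρr ql qr Λ Λt)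
    (hl : IsFuchsian o ρl ql zl) (hΛ : IsLagrangianIsotopicToDiag ql qr Λ) :
    ContMDiff 𝓘(ℝ, ℂ) 𝓘(ℝ, ℂ) ∞ fun z => (Λt z).1 := by
  rw [← contMDiffOn_univ]
  refine hl.contMDiffOn_lift le_rfl (continuous_fst.comp h.continuous).continuousOn ?_
  rw [contMDiffOn_univ]
  have : (fun z => ql (Λt z).1) = fun z => (Λ (ql z)).1 := funext fun z =>
    congrArg Prod.fst (h.covers z)
  rw [this]
  exact _root_.contMDiff_fst.comp (hΛ.contMDiff.comp hl.localDiffeo.contMDiff)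

lemma IsEquivariantLift.contMDiff_snd (h : IsEquivariantLift ρl ρr ql qr Λ Λt)
    (hl : IsFuchsian o ρl ql zl) (hr : IsFuchsian o ρr qr zr)
    (hΛ : IsLagrangianIsotopicToDiag ql qr Λ) :
    ContMDiff 𝓘(ℝ, ℂ) 𝓘(ℝ, ℂ) ∞ fun z => (Λt z).2 := by
  rw [← contMDiffOn_univ]
  refine hr.contMDiffOn_lift le_rfl (continuous_snd.comp h.continuous).continuousOn ?_
  rw [contMDiffOn_univ]
  have : (fun z => qr (Λt z).2) = fun z => (Λ (ql z)).2 := funext fun z =>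
    congrArg Prod.snd (h.covers z)
  rw [this]
  exact _root_.contMDiff_snd.comp (hΛ.contMDiff.comp hl.localDiffeo.contMDiff)

/-- A self-map of the hyperbolic plane, as a function of a complex variable. -/
noncomputable def cpx (X : ℍ → ℍ) (w : ℂ) : ℂ := X (UpperHalfPlane.ofComplex w)

lemma cpx_coe (X : ℍ → ℍ) (z : ℍ) : cpx X z = X z := by simp [cpx]

lemma contDiffOn_cpx {X : ℍ → ℍ} (hX : ContMDiff 𝓘(ℝ, ℂ) 𝓘(ℝ, ℂ) ∞ X) :
    ContDiffOn ℝ ∞ (cpx X) UpperHalfPlane.upperHalfPlaneSet := by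
  rw [← contMDiffOn_iff_contDiffOn]
  intro w hw
  exact (((contMDiff_coe_real.comp hX).contMDiffAt).comp w
    (contMDiffAt_ofComplex_real hw)).contMDiffWithinAt

lemma differentiableAt_cpx {X : ℍ → ℍ} (hX : ContMDiff 𝓘(ℝ, ℂ) 𝓘(ℝ, ℂ) ∞ X) (z : ℍ) :
    DifferentiableAt ℝ (cpx X) z :=
  ((contDiffOn_cpx hX).contDiffAt
    (UpperHalfPlane.isOpen_upperHalfPlaneSet.mem_nhds z.im_pos)).differentiableAt (by simp)

lemma hasMFDerivAt_cpx {X : ℍ → ℍ} (hX : ContMDiff 𝓘(ℝ, ℂ) 𝓘(ℝ, ℂ) ∞ X) (z : ℍ) :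
    HasMFDerivAt 𝓘(ℝ, ℂ) 𝓘(ℝ, ℂ) X z (fderiv ℝ (cpx X) (z : ℂ) : ℂ →L[ℝ] ℂ) :=
  uhp_hasMFDerivAt_iff.2 ⟨hX.continuous.continuousAt, (differentiableAt_cpx hX z).hasFDerivAt⟩

lemma areaForm_congr (q : ℍ → S) {x x' : S} (hx : x = x') (v w : EuclideanSpace ℝ (Fin 2)) :
    areaForm q x v w = areaForm q x' v w := by
  subst hx
  rfl

/-- Pull-back of the area form along a lift. -/
lemma IsFuchsian.areaForm_pullback [IsManifold (𝓡 2) ∞ S] (h : IsFuchsian o ρr qr zr)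
    {q : ℍ → S} {X : ℍ → ℍ} {f₁ : S → S} (hX : ContMDiff 𝓘(ℝ, ℂ) 𝓘(ℝ, ℂ) ∞ X)
    (hq : ∀ z, MDifferentiableAt 𝓘(ℝ, ℂ) (𝓡 2) q z)
    (hf : ∀ x, MDifferentiableAt (𝓡 2) (𝓡 2) f₁ x) (hc : ∀ z, qr (X z) = f₁ (q z))
    (z : ℍ) (a b : ℂ) :
    areaForm qr (f₁ (q z))
      (mfderiv (𝓡 2) (𝓡 2) f₁ (q z) (mfderiv 𝓘(ℝ, ℂ) (𝓡 2) q z a))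
      (mfderiv (𝓡 2) (𝓡 2) f₁ (q z) (mfderiv 𝓘(ℝ, ℂ) (𝓡 2) q z b)) =
    hypArea (X z) (fderiv ℝ (cpx X) z a) (fderiv ℝ (cpx X) z b) := by
  have h1 := (hf (q z)).hasMFDerivAt.comp z (hq z).hasMFDerivAt
  have h2 := (((h.localDiffeo (X z)).mdifferentiableAt (by simp)).hasMFDerivAt).comp z
    (hasMFDerivAt_cpx hX z)
  have e : f₁ ∘ q = qr ∘ X := funext fun z => (hc z).symm
  rw [e] at h1
  have h3 := hasMFDerivAt_unique h1 h2
  have h4 : ∀ a : ℂ, mfderiv (𝓡 2) (𝓡 2) f₁ (q z) (mfderiv 𝓘(ℝ, ℂ) (𝓡 2) q z a) =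
      mfderiv 𝓘(ℝ, ℂ) (𝓡 2) qr (X z) (fderiv ℝ (cpx X) z a) := fun a =>
    congrArg (fun L : ℂ →L[ℝ] EuclideanSpace ℝ (Fin 2) => L a) h3
  have h5 : f₁ (q z) = qr (X z) := (hc z).symm
  rw [← h.areaForm_eq (X z)]
  refine (areaForm_congr qr h5 _ _).trans ?_
  exact congrArg₂ (fun v w : EuclideanSpace ℝ (Fin 2) => areaForm qr (qr (X z)) v w) (h4 a) (h4 b)

/-- The Lagrangian condition read on the universal cover: both components of `Λt` pull back the
hyperbolic area form to the same 2-form. -/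
lemma IsEquivariantLift.hypArea_eq [IsManifold (𝓡 2) ∞ S]
    (h : IsEquivariantLift ρl ρr ql qr Λ Λt)
    (hl : IsFuchsian o ρl ql zl) (hr : IsFuchsian o ρr qr zr)
    (hΛ : IsLagrangianIsotopicToDiag ql qr Λ) (z : ℍ) (a b : ℂ) :
    hypArea (Λt z).1 (fderiv ℝ (cpx fun z => (Λt z).1) z a) (fderiv ℝ (cpx fun z => (Λt z).1) z b) =
    hypArea (Λt z).2 (fderiv ℝ (cpx fun z => (Λt z).2) z a) (fderiv ℝ (cpx fun z => (Λt z).2) z b) := by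
  have hd : ∀ x, MDifferentiableAt (𝓡 2) ((𝓡 2).prod (𝓡 2)) Λ x := fun x =>
    (hΛ.contMDiff x).mdifferentiableAt (by simp)
  have hq : ∀ z, MDifferentiableAt 𝓘(ℝ, ℂ) (𝓡 2) ql z := fun z =>
    (hl.localDiffeo z).mdifferentiableAt (by simp)
  have h1 := hl.areaForm_pullback (q := ql) (f₁ := fun x => (Λ x).1) (h.contMDiff_fst hl hΛ) hq
    (fun x => (hd x).fst) (fun z => congrArg Prod.fst (h.covers z)) z a b
  have h2 := hr.areaForm_pullback (q := ql) (f₁ := fun x => (Λ x).2) (h.contMDiff_snd hl hr hΛ) hq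
    (fun x => (hd x).snd) (fun z => congrArg Prod.snd (h.covers z)) z a b
  have h3 := hΛ.lagrangian (ql z) (mfderiv 𝓘(ℝ, ℂ) (𝓡 2) ql z a) (mfderiv 𝓘(ℝ, ℂ) (𝓡 2) ql z b)
  have e1 : ∀ v, mfderiv (𝓡 2) (𝓡 2) (fun x => (Λ x).1) (ql z) v =
      (mfderiv (𝓡 2) ((𝓡 2).prod (𝓡 2)) Λ (ql z) v).1 := by
    intro v
    have := (hasMFDerivAt_fst (I := 𝓡 2) (I' := 𝓡 2) (Λ (ql z))).comp (ql z) (hd (ql z)).hasMFDerivAt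
    have e := this.mfderiv
    exact congrArg (fun L : EuclideanSpace ℝ (Fin 2) →L[ℝ] EuclideanSpace ℝ (Fin 2) => L v) e
  have e2 : ∀ v, mfderiv (𝓡 2) (𝓡 2) (fun x => (Λ x).2) (ql z) v =
      (mfderiv (𝓡 2) ((𝓡 2).prod (𝓡 2)) Λ (ql z) v).2 := by
    intro v
    have := (hasMFDerivAt_snd (I := 𝓡 2) (I' := 𝓡 2) (Λ (ql z))).comp (ql z) (hd (ql z)).hasMFDerivAt
    have e := this.mfderiv
    exact congrArg (fun L : EuclideanSpace ℝ (Fin 2) →L[ℝ] EuclideanSpace ℝ (Fin 2) => L v) e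
  rw [e1, e1] at h1
  rw [e2, e2] at h2
  rw [← h1, ← h2]
  exact sub_eq_zero.1 h3

end Lift

/-! ### The primitive of the difference of the connection forms -/

/-- The form `Re dX / Im X`. -/
noncomputable def potForm (X : ℂ → ℂ) (w : ℂ) : ℂ →L[ℝ] ℝ :=
  ((X w).im)⁻¹ • (Complex.reCLM.comp (fderiv ℝ X w))

/-- On the half-plane, `d(dx / y) = dx ∧ dy / y²`, and exterior derivative commutes with pull-back.
Concretely, the second derivative of `X` is symmetric and cancels, leaving the derivative of `1 / Im
X`. -/
lemma exists_hasFDerivAt_potForm {X : ℂ → ℂ} {U : Set ℂ} (hU : IsOpen U)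
    (hX : ContDiffOn ℝ ∞ X U) (him : ∀ w ∈ U, 0 < (X w).im) {w : ℂ} (hw : w ∈ U) :
    ∃ B : ℂ →L[ℝ] ℂ →L[ℝ] ℝ, HasFDerivAt (potForm X) B w ∧ ∀ a b, B a b - B b a =
      ((fderiv ℝ X w a).re * (fderiv ℝ X w b).im - (fderiv ℝ X w a).im * (fderiv ℝ X w b).re) /
        (X w).im ^ 2 := by
  have hat := hX.contDiffAt (hU.mem_nhds hw)
  have h1 : HasFDerivAt X (fderiv ℝ X w) w := (hat.differentiableAt (by simp)).hasFDerivAt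
  have h2 : HasFDerivAt (fderiv ℝ X) (fderiv ℝ (fderiv ℝ X) w) w :=
    ((hat.fderiv_right (m := 1) (by norm_cast)).differentiableAt
      (by simp)).hasFDerivAt
  have hsymm : IsSymmSndFDerivAt ℝ X w := hat.isSymmSndFDerivAt (by simp; norm_cast)
  have h3 : HasFDerivAt (fun w => (X w).im) (Complex.imCLM.comp (fderiv ℝ X w)) w :=
    Complex.imCLM.hasFDerivAt.comp w h1
  have h4 := (hasDerivAt_inv (him w hw).ne').comp_hasFDerivAt w h3
  have h5 : HasFDerivAt (fun w => Complex.reCLM.comp (fderiv ℝ X w))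
      ((ContinuousLinearMap.compL ℝ ℂ ℂ ℝ Complex.reCLM).comp (fderiv ℝ (fderiv ℝ X) w)) w :=
    (ContinuousLinearMap.compL ℝ ℂ ℂ ℝ Complex.reCLM).hasFDerivAt.comp w h2
  refine ⟨_, h4.smul h5, fun a b => ?_⟩
  have hs := hsymm.eq a b
  have hne := (him w hw).ne'
  simp [hs]
  field_simp
  ring

section Primitive

variable {S : Type*} [TopologicalSpace S] [ChartedSpace (EuclideanSpace ℝ (Fin 2)) S]
  {o : ∀ x : S, Orientation ℝ (TangentSpace (𝓡 2) x) (Fin 2)} {x₀ : S}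
  {ρl ρr : FundamentalGroup S x₀ →* PSL(2, ℝ)} {ql qr : ℍ → S} {zl zr : ℍ}
  {Λ : S → S × S} {Λt : ℍ → ℍ × ℍ}

lemma hasDerivWithinAt_cpx {X : ℍ → ℍ} (hX : ContMDiff 𝓘(ℝ, ℂ) 𝓘(ℝ, ℂ) ∞ X) {Γ : ℝ → ℍ}
    {A : Set ℝ} {s : ℝ} {Γ' : ℂ} (hΓ : HasDerivWithinAt (fun s => (Γ s : ℂ)) Γ' A s) :
    HasDerivWithinAt (fun s => (X (Γ s) : ℂ)) (fderiv ℝ (cpx X) (Γ s) Γ') A s := by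
  have := (differentiableAt_cpx hX (Γ s)).hasFDerivAt.comp_hasDerivWithinAt s hΓ
  have e : (fun s => (X (Γ s) : ℂ)) = cpx X ∘ fun s => (Γ s : ℂ) :=
    funext fun t => (cpx_coe X (Γ t)).symm
  rwa [e]

/-- Along the lift `Λt`, the function `h₁` is a primitive of `(Re dx / Im x - Re dy / Im y) / 2`. -/
structure IsPrimitive (Λt : ℍ → ℍ × ℍ) (h₁ : ℍ → ℝ) : Prop where
  contDiffOn : ∀ (Γ : ℝ → ℍ) (A : Set ℝ), ContDiffOn ℝ 1 (fun s => (Γ s : ℂ)) A →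
    ContDiffOn ℝ 1 (fun s => h₁ (Γ s)) A
  hasDeriv : ∀ (Γ : ℝ → ℍ) (A : Set ℝ) (s : ℝ) (Γ' : ℂ),
    HasDerivWithinAt (fun s => (Γ s : ℂ)) Γ' A s → ∃ x' y' : ℂ,
      HasDerivWithinAt (fun s => ((Λt (Γ s)).1 : ℂ)) x' A s ∧
      HasDerivWithinAt (fun s => ((Λt (Γ s)).2 : ℂ)) y' A s ∧
      HasDerivWithinAt (fun s => h₁ (Γ s))
        (1 / 2 * (x'.re / (Λt (Γ s)).1.im - y'.re / (Λt (Γ s)).2.im)) A s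

/-- The Lagrangian condition: the curvature of the connection form vanishes along the lift, so that
the connection form is there the differential of a function. -/
lemma IsEquivariantLift.exists_isPrimitive [IsManifold (𝓡 2) ∞ S]
    (h : IsEquivariantLift ρl ρr ql qr Λ Λt)
    (hl : IsFuchsian o ρl ql zl) (hr : IsFuchsian o ρr qr zr)
    (hΛ : IsLagrangianIsotopicToDiag ql qr Λ) : ∃ h₁ : ℍ → ℝ, IsPrimitive Λt h₁ := by
  have hX := h.contMDiff_fst hl hΛ
  have hY := h.contMDiff_snd hl hr hΛ
  set X := fun z => (Λt z).1 with hXd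
  set Y := fun z => (Λt z).2 with hYd
  let U := UpperHalfPlane.upperHalfPlaneSet
  have hU : IsOpen U := UpperHalfPlane.isOpen_upperHalfPlaneSet
  have key : ∀ w ∈ U, ∃ B : ℂ →L[ℝ] ℂ →L[ℝ] ℝ, HasFDerivAt
      (fun w => (1 / 2 : ℝ) • (potForm (cpx X) w - potForm (cpx Y) w)) B w ∧
      ∀ a b, B a b = B b a := by
    intro w hw
    obtain ⟨B, hB, hB'⟩ := exists_hasFDerivAt_potForm hU (contDiffOn_cpx hX)
      (fun w _ => UpperHalfPlane.im_pos _) hw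
    obtain ⟨C, hC, hC'⟩ := exists_hasFDerivAt_potForm hU (contDiffOn_cpx hY)
      (fun w _ => UpperHalfPlane.im_pos _) hw
    refine ⟨_, (hB.sub hC).const_smul (1 / 2 : ℝ), fun a b => ?_⟩
    have e := h.hypArea_eq hl hr hΛ ⟨w, hw⟩ a b
    have e1 := hB' a b
    have e2 := hC' a b
    have c1 : cpx X w = X ⟨w, hw⟩ := cpx_coe X ⟨w, hw⟩
    have c2 : cpx Y w = Y ⟨w, hw⟩ := cpx_coe Y ⟨w, hw⟩
    rw [c1] at e1
    rw [c2] at e2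
    have e3 : B a b - B b a = C a b - C b a := e1.trans (e.trans e2.symm)
    simp only [FunLike.coe_smul, FunLike.coe_sub, Pi.smul_apply, Pi.sub_apply, smul_eq_mul]
    linarith
  choose! B hB hB' using key
  -- The Poincaré lemma: symmetry of `B` says that the 1-form is closed.
  obtain ⟨f, hf⟩ := (convex_halfSpace_im_gt 0).exists_forall_hasFDerivAt_of_fderiv_symmetric hU
    (fun w hw => (hB w hw).differentiableAt.differentiableWithinAt)
    (fun w hw a b => by rw [(hB w hw).fderiv]; exact hB' w hw a b)
  have hf1 : ContDiffOn ℝ 1 f U := by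
    rw [← zero_add 1, contDiffOn_succ_iff_fderiv_of_isOpen hU]
    refine ⟨fun w hw => (hf w hw).differentiableAt.differentiableWithinAt, by simp, ?_⟩
    rw [contDiffOn_zero]
    refine ContinuousOn.congr (fun w hw => (hB w hw).continuousAt.continuousWithinAt)
      fun w hw => (hf w hw).fderiv
  refine ⟨fun z => f z, fun Γ A hΓ => hf1.comp hΓ fun s _ => (Γ s).im_pos,
    fun Γ A s Γ' hΓ => ⟨_, _, hasDerivWithinAt_cpx hX hΓ,
    hasDerivWithinAt_cpx hY hΓ, ?_⟩⟩
  have := (hf _ (Γ s).im_pos).comp_hasDerivWithinAt s hΓ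
  refine this.congr_deriv ?_
  simp only [potForm, cpx_coe]
  simp [X, Y]
  ring

lemma IsEquivariantLift.contDiffOn_curve
    (h : IsEquivariantLift ρl ρr ql qr Λ Λt)
    (hl : IsFuchsian o ρl ql zl) (hr : IsFuchsian o ρr qr zr)
    (hΛ : IsLagrangianIsotopicToDiag ql qr Λ) {Γ : ℝ → ℍ} {A : Set ℝ}
    (hΓ : ContDiffOn ℝ 1 (fun s => (Γ s : ℂ)) A) :
    ContDiffOn ℝ 1 (fun s => ((Λt (Γ s)).1 : ℂ)) A ∧
      ContDiffOn ℝ 1 (fun s => ((Λt (Γ s)).2 : ℂ)) A := by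
  rw [← contMDiffOn_curve_iff] at hΓ
  rw [← contMDiffOn_curve_iff (f := fun s => (Λt (Γ s)).1),
    ← contMDiffOn_curve_iff (f := fun s => (Λt (Γ s)).2)]
  exact ⟨((h.contMDiff_fst hl hΛ).of_le (by simp)).comp_contMDiffOn hΓ,
    ((h.contMDiff_snd hl hr hΛ).of_le (by simp)).comp_contMDiffOn hΓ⟩

end Primitive

/-! ### Points of the principal bundle -/

section BundlePoints

variable {G : Type*} [Group G] {ρt : G →* Isom0}

lemma Bundle.mk_eq_iff {q q' : T1} :
    Bundle.mk ρt q = Bundle.mk ρt q' ↔ ∃ g ∈ liftGroup ρt, g • q = q' := by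
  constructor
  · intro h
    obtain ⟨g, hg⟩ := MulAction.orbitRel_apply.1 (Quotient.exact h.symm)
    exact ⟨g, g.2, hg⟩
  · rintro ⟨g, hg, h⟩
    exact (Quotient.sound (MulAction.orbitRel_apply.2 ⟨⟨g, hg⟩, h⟩)).symm

lemma Bundle.mk_smul {g : UnivSL2 × UnivSL2} (hg : g ∈ liftGroup ρt) (q : T1) :
    Bundle.mk ρt (g • q) = Bundle.mk ρt q := (Bundle.mk_eq_iff.2 ⟨g, hg, rfl⟩).symm

/-- Pairs which represent the identity act trivially. -/
lemma smul_eq_self {ρl ρr : G →* PSL(2, ℝ)} (hρ : IsLift ρl ρr ρt) {g : UnivSL2 × UnivSL2}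
    (hg : (QuotientGroup.mk g : Isom0) = 1) (q : T1) : g • q = q := by
  have h1 := (QuotientGroup.eq_one_iff g).1 hg
  -- Being central in the universal cover settles the base point. For the vector, the matrix must be
  -- scalar, which follows from the lift condition at the identity.
  have h2 : g.2.proj = 1 := by rw [(hρ 1 g (by rw [hg, map_one])).2, map_one]
  have h3 := (QuotientGroup.eq_one_iff g.2.mat).1 h2
  obtain ⟨hc, he⟩ := h1
  refine T1.ext ?_ ?_
  · change g.1 * q.pt * g.2⁻¹ = q.pt
    rw [← he, ← Subgroup.mem_center_iff.1 hc q.pt, mul_inv_cancel_right]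
  · change Ad g.2.mat q.vec = q.vec
    obtain ⟨r, -, hr⟩ := Matrix.SpecialLinearGroup.mem_center_iff.1 h3
    have h4 : (g.2.mat : Matrix (Fin 2) (Fin 2) ℝ) * q.vec = q.vec * g.2.mat := by
      rw [← hr]
      exact (Matrix.scalar_commute r (fun _ => mul_comm _ _) q.vec)
    have h5 : (g.2.mat : Matrix (Fin 2) (Fin 2) ℝ) *
        ((g.2.mat⁻¹ : SL(2, ℝ)) : Matrix (Fin 2) (Fin 2) ℝ) = 1 :=
      congrArg Subtype.val (mul_inv_cancel g.2.mat)
    rw [Ad, h4, Matrix.mul_assoc, h5, Matrix.mul_one]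

/-- Independent of the representative because isometries commute with the flow. -/
lemma Bundle.flowTo_mk_triple {s a : ℝ} {x y : ℍ} {p : Bundle ρt} :
    Bundle.FlowTo s (Bundle.mk ρt (triple a x y)) p ↔ p = Bundle.mk ρt (triple (a + s) x y) := by
  constructor
  · rintro ⟨q, q', h1, rfl, h3⟩
    obtain ⟨g, hg, h4⟩ := Bundle.mk_eq_iff.1 h1
    rw [← triple_coords q] at h3 h4
    rw [flowTo_triple_iff.1 h3]
    exact Bundle.mk_eq_iff.2 ⟨g, hg, smul_triple_add h4 s⟩
  · rintro rfl
    exact ⟨_, _, rfl, rfl, flowTo_triple_iff.2 rfl⟩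

lemma Bundle.mk_triple_add {a a' s : ℝ} {x y x' y' : ℍ}
    (h : Bundle.mk ρt (triple a x y) = Bundle.mk ρt (triple a' x' y')) :
    Bundle.mk ρt (triple (a + s) x y) = Bundle.mk ρt (triple (a' + s) x' y') := by
  obtain ⟨g, hg, h4⟩ := Bundle.mk_eq_iff.1 h
  exact Bundle.mk_eq_iff.2 ⟨g, hg, smul_triple_add h4 s⟩

lemma IsLift.smul_coords {ρl ρr : G →* PSL(2, ℝ)} (hρ : IsLift ρl ρr ρt) {g : UnivSL2 × UnivSL2}
    {τ : G} (hg : ρt τ = (QuotientGroup.mk g : Isom0)) (q : T1) :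
    (g • q).img = pslAct (ρl τ) q.img ∧ (g • q).ctr = pslAct (ρr τ) q.ctr := by
  obtain ⟨h1, h2⟩ := hρ τ g hg.symm
  rw [← h1, ← h2, proj_act, proj_act]
  exact ⟨smul_img g q, smul_ctr g q⟩

end BundlePoints

section SurfaceBundle

variable {S : Type*} [TopologicalSpace S] [ChartedSpace (EuclideanSpace ℝ (Fin 2)) S]
  {o : ∀ x : S, Orientation ℝ (TangentSpace (𝓡 2) x) (Fin 2)} {x₀ : S}
  {ρl ρr : FundamentalGroup S x₀ →* PSL(2, ℝ)} {ql qr : ℍ → S} {zl zr : ℍ}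
  {ρt : FundamentalGroup S x₀ →* Isom0}

/-- Two elements of the lifted group which send some point to points over the same point of the
hyperbolic plane act in the same way. -/
lemma IsLift.smul_eq_smul (hρ : IsLift ρl ρr ρt) (hl : IsFuchsian o ρl ql zl)
    {g g' : UnivSL2 × UnivSL2} (hg : g ∈ liftGroup ρt) (hg' : g' ∈ liftGroup ρt) {q : T1}
    (h : (g • q).img = (g' • q).img) (q' : T1) : g • q' = g' • q' := by
  obtain ⟨τ, hτ⟩ := hg
  obtain ⟨τ', hτ'⟩ := hg'
  rw [(hρ.smul_coords hτ q).1, (hρ.smul_coords hτ' q).1] at h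
  have e := hl.deck_unique h
  subst e
  have h1 : (QuotientGroup.mk (g'⁻¹ * g) : Isom0) = 1 := by
    rw [QuotientGroup.mk_mul, QuotientGroup.mk_inv, inv_mul_eq_one]
    exact hτ'.symm.trans hτ
  have h2 := smul_eq_self hρ h1 q'
  rwa [mul_smul, inv_smul_eq_iff] at h2

/-- The flow acts freely on the quotient: an element of the lifted group fixing `x` acts trivially,
since deck transformations are free. This makes the `t` in the definition of holonomy unique. -/
lemma IsLift.triple_time_inj (hρ : IsLift ρl ρr ρt) (hl : IsFuchsian o ρl ql zl) {t t' : ℝ}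
    {x y : ℍ} (h : Bundle.mk ρt (triple t x y) = Bundle.mk ρt (triple t' x y)) : t = t' := by
  obtain ⟨g, hg, h1⟩ := Bundle.mk_eq_iff.1 h
  have h2 := hρ.smul_eq_smul hl hg (one_mem _) (q := triple t x y) (by rw [h1]; simp)
    (triple t x y)
  rw [h1, one_smul] at h2
  simpa using (congrArg T1.time h2).symm

variable {Λ : S → S × S} {Λt : ℍ → ℍ × ℍ}

/-- Points of the fibre over `ql z`. -/
lemma IsLift.mem_fiber_iff (hρ : IsLift ρl ρr ρt) (hl : IsFuchsian o ρl ql zl)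
    (h : IsEquivariantLift ρl ρr ql qr Λ Λt) {z : ℍ} {p : Bundle ρt} :
    p ∈ fiber ρt ql Λt (ql z) ↔ ∃ k, p = Bundle.mk ρt (triple k (Λt z).1 (Λt z).2) := by
  constructor
  · rintro ⟨z', q, hz, rfl, hp⟩
    obtain ⟨τ, rfl⟩ := hl.exists_deck hz
    obtain ⟨g, hg⟩ := QuotientGroup.mk_surjective (ρt τ)
    have h1 := hρ.smul_coords hg.symm q
    obtain ⟨hi, hc⟩ := projectsTo_iff.1 hp
    rw [hi, hc] at h1
    refine ⟨(g • q).time, ?_⟩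
    rw [h.equivariant, ← h1.1, ← h1.2, triple_coords]
    exact (Bundle.mk_smul ⟨τ, hg.symm⟩ q).symm
  · rintro ⟨k, rfl⟩
    exact ⟨z, _, rfl, rfl, projectsTo_iff.2 ⟨by simp, by simp⟩⟩

/-- A continuous lift to `T1` of a family of points of the bundle is a translate of any other one,
given in coordinates. -/
lemma IsLift.exists_smul_eq (hρ : IsLift ρl ρr ρt) (hl : IsFuchsian o ρl ql zl) {M : Type*}
    [TopologicalSpace M] {A : Set M} {m : M} (hm : m ∈ A) {F : M → T1} {k : M → ℝ} {x y : M → ℍ}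
    (hF : ContinuousWithinAt F A m) (hx : ContinuousWithinAt x A m)
    (h : ∀ᶠ s in 𝓝[A] m, Bundle.mk ρt (F s) = Bundle.mk ρt (triple (k s) (x s) (y s))) :
    ∃ g ∈ liftGroup ρt, ∀ᶠ s in 𝓝[A] m, g • F s = triple (k s) (x s) (y s) := by
  obtain ⟨g, hg, h1⟩ := Bundle.mk_eq_iff.1 (h.self_of_nhdsWithin hm)
  refine ⟨g, hg, ?_⟩
  -- The element `g` is fixed by the equation at `m`. Near `m`, `(g • F s).img` and `x s` are lifts
  -- of one map to `S` that agree at `m`, so the element needed at `s` acts as `g` does.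
  have hql : ∀ g ∈ liftGroup ρt, ∀ q : T1, ql (g • q).img = ql q.img := by
    rintro g ⟨τ, hτ⟩ q
    rw [(hρ.smul_coords hτ q).1, hl.deck]
  have h2 : ∀ᶠ s in 𝓝[A] m, (g • F s).img = x s := by
    refine hl.eventually_eq ((T1.continuous_img.comp (continuous_smul_T1 g)).continuousAt
      |>.comp_continuousWithinAt hF) hx ?_ ?_
    · simp only [h1, triple_img]
    · filter_upwards [h] with s hs
      obtain ⟨g', hg', h3⟩ := Bundle.mk_eq_iff.1 hs
      have h4 := hql g' hg' (F s)
      rw [h3, triple_img] at h4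
      rw [h4]
      exact hql g hg (F s)
  filter_upwards [h, h2] with s hs hs2
  obtain ⟨g', hg', h3⟩ := Bundle.mk_eq_iff.1 hs
  rw [← h3]
  exact hρ.smul_eq_smul hl hg hg' (q := F s) (by rw [hs2, h3, triple_img]) (F s)

end SurfaceBundle

section CurvesInBundle

variable {S : Type*} [TopologicalSpace S] [ChartedSpace (EuclideanSpace ℝ (Fin 2)) S]
  {o : ∀ x : S, Orientation ℝ (TangentSpace (𝓡 2) x) (Fin 2)} {x₀ : S}
  {ρl ρr : FundamentalGroup S x₀ →* PSL(2, ℝ)} {ql qr : ℍ → S} {zl zr : ℍ}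
  {ρt : FundamentalGroup S x₀ →* Isom0}
  {E H M : Type*} [NormedAddCommGroup E] [NormedSpace ℝ E] [TopologicalSpace H]
  {I : ModelWithCorners ℝ E H} [TopologicalSpace M] [ChartedSpace H M]

/-! ### Curves in the principal bundle -/

lemma isLocalLift_triple {G : Type*} [Group G] {ρt : G →* Isom0} {k : ℝ → ℝ} {x y : ℝ → ℍ} {A : Set ℝ} {p : ℝ → Bundle ρt}
    (hk : ContDiffOn ℝ 1 k A) (hx : ContDiffOn ℝ 1 (fun s => (x s : ℂ)) A)
    (hy : ContDiffOn ℝ 1 (fun s => (y s : ℂ)) A)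
    (hp : ∀ s ∈ A, p s = Bundle.mk ρt (triple (k s) (x s) (y s))) (s : ℝ) :
    IsLocalLift 𝓘(ℝ, ℝ) 1 p A s fun s => triple (k s) (x s) (y s) := by
  refine ⟨Set.univ, isOpen_univ, trivial, fun y hy => (hp y hy.1).symm, ?_, ?_⟩
  · rw [Set.inter_univ]
    exact continuous_triple.comp_continuousOn (f := fun s => (k s, x s, y s)) (hk.continuousOn.prodMk
      ((continuousOn_uhp hx.continuousOn).prodMk (continuousOn_uhp hy.continuousOn)))
  · rw [Set.inter_univ, contMDiffOn_iff_contDiffOn]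
    exact contDiffOn_triple hk hx hy

/-- The time coordinate of a `C¹` curve in the bundle is `C¹`. -/
lemma IsLift.contDiffOn_time (hρ : IsLift ρl ρr ρt) (hl : IsFuchsian o ρl ql zl)
    {k : ℝ → ℝ} {x y : ℝ → ℍ} {A : Set ℝ} {p : ℝ → Bundle ρt}
    (hp : Bundle.ContMDiffOn 𝓘(ℝ, ℝ) 1 p A) (hx : ContinuousOn x A)
    (h : ∀ s ∈ A, p s = Bundle.mk ρt (triple (k s) (x s) (y s))) : ContDiffOn ℝ 1 k A := by
  intro s hs
  obtain ⟨F, O, hO, hsO, hF, hFc, hFd⟩ := hp s hs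
  have hAO : A ∩ O ∈ 𝓝[A] s := inter_mem_nhdsWithin A (hO.mem_nhds hsO)
  obtain ⟨g, -, hg⟩ := hρ.exists_smul_eq hl hs
    ((hFc s ⟨hs, hsO⟩).mono_of_mem_nhdsWithin hAO) (hx s hs)
    (k := k) (y := y) (by
      filter_upwards [hAO] with t ht
      rw [hF t ht, h t ht.1])
  have h1 : ContDiffOn ℝ 1 (fun t => (g • F t).time) (A ∩ O) := by
    refine AdS.contDiffOn_time (F := fun t => g • F t)
      ((continuous_smul_T1 g).comp_continuousOn hFc) ?_
    exact (isomDiffL g).contDiff.comp_contDiffOn (contMDiffOn_iff_contDiffOn.1 hFd)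
  refine ((h1 s ⟨hs, hsO⟩).mono_of_mem_nhdsWithin hAO).congr_of_eventuallyEq_of_mem ?_ hs
  filter_upwards [hg] with t ht
  rw [ht, triple_time]

lemma Bundle.ContMDiffOn.comp_curve {G : Type*} [Group G] {ρt : G →* Isom0} {f : M → Bundle ρt} {B : Set M} {c : ℝ → M} {A : Set ℝ}
    (hf : Bundle.ContMDiffOn I 1 f B) (hc : _root_.ContMDiffOn 𝓘(ℝ, ℝ) I 1 c A) (hcB : Set.MapsTo c A B) :
    Bundle.ContMDiffOn 𝓘(ℝ, ℝ) 1 (fun s => f (c s)) A := by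
  intro s hs
  obtain ⟨F, O, hO, hsO, hF, hFc, hFd⟩ := hf (c s) (hcB hs)
  obtain ⟨u, hu, hu'⟩ := continuousOn_iff'.1 hc.continuousOn O hO
  have hm : Set.MapsTo c (A ∩ u) (B ∩ O) := fun t ht =>
    ⟨hcB ht.1, (hu'.ge ⟨ht.2, ht.1⟩).1⟩
  exact ⟨F ∘ c, u, hu, (hu'.le ⟨hsO, hs⟩).1, fun t ht => hF _ (hm ht),
    hFc.comp (hc.continuousOn.mono Set.inter_subset_left) hm,
    hFd.comp (hc.mono Set.inter_subset_left) hm⟩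

/-- The connection form along a curve, in coordinates. -/
lemma IsLift.pullbackForm_curve (hρ : IsLift ρl ρr ρt) (hl : IsFuchsian o ρl ql zl)
    {f : M → Bundle ρt} {B : Set M} {c : ℝ → M} {k : ℝ → ℝ} {x y : ℝ → ℍ} {A : Set ℝ} {s : ℝ}
    (hs : s ∈ A) (hA : UniqueDiffWithinAt ℝ A s) (hcB : Set.MapsTo c A B)
    (hc : MDifferentiableWithinAt 𝓘(ℝ, ℝ) I c A s)
    (hf : ∃ F : M → T1, IsLocalLift I 1 f B (c s) F)
    (h : ∀ s ∈ A, f (c s) = Bundle.mk ρt (triple (k s) (x s) (y s)))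
    {k' : ℝ} {x' y' : ℂ} (hk : HasDerivWithinAt k k' A s)
    (hx : HasDerivWithinAt (fun s => (x s : ℂ)) x' A s)
    (hy : HasDerivWithinAt (fun s => (y s : ℂ)) y' A s) :
    Bundle.pullbackForm I f B (c s) (mfderivWithin 𝓘(ℝ, ℝ) I c A s (1 : ℝ)) =
      k' + 1 / 2 * (x'.re / (x s).im - y'.re / (y s).im) := by
  obtain ⟨D, hD, hD'⟩ := exists_hasDerivWithinAt_triple hk hx hy
  rw [Bundle.pullbackForm, dif_pos hf]
  obtain ⟨O, hO, hsO, hF, hFc, hFd⟩ := hf.choose_spec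
  -- The computation applies to any local lift, so the choice in `pullbackForm` is immaterial.
  generalize hf.choose = F at *
  have hBO : B ∩ O ∈ 𝓝[B] (c s) := inter_mem_nhdsWithin B (hO.mem_nhds hsO)
  have hcs : c s ∈ B ∩ O := ⟨hcB hs, hsO⟩
  have hFc' : ContinuousWithinAt F B (c s) := (hFc _ hcs).mono_of_mem_nhdsWithin hBO
  have htend : Filter.Tendsto c (𝓝[A] s) (𝓝[B] (c s)) :=
    hc.continuousWithinAt.tendsto_nhdsWithin hcB
  have hxc : ContinuousWithinAt x A s :=
    UpperHalfPlane.isOpenEmbedding_coe.isEmbedding.continuousWithinAt_iff.2 hx.continuousWithinAt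
  obtain ⟨g, -, hg⟩ := hρ.exists_smul_eq hl hs (F := F ∘ c)
    (hFc'.comp hc.continuousWithinAt hcB) hxc (k := k) (y := y) (by
      filter_upwards [htend.eventually hBO, self_mem_nhdsWithin] with t ht htA
      rw [← h t htA]
      exact hF _ ht)
  have h1 : MDifferentiableWithinAt I 𝓘(ℝ, Coord) (fun y => (F y).coord) B (c s) :=
    (mdifferentiableWithinAt_inter (hO.mem_nhds hsO)).1
      ((hFd _ hcs).mdifferentiableWithinAt (by simp))
  have h2 := HasMFDerivWithinAt.comp s h1.hasMFDerivWithinAt hc.hasMFDerivWithinAt hcB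
  obtain ⟨L, h3, hL⟩ : ∃ L : ℝ →L[ℝ] Coord,
      HasFDerivWithinAt (fun t => (F (c t)).coord) L A s ∧ L 1 =
        mfderivWithin I 𝓘(ℝ, Coord) (fun y => (F y).coord) B (c s)
          (mfderivWithin 𝓘(ℝ, ℝ) I c A s (1 : ℝ)) :=
    ⟨_, hasMFDerivWithinAt_iff_hasFDerivWithinAt.1 h2, rfl⟩
  have h4 := (isomDiffL g).hasFDerivAt.comp_hasDerivWithinAt s h3.hasDerivWithinAt
  have h5 : HasDerivWithinAt (fun s => (triple (k s) (x s) (y s)).coord) _ A s :=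
    h4.congr_of_eventuallyEq_of_mem (by
      filter_upwards [hg] with t ht
      rw [← ht]
      rfl) hs
  -- The coordinate curve has one derivative, computed both explicitly and by moving the local lift
  -- with the isometry `g`; invariance of `ω` under `g` concludes.
  have h6 := hA.eq_deriv _ hD h5
  have h7 := hg.self_of_nhdsWithin hs
  rw [← hD', h6, ← h7, ← hL]
  exact (connForm_smul g (F (c s)) _).symm

end CurvesInBundle

/-! ### Sections and holonomy -/

lemma Bundle.ContMDiffOn.of_le {G : Type*} [Group G] {ρt : G →* Isom0} {E H M : Type*}
    [NormedAddCommGroup E] [NormedSpace ℝ E] [TopologicalSpace H] {I : ModelWithCorners ℝ E H}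
    [TopologicalSpace M] [ChartedSpace H M] {f : M → Bundle ρt} {A : Set M} {m n : ℕ∞ω}
    (hf : Bundle.ContMDiffOn I n f A) (hmn : m ≤ n) : Bundle.ContMDiffOn I m f A := by
  intro x hx
  obtain ⟨F, O, hO, hxO, h1, h2, h3⟩ := hf x hx
  exact ⟨F, O, hO, hxO, h1, h2, _root_.ContMDiffOn.of_le h3 hmn⟩

section Holonomy

variable {S : Type*} [TopologicalSpace S] [ChartedSpace (EuclideanSpace ℝ (Fin 2)) S]
  {o : ∀ x : S, Orientation ℝ (TangentSpace (𝓡 2) x) (Fin 2)} {x₀ : S}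
  {ρl ρr : FundamentalGroup S x₀ →* PSL(2, ℝ)} {ql qr : ℍ → S} {zl zr : ℍ}
  {ρt : FundamentalGroup S x₀ →* Isom0} {Λ : S → S × S} {Λt : ℍ → ℍ × ℍ}
  {h₁ : ℍ → ℝ}

/-- The connection form along a curve over the lift `Λt`. -/
lemma IsLift.pullbackForm_eq_derivWithin (hρ : IsLift ρl ρr ρt) (hl : IsFuchsian o ρl ql zl)
    (h₁d : IsPrimitive Λt h₁) {E H M : Type*} [NormedAddCommGroup E] [NormedSpace ℝ E]
    [TopologicalSpace H] {I : ModelWithCorners ℝ E H} [TopologicalSpace M] [ChartedSpace H M]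
    {f : M → Bundle ρt} {B : Set M} {c : ℝ → M} {k : ℝ → ℝ} {Γ : ℝ → ℍ}
    (hc : ContMDiffOn 𝓘(ℝ, ℝ) I 1 c (Set.Icc 0 1)) (hcB : Set.MapsTo c (Set.Icc 0 1) B)
    (hf : Bundle.ContMDiffOn I 1 f B)
    (h : ∀ s ∈ Set.Icc (0 : ℝ) 1,
      f (c s) = Bundle.mk ρt (triple (k s) (Λt (Γ s)).1 (Λt (Γ s)).2))
    (hk : ContDiffOn ℝ 1 k (Set.Icc 0 1))
    (hΓ : ContDiffOn ℝ 1 (fun s => (Γ s : ℂ)) (Set.Icc 0 1)) {s : ℝ} (hs : s ∈ Set.Icc (0 : ℝ) 1) :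
    Bundle.pullbackForm I f B (c s) (mfderivWithin 𝓘(ℝ, ℝ) I c (Set.Icc 0 1) s (1 : ℝ)) =
      derivWithin (fun s => k s + h₁ (Γ s)) (Set.Icc 0 1) s := by
  have hu := uniqueDiffOn_Icc (zero_lt_one (α := ℝ)) s hs
  have hkd := (hk.differentiableOn (by simp) s hs).hasDerivWithinAt
  obtain ⟨x', y', hx, hy, hh⟩ := h₁d.hasDeriv Γ (Set.Icc 0 1) s _
    (hΓ.differentiableOn (by simp) s hs).hasDerivWithinAt
  exact (hρ.pullbackForm_curve hl hs hu hcB ((hc s hs).mdifferentiableWithinAt (by simp))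
    (hf _ (hcB hs)) h hkd hx hy).trans ((hkd.add hh).derivWithin hu).symm

lemma IsLift.pullbackForm_path (hρ : IsLift ρl ρr ρt) (hl : IsFuchsian o ρl ql zl)
    (h₁d : IsPrimitive Λt h₁) {p : ℝ → Bundle ρt} {k : ℝ → ℝ} {Γ : ℝ → ℍ}
    (hp : Bundle.ContMDiffOn 𝓘(ℝ, ℝ) 1 p (Set.Icc 0 1))
    (h : ∀ s ∈ Set.Icc (0 : ℝ) 1,
      p s = Bundle.mk ρt (triple (k s) (Λt (Γ s)).1 (Λt (Γ s)).2))
    (hk : ContDiffOn ℝ 1 k (Set.Icc 0 1))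
    (hΓ : ContDiffOn ℝ 1 (fun s => (Γ s : ℂ)) (Set.Icc 0 1)) {s : ℝ} (hs : s ∈ Set.Icc (0 : ℝ) 1) :
    Bundle.pullbackForm 𝓘(ℝ, ℝ) p (Set.Icc 0 1) s (1 : ℝ) =
      derivWithin (fun s => k s + h₁ (Γ s)) (Set.Icc 0 1) s := by
  have hu := uniqueDiffOn_Icc (zero_lt_one (α := ℝ)) s hs
  have := hρ.pullbackForm_eq_derivWithin (I := 𝓘(ℝ, ℝ)) (c := id) hl h₁d contMDiffOn_id
    (Set.mapsTo_id _) hp h hk hΓ hs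
  rwa [mfderivWithin_id hu.uniqueMDiffWithinAt] at this

lemma IsFuchsian.contMDiffOn_proj (hl : IsFuchsian o ρl ql zl) {Γ : ℝ → ℍ} {A : Set ℝ}
    (hΓ : ContDiffOn ℝ 1 (fun s => (Γ s : ℂ)) A) :
    ContMDiffOn 𝓘(ℝ, ℝ) (𝓡 2) 1 (fun s => ql (Γ s)) A :=
  (hl.localDiffeo.contMDiff.of_le (by simp)).comp_contMDiffOn (contMDiffOn_curve_iff.2 hΓ)

/-- A curve in `S` along which a section is evaluated gives a `C¹` time coordinate. -/
lemma IsSmoothSection.contDiffOn_time (hρ : IsLift ρl ρr ρt) (hl : IsFuchsian o ρl ql zl)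
    (hΛt : IsEquivariantLift ρl ρr ql qr Λ Λt) {f : S → Bundle ρt}
    (hf : IsSmoothSection (fiber ρt ql Λt) f) {k : ℍ → ℝ}
    (hk : ∀ z, f (ql z) = Bundle.mk ρt (triple (k z) (Λt z).1 (Λt z).2)) {Γ : ℝ → ℍ} {A : Set ℝ}
    (hΓ : ContDiffOn ℝ 1 (fun s => (Γ s : ℂ)) A) : ContDiffOn ℝ 1 (fun s => k (Γ s)) A :=
  hρ.contDiffOn_time hl
    ((hf.smooth.of_le (by simp)).comp_curve (hl.contMDiffOn_proj hΓ) (Set.mapsTo_univ _ _))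
    ((continuous_fst.comp hΛt.continuous).comp_continuousOn (continuousOn_uhp hΓ.continuousOn))
    fun s _ => hk (Γ s)

/-- The time coordinate of a section, corrected by the primitive of the connection form, changes by
constants under deck transformations. -/
lemma IsSmoothSection.sub_deck_eq (hρ : IsLift ρl ρr ρt) (hl : IsFuchsian o ρl ql zl)
    (hΛt : IsEquivariantLift ρl ρr ql qr Λ Λt) (h₁d : IsPrimitive Λt h₁) {f : S → Bundle ρt}
    (hf : IsSmoothSection (fiber ρt ql Λt) f) {k : ℍ → ℝ}
    (hk : ∀ z, f (ql z) = Bundle.mk ρt (triple (k z) (Λt z).1 (Λt z).2))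
    (τ : FundamentalGroup S x₀) (z w : ℍ) :
    k w + h₁ w - (k (pslAct (ρl τ) w) + h₁ (pslAct (ρl τ) w)) =
      k z + h₁ z - (k (pslAct (ρl τ) z) + h₁ (pslAct (ρl τ) z)) := by
  -- Along the segment from `z` to `w` and along its translate, the section gives the same curve in
  -- the bundle; both corrected times thus have its connection form as derivative.
  have hΓ : ContDiffOn ℝ 1 (fun s => (seg z w s : ℂ)) (Set.Icc 0 1) := contDiffOn_seg z w
  have hΓ' : ContDiffOn ℝ 1 (fun s => (pslAct (ρl τ) (seg z w s) : ℂ)) (Set.Icc 0 1) := by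
    rw [← contMDiffOn_curve_iff (f := fun s => pslAct (ρl τ) (seg z w s))]
    refine hl.contMDiffOn_lift (by simp)
      ((continuous_pslAct _).comp_continuousOn (continuousOn_uhp hΓ.continuousOn)) ?_
    simp only [hl.deck]
    exact hl.contMDiffOn_proj hΓ
  have hp : Bundle.ContMDiffOn 𝓘(ℝ, ℝ) 1 (fun s => f (ql (seg z w s))) (Set.Icc 0 1) :=
    (hf.smooth.of_le (by simp)).comp_curve (hl.contMDiffOn_proj hΓ) (Set.mapsTo_univ _ _)
  have hc := hf.contDiffOn_time hρ hl hΛt hk hΓ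
  have hc' := hf.contDiffOn_time hρ hl hΛt hk hΓ'
  have hd := (hc.add (h₁d.contDiffOn _ _ hΓ)).differentiableOn (by simp)
  have hd' := (hc'.add (h₁d.contDiffOn _ _ hΓ')).differentiableOn (by simp)
  have := constant_of_derivWithin_zero (hd.sub hd') (fun s hs => ?_) 1 (by simp)
  · simpa [seg_zero, seg_one] using this
  · replace hs := Set.Ico_subset_Icc_self hs
    have e1 := hρ.pullbackForm_path hl h₁d hp (fun s _ => hk _) hc hΓ hs
    have e2 := hρ.pullbackForm_path hl h₁d hp
      (fun s _ => by rw [← hl.deck τ]; exact hk _) hc' hΓ' hs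
    rw [derivWithin_sub (hd s hs) (hd' s hs), sub_eq_zero]
    exact e1.symm.trans e2

/-- Multiplicativity comes from independence of the base point: for `τ * σ` the change telescopes
through `σ zl`, where the constant of `τ` may be evaluated. -/
lemma IsSmoothSection.exists_period (hρ : IsLift ρl ρr ρt) (hl : IsFuchsian o ρl ql zl)
    (hΛt : IsEquivariantLift ρl ρr ql qr Λ Λt) (h₁d : IsPrimitive Λt h₁) {f : S → Bundle ρt}
    (hf : IsSmoothSection (fiber ρt ql Λt) f) {k : ℍ → ℝ}
    (hk : ∀ z, f (ql z) = Bundle.mk ρt (triple (k z) (Λt z).1 (Λt z).2)) :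
    ∃ hol : FundamentalGroup S x₀ →* Multiplicative ℝ, ∀ τ z, (hol τ).toAdd =
      k z + h₁ z - (k (pslAct (ρl τ) z) + h₁ (pslAct (ρl τ) z)) := by
  have key := hf.sub_deck_eq hρ hl hΛt h₁d hk
  refine ⟨MonoidHom.mk' (fun τ => Multiplicative.ofAdd
    (k zl + h₁ zl - (k (pslAct (ρl τ) zl) + h₁ (pslAct (ρl τ) zl)))) fun τ σ => ?_,
    fun τ z => (key τ zl z).symm⟩
  rw [← ofAdd_add, map_mul, map_mul, Equiv.Perm.mul_apply]
  refine congrArg Multiplicative.ofAdd ?_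
  linarith [key τ zl (pslAct (ρl σ) zl)]

/-- The parallel transport along a `C¹` loop. -/
lemma IsSmoothSection.isHolonomy (hρ : IsLift ρl ρr ρt) (hl : IsFuchsian o ρl ql zl)
    (hr : IsFuchsian o ρr qr zr) (hΛ : IsLagrangianIsotopicToDiag ql qr Λ)
    (hΛt : IsEquivariantLift ρl ρr ql qr Λ Λt) (h₁d : IsPrimitive Λt h₁) {f : S → Bundle ρt}
    {k : ℍ → ℝ}
    (hk : ∀ z, f (ql z) = Bundle.mk ρt (triple (k z) (Λt z).1 (Λt z).2))
    {hol : FundamentalGroup S x₀ →* Multiplicative ℝ} (hhol : ∀ τ z, (hol τ).toAdd =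
      k z + h₁ z - (k (pslAct (ρl τ) z) + h₁ (pslAct (ρl τ) z))) :
    IsHolonomy (fiber ρt ql Λt) hol := by
  intro l hlC
  obtain ⟨Γ, hΓ, h0, hΓl, hΓ1⟩ := hl.exists_C1_lift hlC
  obtain ⟨hx, hy⟩ := hΛt.contDiffOn_curve hl hr hΛ hΓ
  have hh := h₁d.contDiffOn Γ _ hΓ
  constructor
  · have hp : Bundle.ContMDiffOn 𝓘(ℝ, ℝ) 1
        -- Time `-h₁` makes `t + h₁` vanish identically, so this curve is parallel.
        (fun s => Bundle.mk ρt (triple (-h₁ (Γ s)) (Λt (Γ s)).1 (Λt (Γ s)).2)) (Set.Icc 0 1) :=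
      fun s _ => ⟨_, isLocalLift_triple hh.neg hx hy (fun s _ => rfl) s⟩
    refine ⟨_, fun s hs => ?_, hp, fun s hs => ?_⟩
    · rw [← hΓl s hs]
      exact (hρ.mem_fiber_iff hl hΛt).2 ⟨_, rfl⟩
    · rw [hρ.pullbackForm_path hl h₁d hp (fun s _ => rfl) hh.neg hΓ hs]
      simp
  · intro p hp t
    have hex : ∀ s ∈ Set.Icc (0 : ℝ) 1,
        ∃ κ, p s = Bundle.mk ρt (triple κ (Λt (Γ s)).1 (Λt (Γ s)).2) := fun s hs => by
      have := hp.mem s hs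
      rw [← hΓl s hs] at this
      exact (hρ.mem_fiber_iff hl hΛt).1 this
    choose! κ hκ using hex
    have hκc := hρ.contDiffOn_time hl hp.smooth (continuousOn_uhp hx.continuousOn) hκ
    have hconst := constant_of_derivWithin_zero ((hκc.add hh).differentiableOn (by simp))
      (fun s hs => (hρ.pullbackForm_path hl h₁d hp.smooth hκ hκc hΓ
        (Set.Ico_subset_Icc_self hs)).symm.trans (hp.parallel s (Set.Ico_subset_Icc_self hs)))
      1 (by simp)
    have hm0 : (0 : ℝ) ∈ Set.Icc (0 : ℝ) 1 := by simp
    have hm1 : (1 : ℝ) ∈ Set.Icc (0 : ℝ) 1 := by simp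
    -- The section takes one value at both ends of the loop. Flowing it for time `κ 0 - k (Γ 0)`
    -- rewrites `p 0` over `Γ 1`, where its time can be compared with that of `p 1`.
    have hq : f (ql (Γ 0)) = f (ql (Γ 1)) := by rw [hΓl 0 hm0, hΓl 1 hm1]; simp
    rw [hk, hk] at hq
    have hq' := Bundle.mk_triple_add (s := κ 0 - k (Γ 0)) hq
    rw [add_sub_cancel, ← hκ 0 hm0] at hq'
    rw [hκ 1 hm1, Bundle.flowTo_mk_triple, hq']
    have hlc := hhol (loopClass l) (Γ 1)
    rw [hΓ1, ← h0] at hlc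
    change _ ↔ t = (hol (loopClass l)).toAdd
    rw [hlc]
    constructor
    · intro h
      have := hρ.triple_time_inj hl h
      linarith
    · rintro rfl
      congr 2
      linarith

/-- The integrand is the derivative of `k + h₁` along the lift `Γ`. The deck transformation sends `Γ
1` back to `Γ 0`, so the increment has exactly the sign of the period. -/
lemma IsSmoothSection.integralAlong_eq (hρ : IsLift ρl ρr ρt) (hl : IsFuchsian o ρl ql zl)
    (hΛt : IsEquivariantLift ρl ρr ql qr Λ Λt) (h₁d : IsPrimitive Λt h₁) {f : S → Bundle ρt}
    (hf : IsSmoothSection (fiber ρt ql Λt) f) {k : ℍ → ℝ}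
    (hk : ∀ z, f (ql z) = Bundle.mk ρt (triple (k z) (Λt z).1 (Λt z).2))
    {hol : FundamentalGroup S x₀ →* Multiplicative ℝ} (hhol : ∀ τ z, (hol τ).toAdd =
      k z + h₁ z - (k (pslAct (ρl τ) z) + h₁ (pslAct (ρl τ) z)))
    {l : Path x₀ x₀} (hlC : IsC1Loop l) : (hol (loopClass l)).toAdd = integralAlong f l := by
  obtain ⟨Γ, hΓ, h0, hΓl, hΓ1⟩ := hl.exists_C1_lift hlC
  have hc := hf.contDiffOn_time hρ hl hΛt hk hΓ
  have hH := hc.add (h₁d.contDiffOn Γ _ hΓ)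
  have h2 := intervalIntegral.integral_derivWithin_Icc_of_contDiffOn_Icc hH zero_le_one
  have hlc := hhol (loopClass l) (Γ 1)
  rw [hΓ1, ← h0] at hlc
  rw [hlc, integralAlong]
  refine Eq.trans h2.symm (intervalIntegral.integral_congr fun s hs => ?_)
  rw [Set.uIcc_of_le zero_le_one] at hs
  exact (hρ.pullbackForm_eq_derivWithin hl h₁d hlC (Set.mapsTo_univ _ _)
    (hf.smooth.of_le (by simp)) (fun s hs => by rw [← hΓl s hs]; exact hk _) hc hΓ hs).symm

/-- Each class has a `C¹` representative carrying a parallel section, and the equivalence in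
`IsHolonomy` then fixes the value. -/
lemma IsHolonomy.unique {B : S → Set (Bundle ρt)} (hl : IsFuchsian o ρl ql zl)
    {hol hol' : FundamentalGroup S x₀ →* Multiplicative ℝ} (h : IsHolonomy B hol)
    (h' : IsHolonomy B hol') : hol = hol' := by
  ext τ
  obtain ⟨l, hlC, rfl⟩ := hl.exists_C1_loop τ
  obtain ⟨⟨p, hp⟩, h1⟩ := h l hlC
  exact ((h' l hlC).2 p hp _).1 ((h1 p hp _).2 rfl)

end Holonomy

end AdS

/-! ### The main theorem -/

theorem mainTheorem6 {S : Type*} [TopologicalSpace S] [T2Space S] [CompactSpace S]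
    [ConnectedSpace S] [ChartedSpace (EuclideanSpace ℝ (Fin 2)) S] [IsManifold (𝓡 2) ∞ S]
    (o : ∀ x : S, Orientation ℝ (TangentSpace (𝓡 2) x) (Fin 2)) (x₀ : S)
    (ρl ρr : FundamentalGroup S x₀ →* PSL(2, ℝ)) (ql qr : ℍ → S) (zl zr : ℍ)
    (hl : AdS.IsFuchsian o ρl ql zl) (hr : AdS.IsFuchsian o ρr qr zr)
    (ρt : FundamentalGroup S x₀ →* AdS.Isom0) (hρ : AdS.IsStandardLift ρl ρr ρt)
    (Λ : S → S × S) (hΛ : AdS.IsLagrangianIsotopicToDiag ql qr Λ) :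
    (∃ Λt : ℍ → ℍ × ℍ, AdS.IsEquivariantLift ρl ρr ql qr Λ Λt) ∧
    ∀ Λt : ℍ → ℍ × ℍ, AdS.IsEquivariantLift ρl ρr ql qr Λ Λt →
      ∀ f : S → AdS.Bundle ρt, AdS.IsSmoothSection (AdS.fiber ρt ql Λt) f →
        (∃! hol : FundamentalGroup S x₀ →* Multiplicative ℝ,
          AdS.IsHolonomy (AdS.fiber ρt ql Λt) hol) ∧
        ∀ hol : FundamentalGroup S x₀ →* Multiplicative ℝ,
          AdS.IsHolonomy (AdS.fiber ρt ql Λt) hol →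
            ∀ (τ : FundamentalGroup S x₀) (l : Path x₀ x₀), AdS.IsC1Loop l →
              FundamentalGroup.fromPath (Path.Homotopic.Quotient.mk l) = τ →
                (hol τ).toAdd = AdS.integralAlong f l := by
  refine ⟨AdS.exists_isEquivariantLift hl hr hΛ, fun Λt hΛt f hf => ?_⟩
  obtain ⟨h₁, h₁d⟩ := hΛt.exists_isPrimitive hl hr hΛ
  have hex : ∀ z, ∃ k, f (ql z) = AdS.Bundle.mk ρt (AdS.triple k (Λt z).1 (Λt z).2) := fun z =>
    (hρ.1.mem_fiber_iff hl hΛt).1 (hf.mem (ql z))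
  -- A pointwise choice suffices: regularity of `k` along curves is recovered from smoothness of the
  -- section by `IsSmoothSection.contDiffOn_time`.
  choose k hk using hex
  obtain ⟨hol, hhol⟩ := hf.exists_period hρ.1 hl hΛt h₁d hk
  have hH := AdS.IsSmoothSection.isHolonomy hρ.1 hl hr hΛ hΛt h₁d hk hhol
  refine ⟨⟨hol, hH, fun hol' h' => h'.unique hl hH⟩, fun hol' h' τ l hlC hτ => ?_⟩
  subst hτ
  rw [h'.unique hl hH]
  exact hf.integralAlong_eq hρ.1 hl hΛt h₁d hk hhol hlC
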